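/- Let $G$ be a connected (finite-dimensional, real) Lie group with Lie algebra $\mathfrak g=T_1G$, equipped with a left-invariant Riemannian metric and a left Haar measure $\mu$ (the Riemannian volume up to scale), and let $1\le p<\infty$. All function spaces consist of real functions modulo $\mu$-a.e. equality, differentials are taken in the sense of distributions, and "a function with $L^p$ gradient" means a locally integrable $u$ with $du\in L^p$. Let $\xi_0\in\mathfrak g$ be such that the corresponding left-invariant vector field has positive divergence with respect to $\mu$; equivalently, right translation $R_{\exp(t\xi_0)}$ multiplies volumes by $e^{t\tau}$ with $\tau>0$. (Such a $\xi_0$ exists exactly when $G$ is not unimodular.) Let $H^{1,p}(G)$ be the quotient of the space of closed $L^p$ one-forms by the space $\{du: u\in L^p,\ du\in L^p\}$, and let $T^{1,p}(G)\subset H^{1,p}(G)$ be the subspace of classes of $L^p$-limits of elements of the latter space. Let $B$ be the open unit ball centred at $1$, and let $d^{-1}dL^p(G)$ be the space of locally $L^p$ functions $f$ on $G$ with $\int_G\inf_{c\in\mathbb R}\|f-c\|_{L^p(gB)}^p\,d\mu(g)<\infty$. Let $(L^p+dL^p)(G)$ be the space of one-forms with distribution coefficients of the form $\beta+d\gamma$,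 with $\beta$ an $L^p$ one-form and $\gamma$ an $L^p$ function. Put $$\mathcal B^p_{\xi_0}=\{w\in d^{-1}dL^p(G): w\circ R_{\exp(t\xi_0)}=w \text{ a.e., for every } t\in\mathbb R\}.$$ Then every closed $L^p$ one-form on $G$ is the differential of a function with $L^p$ gradient. For every function $u$ with $L^p$ gradient there is a function $u_\infty$, unique up to a.e. equality, such that $\|u\circ R_{\exp(t\xi_0)}-u_\infty\|_{L^p}\to0$ as $t\to+\infty$; moreover, after modifying $u$ on a null set, $u(x\exp(t\xi_0))\to u_\infty(x)$ as $t\to+\infty$ for almost every $x$. One has $u_\infty\in\mathcal B^p_{\xi_0}$. Furthermore: 1. The map $u\mapsto u_\infty$ induces a well-defined injective linear map $[du]\mapsto u_\infty$ from $H^{1,p}(G)$ to $d^{-1}dL^p(G)$ modulo constants, whose image is exactly $\mathcal B^p_{\xi_0}$ modulo constants. 2. The map $du\mapsto du_\infty$ induces a well-defined injective linear map $H^{1,p}(G)\to(L^p+dL^p)(G)$, whose image is $$d\mathcal B^p_{\xi_0}=\{\alpha\in(L^p+dL^p)(G): d\alpha=0 \text{ and } \alpha(\xi_0)=0 \text{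 in the sense of distributions}\}.$$ 3. $T^{1,p}(G)=0$. -/

import Mathlib

open MeasureTheory Filter Manifold Bundle
open scoped Manifold Topology ENNReal ContDiff

noncomputable section

namespace LpCohomology

/-! ### Left-invariant vector fields, test functions, divergence, exponential -/

section Calculus

variable (E : Type*) [NormedAddCommGroup E] [NormedSpace ℝ E]
  (G : Type*) [TopologicalSpace G] [ChartedSpace E G]

/-- The space of smooth compactly supported real functions on `G`. -/
def TestFunction : Submodule ℝ (G → ℝ) where
  carrier := {φ | ContMDiff 𝓘(ℝ, E) 𝓘(ℝ, ℝ) ∞ φ ∧ HasCompactSupport φ}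
  zero_mem' := ⟨contMDiff_const, HasCompactSupport.zero⟩
  add_mem' := fun hf hg => ⟨hf.1.add hg.1, hf.2.add hg.2⟩
  smul_mem' := fun c _ hf => ⟨(contDiff_const_smul c).contMDiff.comp hf.1, hf.2.smul_left (f := fun _ => c)⟩

variable {E G}
variable [Group G]

/-- The one-parameter subgroup `t ↦ exp (t ξ)`: the integral curve through `1` of the
left-invariant vector field of `ξ`. -/
def expCurve (ξ : GroupLieAlgebra 𝓘(ℝ, E) G) : ℝ → G :=
  open Classical in
  if h : ∃ γ : ℝ → G, γ 0 = 1 ∧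
      IsMIntegralCurve (I := 𝓘(ℝ, E)) γ (mulInvariantVectorField ξ) then h.choose
  else fun _ => 1

variable [LieGroup 𝓘(ℝ, E) ∞ G]

/-- Left-invariant vector fields on a smooth Lie group are smooth. -/
theorem contMDiff_leftInvariant (v : GroupLieAlgebra 𝓘(ℝ, E) G) :
    ContMDiff 𝓘(ℝ, E) 𝓘(ℝ, E).tangent ∞
      (fun g : G => (mulInvariantVectorField v g : TangentBundle 𝓘(ℝ, E) G)) := by
  let fg : G → TangentBundle 𝓘(ℝ, E) G := fun g => TotalSpace.mk' E g 0
  have sfg : ContMDiff 𝓘(ℝ, E) 𝓘(ℝ, E).tangent ∞ fg := contMDiff_zeroSection _ _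
  let fv : G → TangentBundle 𝓘(ℝ, E) G := fun _ => TotalSpace.mk' E 1 v
  have sfv : ContMDiff 𝓘(ℝ, E) 𝓘(ℝ, E).tangent ∞ fv := contMDiff_const
  let F₁ : G → (TangentBundle 𝓘(ℝ, E) G × TangentBundle 𝓘(ℝ, E) G) := fun g => (fg g, fv g)
  have S₁ : ContMDiff 𝓘(ℝ, E) (𝓘(ℝ, E).tangent.prod 𝓘(ℝ, E).tangent) ∞ F₁ := sfg.prodMk sfv
  let F₂ : (TangentBundle 𝓘(ℝ, E) G × TangentBundle 𝓘(ℝ, E) G) →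
      TangentBundle (𝓘(ℝ, E).prod 𝓘(ℝ, E)) (G × G) :=
    (equivTangentBundleProd 𝓘(ℝ, E) G 𝓘(ℝ, E) G).symm
  have S₂ : ContMDiff (𝓘(ℝ, E).tangent.prod 𝓘(ℝ, E).tangent)
      (𝓘(ℝ, E).prod 𝓘(ℝ, E)).tangent ∞ F₂ := contMDiff_equivTangentBundleProd_symm
  let F₃ : TangentBundle (𝓘(ℝ, E).prod 𝓘(ℝ, E)) (G × G) → TangentBundle 𝓘(ℝ, E) G :=
    tangentMap (𝓘(ℝ, E).prod 𝓘(ℝ, E)) 𝓘(ℝ, E) (fun (p : G × G) => p.1 * p.2)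
  have S₃ : ContMDiff (𝓘(ℝ, E).prod 𝓘(ℝ, E)).tangent 𝓘(ℝ, E).tangent ∞ F₃ :=
    ContMDiff.contMDiff_tangentMap (contMDiff_mul 𝓘(ℝ, E) ∞) (m := ∞) (by simp)
  let S := (S₃.comp S₂).comp S₁
  convert! S with g
  · simp [F₁, F₂, F₃, fg, fv]
  · simp only [Function.comp_apply, tangentMap, F₃, F₂, F₁, fg, fv]
    rw [mfderiv_prod_eq_add_apply ((contMDiff_mul 𝓘(ℝ, E) ∞).mdifferentiableAt (by simp))]
    exact ((congrArg₂ (fun a b : E => a + b) (ContinuousLinearMap.map_zero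
      (mfderiv 𝓘(ℝ, E) 𝓘(ℝ, E) (fun z : G => z * 1) g)) rfl).trans (zero_add _)).symm

/-- The derivative `vφ` of a test function `φ` along the left-invariant vector field of `v`. -/
def derivAlong (v : GroupLieAlgebra 𝓘(ℝ, E) G) (φ : TestFunction E G) : TestFunction E G :=
  ⟨fun x => mfderiv 𝓘(ℝ, E) 𝓘(ℝ, ℝ) φ.1 x (mulInvariantVectorField v x), by
    have h1 : ContMDiff 𝓘(ℝ, E).tangent 𝓘(ℝ, ℝ).tangent ∞
        (tangentMap 𝓘(ℝ, E) 𝓘(ℝ, ℝ) φ.1) :=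
      ContMDiff.contMDiff_tangentMap φ.2.1 (m := ∞) (by simp)
    exact (contMDiff_snd_tangentBundle_modelSpace ℝ 𝓘(ℝ, ℝ)).comp
      (h1.comp (contMDiff_leftInvariant v)), by
    refine φ.2.2.mono' fun x hx => ?_
    by_contra h
    apply hx
    have h0 : φ.1 =ᶠ[𝓝 x] fun _ => (0 : ℝ) := notMem_tsupport_iff_eventuallyEq.mp h
    show mfderiv 𝓘(ℝ, E) 𝓘(ℝ, ℝ) φ.1 x (mulInvariantVectorField v x) = (0 : ℝ)
    rw [h0.mfderiv_eq, mfderiv_const]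
    rfl⟩

variable [MeasurableSpace G] (μ : Measure G)

/-- The divergence, with respect to the left-invariant volume `μ`, of the left-invariant vector
field of `v`: the constant `c` such that `∫ vφ dμ = - c ∫ φ dμ` for all test functions `φ`.
Equivalently, right translation by `exp (t v)` multiplies volumes by `exp (t c)`. -/
def divergence (v : GroupLieAlgebra 𝓘(ℝ, E) G) : ℝ :=
  open Classical in
  if h : ∃ c : ℝ, ∀ φ : TestFunction E G,
      ∫ x, (derivAlong v φ).1 x ∂μ = -(c * ∫ x, φ.1 x ∂μ) then h.choose else 0

/-- The formal transpose of `-v`, that is `φ ↦ vφ + (div v) φ`. -/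
def adjDeriv (v : GroupLieAlgebra 𝓘(ℝ, E) G) (φ : TestFunction E G) : TestFunction E G :=
  derivAlong v φ + divergence μ v • φ

end Calculus

/-! ### One-forms with distribution coefficients -/

section Forms

variable (E : Type*) [NormedAddCommGroup E] [NormedSpace ℝ E]
  (G : Type*) [TopologicalSpace G] [ChartedSpace E G] [Group G]

/-- One-forms on `G` with generalized coefficients: `T v φ` is the pairing of the coefficient of `T`
along the left-invariant vector field of `v` with the test function `φ`. Only the forms in
`LpDLp` below, whose coefficients are distributions, are used. -/
abbrev GenForm : Type _ := GroupLieAlgebra 𝓘(ℝ, E) G → TestFunction E G → ℝ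

variable {E G}
variable [LieGroup 𝓘(ℝ, E) ∞ G] [MeasurableSpace G] (μ : Measure G)

/-- The differential of a locally integrable function, in the sense of distributions. -/
def distD (u : G → ℝ) : GenForm E G :=
  fun v φ => -∫ x, u x * (adjDeriv μ v φ).1 x ∂μ

/-- `dT = 0` in the sense of distributions. This is the transposed form of
`dα(v, w) = v (α w) - w (α v) - α [v, w]` on left-invariant vector fields. -/
def GenForm.IsClosed (T : GenForm E G) : Prop :=
  ∀ (v w : GroupLieAlgebra 𝓘(ℝ, E) G) (φ : TestFunction E G),
    -T w (adjDeriv μ v φ) + T v (adjDeriv μ w φ) - T ⁅v, w⁆ φ = 0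

/-- A measurable one-form, written as a function from `G` to the dual of the Lie algebra
(`α x v` is the value at `x` of the form on the left-invariant vector field of `v`),
viewed as a form with distribution coefficients. -/
def formDist (α : G → (E →L[ℝ] ℝ)) : GenForm E G :=
  fun (v : E) φ => ∫ x, α x v * φ.1 x ∂μ

/-- `α` is the differential of `u` in the sense of distributions. -/
def HasWeakDifferential (u : G → ℝ) (α : G → (E →L[ℝ] ℝ)) : Prop :=
  LocallyIntegrable u μ ∧ distD μ u = formDist μ α

end Forms

/-! ### `L^p`-cohomology in degree one -/

section Cohomology

variable {E : Type*} [NormedAddCommGroup E] [NormedSpace ℝ E] [FiniteDimensional ℝ E]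
  {G : Type*} [TopologicalSpace G] [ChartedSpace E G] [Group G]

theorem formDist_congr [MeasurableSpace G] (μ : Measure G) {α β : G → (E →L[ℝ] ℝ)}
    (h : α =ᵐ[μ] β) : formDist μ α = formDist μ β := by
  funext v φ
  refine integral_congr_ae ?_
  filter_upwards [h] with x hx
  rw [hx]

variable [MeasurableSpace G] [BorelSpace G] [T2Space G]
  (μ : Measure G) [IsFiniteMeasureOnCompacts μ]
  (p : ℝ≥0∞) [hp : Fact (1 ≤ p)]

theorem integrable_form_mul {α : G → (E →L[ℝ] ℝ)} (hα : MemLp α p μ)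
    (v : E) (φ : TestFunction E G) :
    Integrable (fun x => α x v * φ.1 x) μ := by
  have : LocallyCompactSpace G := ChartedSpace.locallyCompactSpace E G
  have h1 : MemLp (fun x => α x v) p μ :=
    (ContinuousLinearMap.apply (E := E) ℝ ℝ v).comp_memLp' hα
  have h2 : LocallyIntegrable (fun x => α x v) μ := h1.locallyIntegrable hp.out
  have h3 := h2.integrable_smul_right_of_hasCompactSupport φ.2.1.continuous φ.2.2
  simpa [mul_comm] using h3

theorem formDist_add (α β : Lp (E →L[ℝ] ℝ) p μ) :
    formDist μ (α + β : Lp (E →L[ℝ] ℝ) p μ) = formDist μ α + formDist μ β := by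
  rw [formDist_congr μ (Lp.coeFn_add α β)]
  refine funext fun (v : E) => funext fun φ => ?_
  simp only [formDist, Pi.add_apply, add_apply, add_mul]
  exact integral_add (integrable_form_mul μ p (Lp.memLp α) v φ)
    (integrable_form_mul μ p (Lp.memLp β) v φ)

theorem formDist_smul (c : ℝ) (α : Lp (E →L[ℝ] ℝ) p μ) :
    formDist μ (c • α : Lp (E →L[ℝ] ℝ) p μ) = c • formDist μ α := by
  rw [formDist_congr μ (Lp.coeFn_smul c α)]
  refine funext fun (v : E) => funext fun φ => ?_
  simp only [formDist, Pi.smul_apply, smul_apply, smul_eq_mul, mul_assoc]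
  exact integral_const_mul c _

theorem formDist_zero : formDist μ (0 : Lp (E →L[ℝ] ℝ) p μ) = 0 := by
  rw [formDist_congr μ (Lp.coeFn_zero _ p μ)]
  refine funext fun (v : E) => funext fun φ => ?_
  simp only [formDist, Pi.zero_apply]
  exact (integral_congr_ae (by filter_upwards with x; simp)).trans (integral_zero G ℝ)

variable [LieGroup 𝓘(ℝ, E) ∞ G]

theorem distD_add {u w : G → ℝ} (hu : LocallyIntegrable u μ) (hw : LocallyIntegrable w μ) :
    distD (E := E) μ (u + w) = distD μ u + distD μ w := by
  funext v φ
  have key : ∀ {f : G → ℝ}, LocallyIntegrable f μ →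
      Integrable (fun x => f x * (adjDeriv μ v φ).1 x) μ := fun hf => by
    have h3 := hf.integrable_smul_right_of_hasCompactSupport
      (adjDeriv μ v φ).2.1.continuous (adjDeriv μ v φ).2.2
    simpa [mul_comm] using h3
  simp only [distD, Pi.add_apply, add_mul]
  rw [integral_add (key hu) (key hw)]
  ring

theorem distD_smul (c : ℝ) (u : G → ℝ) : distD (E := E) μ (c • u) = c • distD μ u := by
  funext v φ
  simp only [distD, Pi.smul_apply, smul_eq_mul, mul_assoc]
  rw [integral_const_mul]
  ring

variable (E)

/-- The space of closed `L^p` one-forms on `G`, a subspace of the Banach space of `L^p` one-forms.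
The norm on covectors is dual to the norm of the Lie algebra `E = T_1 G`. If `E` is a Euclidean
space and `G` carries the left-invariant metric that it defines, this is the Riemannian norm at
every point of `G`, because forms are written in left-invariant frames. -/
def closedForms : Submodule ℝ (Lp (E →L[ℝ] ℝ) p μ) where
  carrier := {α | GenForm.IsClosed μ (formDist μ α)}
  zero_mem' := by
    intro v w φ
    rw [formDist_zero]
    simp
  add_mem' := by
    intro α β hα hβ v w φ
    have h1 := hα v w φ
    have h2 := hβ v w φ
    rw [formDist_add]
    simp only [Pi.add_apply]
    linarith
  smul_mem' := by
    intro c α hα v w φ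
    have h1 := hα v w φ
    rw [formDist_smul]
    simp only [Pi.smul_apply, smul_eq_mul]
    linear_combination c * h1

/-- The space `d Ω^{0,p}` of differentials of `L^p` functions with `L^p` differential. -/
def exactForms : Submodule ℝ (Lp (E →L[ℝ] ℝ) p μ) where
  carrier := {α | ∃ u : G → ℝ, MemLp u p μ ∧ HasWeakDifferential μ u α}
  zero_mem' := by
    refine ⟨0, MemLp.zero, locallyIntegrable_zero, ?_⟩
    rw [formDist_zero]
    funext v φ
    simp [distD]
  add_mem' := by
    rintro α β ⟨u, hu, hu1, hu2⟩ ⟨w, hw, hw1, hw2⟩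
    refine ⟨u + w, hu.add hw, hu1.add hw1, ?_⟩
    rw [formDist_add, distD_add μ hu1 hw1, hu2, hw2]
  smul_mem' := by
    rintro c α ⟨u, hu, hu1, hu2⟩
    refine ⟨c • u, hu.const_smul c, hu1.smul c, ?_⟩
    rw [formDist_smul, distD_smul, hu2]

/-- The `L^p`-cohomology `H^{1,p}(G)` in degree one: closed `L^p` one-forms modulo differentials of
`L^p` functions with `L^p` differential. -/
abbrev H1p : Type _ :=
  closedForms E μ p ⧸ (exactForms E μ p).comap (closedForms E μ p).subtype

/-- The torsion `T^{1,p}(G)`: classes of closed forms that are `L^p` limits of differentials of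
`L^p` functions with `L^p` differential. -/
def torsion : Submodule ℝ (H1p E μ p) :=
  ((exactForms E μ p).topologicalClosure.comap (closedForms E μ p).subtype).map
    (Submodule.mkQ _)

/-- Generalized one-forms of the form `β + dγ` with `β` an `L^p` form and `γ` an `L^p` function. -/
def LpDLp : Set (GenForm E G) :=
  {T | ∃ β : Lp (E →L[ℝ] ℝ) p μ, ∃ γ : G → ℝ, MemLp γ p μ ∧ T = formDist μ β + distD μ γ}

end Cohomology

/-! ### Boundary values -/

section Boundary

variable (E : Type*) [NormedAddCommGroup E] [NormedSpace ℝ E]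
  {G : Type*} [TopologicalSpace G] [ChartedSpace E G] [Group G]

variable (G) in
/-- The open unit ball of `G` centered at `1` for the distance of the left-invariant metric: the
points joined to `1` by a `C^1` curve of length `< 1`. The length of a tangent vector `w` at `g` is
the norm in `T_1 G = E` of the left translate `d(L_{g⁻¹}) w`. -/
def unitBall : Set G :=
  {x | ∃ γ : ℝ → G, γ 0 = 1 ∧ γ 1 = x ∧ ContMDiff 𝓘(ℝ, ℝ) 𝓘(ℝ, E) 1 γ ∧
    ∫⁻ t in Set.Icc (0 : ℝ) 1, enorm (E := E)
      (mfderiv 𝓘(ℝ, E) 𝓘(ℝ, E) (fun y : G => (γ t)⁻¹ * y) (γ t)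
        (mfderiv 𝓘(ℝ, ℝ) 𝓘(ℝ, E) γ t (1 : ℝ))) < 1}

variable [MeasurableSpace G] (μ : Measure G) (p : ℝ≥0∞)

/-- The space `d^{-1}dL^p(G)` of locally `L^p` functions `f` such that
`∫_G inf_c ‖f - c‖_{L^p(gB)}^p dg < ∞`, where `B` is the unit ball of `G` centered at `1`. -/
def dInvDLp : Set (G → ℝ) :=
  {f | (∀ K : Set G, IsCompact K → MemLp f p (μ.restrict K)) ∧
    ∫⁻ g, (⨅ c : ℝ, eLpNorm (fun x => f x - c) p
      (μ.restrict ((fun x => g * x) '' unitBall E G))) ^ p.toReal ∂μ < ⊤}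

variable {E}
variable (ξ : GroupLieAlgebra 𝓘(ℝ, E) G)

/-- The space `B_ξ^p` of functions in `d^{-1}dL^p(G)` that are almost everywhere invariant under
right translation by `exp (t ξ)`, for every `t`. -/
def invariantSpace : Set (G → ℝ) :=
  {w | w ∈ dInvDLp E μ p ∧ ∀ t : ℝ, (fun x => w (x * expCurve ξ t)) =ᵐ[μ] w}

/-- `v` is a boundary value of `u`: the right translates of `u` by `exp (t ξ)` converge to `v` in
`L^p` as `t → +∞`, meaning that the `L^p` norm of the difference (not of `u`, `v` separately) tends
to zero. -/
def IsBoundaryValue (u v : G → ℝ) : Prop :=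
  AEStronglyMeasurable v μ ∧
    Tendsto (fun t : ℝ => eLpNorm (fun x => u (x * expCurve ξ t) - v x) p μ) atTop (𝓝 0)

/-- Functions that are almost everywhere equal to a constant. -/
def aeConst {G : Type*} [MeasurableSpace G] (μ : Measure G) : Submodule ℝ (G → ℝ) where
  carrier := {f | ∃ c : ℝ, f =ᵐ[μ] fun _ => c}
  zero_mem' := ⟨0, Filter.EventuallyEq.rfl⟩
  add_mem' := by
    rintro f g ⟨a, ha⟩ ⟨b, hb⟩
    exact ⟨a + b, ha.add hb⟩
  smul_mem' := by
    rintro c f ⟨a, ha⟩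
    exact ⟨c * a, ha.const_smul c⟩

end Boundary
end LpCohomology

set_option linter.unusedSectionVars false

namespace LpCohomology

/-! ### One-parameter subgroups and coordinates by products of exponentials -/

section OneParameterSubgroups

variable {E : Type*} [NormedAddCommGroup E] [NormedSpace ℝ E]
  {G : Type*} [TopologicalSpace G] [ChartedSpace E G] [Group G] [LieGroup 𝓘(ℝ, E) ∞ G]

/-! Write `τ > 0` for the divergence of `ξ₀`. Right translation by `exp (t ξ₀)` multiplies `L^p`
norms of functions by `exp (-τ t / p)`, so it contracts `L^p` as `t → +∞`
(`tendsto_eLpNorm_mul_right`). If `α = du` is in `L^p`, then `u (x exp (t ξ₀)) - u x` is the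
integral of `α(ξ₀)` along the orbit over `[0, t]`. By the contraction, the integral over the whole
half-line converges to an `L^p` function `H` (`tailIntegral`, bounded in
`exists_lintegral_tail_le`). Hence `u_∞ = u + H`, and `u ∘ R - u_∞ = -H ∘ R` tends to zero.

Injectivity follows. An `L^p` function has boundary value zero; conversely, if `u_∞` is a constant
`c`, then `u - c = -H` is in `L^p`, so `du` is trivial in cohomology (`mem_exactForms_iff`). Thus
`α` is exact if and only if `α = -dH`. As `H` depends continuously on `α`, this is a closed
condition, and the torsion vanishes (`isClosed_exactForms`).

For surjectivity, let `w` be an invariant function in `d⁻¹dL^p`. Convolve it on the right with a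
bump function of mean one: the result `u` has `L^p` gradient and `u - w` is in `L^p`
(`exists_hasWeakDifferential_of_mem_dInvDLp`). By invariance of `w`, `u ∘ R - w = (u - w) ∘ R` tends
to zero, so `w` is the boundary value of `u`. Both directions between `d⁻¹dL^p` and functions with
`L^p` gradient rest on one fact: the oscillation on balls `gB` is controlled by, and controls, the
`L^p` norms of differences `u ∘ R_h - u` for `h` near `1`. At the level of forms, `du_∞ = α + dH`;
conversely, a closed `β + dγ` has `β` closed, hence `β = du`, and `w = u + γ` is the required
function.

The group need not be simply connected, so the exactness of closed `L^p` forms requires an argument.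
For `g = exp v`, Cartan's formula gives an `L^p` primitive of `R_g^* α - α`, namely the integral of
`α(v)` along the flow of `v` (`distD_integral_translate`). Such primitives exist for all `g`,
because exponentials generate the connected group `G`. They are unique, because a non-unimodular
group has infinite volume and its only constant in `L^p` is zero. Uniqueness makes them a true
cocycle `F (g h) = F g + F h ∘ R_g`, continuous in `g`. Averaging `F (x⁻¹ y)` at `x` over a compact
set of `x` gives a function `u` of `y` with `u ∘ R_h - u = F h`, and differentiating in `h` gives
`du = α`. -/

theorem isManifold_one : IsManifold 𝓘(ℝ, E) 1 G :=
  have : IsManifold 𝓘(ℝ, E) ∞ G := inferInstance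
  IsManifold.of_le (n := ∞) (by exact_mod_cast le_top)

theorem mulInvariantVectorField_mul (v : GroupLieAlgebra 𝓘(ℝ, E) G) (g h : G) :
    mfderiv 𝓘(ℝ, E) 𝓘(ℝ, E) (fun x : G => g * x) h (mulInvariantVectorField v h) =
      mulInvariantVectorField v (g * h) := by
  have h1 : (fun x : G => g * h * x) = (fun x => g * x) ∘ (fun x => h * x) := by
    funext x; simp [mul_assoc]
  have d (a : G) : MDifferentiable 𝓘(ℝ, E) 𝓘(ℝ, E) (fun x : G => a * x) :=
    (contMDiff_mul_left (I := 𝓘(ℝ, E)) (n := ∞)).mdifferentiable (by simp)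
  have h2 : (mfderiv 𝓘(ℝ, E) 𝓘(ℝ, E) (fun x : G => g * h * x) 1 : E →L[ℝ] E) =
      (mfderiv 𝓘(ℝ, E) 𝓘(ℝ, E) (fun x : G => g * x) (h * 1) : E →L[ℝ] E).comp
        (mfderiv 𝓘(ℝ, E) 𝓘(ℝ, E) (fun x : G => h * x) 1 : E →L[ℝ] E) := by
    rw [h1]
    exact mfderiv_comp (1 : G) (d g _) (d h _)
  -- The base points `h * 1` and `h`, and so their tangent spaces, are equal only propositionally;
  -- substituting for a variable point identifies the two differentials. The same device recurs
  -- below.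
  have h4 : ∀ k, k = h → (mfderiv 𝓘(ℝ, E) 𝓘(ℝ, E) (fun x : G => g * x) k : E →L[ℝ] E) =
      (mfderiv 𝓘(ℝ, E) 𝓘(ℝ, E) (fun x : G => g * x) h : E →L[ℝ] E) := by
    rintro _ rfl; rfl
  rw [h4 _ (mul_one h)] at h2
  exact (congrArg (fun L : E →L[ℝ] E => L v) h2).symm

theorem IsMIntegralCurve.mul_left {v : GroupLieAlgebra 𝓘(ℝ, E) G} {γ : ℝ → G} {s : Set ℝ}
    (hγ : IsMIntegralCurveOn (I := 𝓘(ℝ, E)) γ (mulInvariantVectorField v) s) (g : G) :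
    IsMIntegralCurveOn (I := 𝓘(ℝ, E)) (fun t => g * γ t) (mulInvariantVectorField v) s := by
  intro t ht
  have d : MDifferentiable 𝓘(ℝ, E) 𝓘(ℝ, E) (fun x : G => g * x) :=
    (contMDiff_mul_left (I := 𝓘(ℝ, E)) (n := ∞)).mdifferentiable (by simp)
  refine ((d (γ t)).hasMFDerivAt.comp_hasMFDerivWithinAt t (hγ t ht)).congr_mfderiv ?_
  ext
  exact (congrArg _ (one_smul ℝ _)).trans <| (mulInvariantVectorField_mul v g (γ t)).trans
    (one_smul ℝ _).symm

theorem contMDiff_leftInvariant_one (v : GroupLieAlgebra 𝓘(ℝ, E) G) :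
    ContMDiff 𝓘(ℝ, E) 𝓘(ℝ, E).tangent 1
      (fun g : G => (mulInvariantVectorField v g : TangentBundle 𝓘(ℝ, E) G)) :=
  (contMDiff_leftInvariant v).of_le (by exact_mod_cast le_top)

variable [T2Space G] [FiniteDimensional ℝ E]

/-- Left translation carries a local integral curve through `1` to one through any `x` with the same
existence time `ε`, and a field with a uniform existence time is complete. -/
theorem exists_isMIntegralCurve (v : GroupLieAlgebra 𝓘(ℝ, E) G) :
    ∃ γ : ℝ → G, γ 0 = 1 ∧ IsMIntegralCurve (I := 𝓘(ℝ, E)) γ (mulInvariantVectorField v) := by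
  have : IsManifold 𝓘(ℝ, E) 1 G := isManifold_one
  have hv := contMDiff_leftInvariant_one v
  have := FiniteDimensional.complete ℝ E
  obtain ⟨γ, h0, hγ⟩ := exists_isMIntegralCurveAt_of_contMDiffAt_boundaryless (t₀ := 0)
    (hv.contMDiffAt (x := (1 : G)))
  rw [isMIntegralCurveAt_iff'] at hγ
  obtain ⟨ε, hε, hγ⟩ := hγ
  refine exists_isMIntegralCurve_of_isMIntegralCurveOn hv hε (fun x => ?_) 1
  refine ⟨fun t => x * γ t, by simp [h0], ?_⟩
  have := IsMIntegralCurve.mul_left hγ x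
  rwa [Real.ball_eq_Ioo, zero_sub, zero_add] at this

theorem expCurve_zero (v : GroupLieAlgebra 𝓘(ℝ, E) G) : expCurve v 0 = 1 := by
  rw [expCurve, dif_pos (exists_isMIntegralCurve v)]
  exact (exists_isMIntegralCurve v).choose_spec.1

theorem isMIntegralCurve_expCurve (v : GroupLieAlgebra 𝓘(ℝ, E) G) :
    IsMIntegralCurve (I := 𝓘(ℝ, E)) (expCurve v) (mulInvariantVectorField v) := by
  rw [expCurve, dif_pos (exists_isMIntegralCurve v)]
  exact (exists_isMIntegralCurve v).choose_spec.2

theorem isMIntegralCurve_mul_expCurve (v : GroupLieAlgebra 𝓘(ℝ, E) G) (x : G) :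
    IsMIntegralCurve (I := 𝓘(ℝ, E)) (fun t => x * expCurve v t) (mulInvariantVectorField v) := by
  rw [isMIntegralCurve_iff_isMIntegralCurveOn]
  exact IsMIntegralCurve.mul_left ((isMIntegralCurve_expCurve v).isMIntegralCurveOn _) x

theorem eq_mul_expCurve {v : GroupLieAlgebra 𝓘(ℝ, E) G} {γ : ℝ → G}
    (hγ : IsMIntegralCurve (I := 𝓘(ℝ, E)) γ (mulInvariantVectorField v)) (t : ℝ) :
    γ t = γ 0 * expCurve v t := by
  have : IsManifold 𝓘(ℝ, E) 1 G := isManifold_one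
  have hv := contMDiff_leftInvariant_one v
  exact congrFun (isMIntegralCurve_Ioo_eq_of_contMDiff_boundaryless (t₀ := 0) hv hγ
    (isMIntegralCurve_mul_expCurve v (γ 0)) (by simp [expCurve_zero])) t

theorem expCurve_add (v : GroupLieAlgebra 𝓘(ℝ, E) G) (s t : ℝ) :
    expCurve v (s + t) = expCurve v s * expCurve v t := by
  have := eq_mul_expCurve ((isMIntegralCurve_expCurve v).comp_add s) t
  simpa [add_comm] using this

theorem expCurve_neg (v : GroupLieAlgebra 𝓘(ℝ, E) G) (t : ℝ) :
    expCurve v (-t) = (expCurve v t)⁻¹ := by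
  rw [eq_inv_iff_mul_eq_one, ← expCurve_add]
  simp [expCurve_zero]

theorem expCurve_smul (v : GroupLieAlgebra 𝓘(ℝ, E) G) (a t : ℝ) :
    expCurve (a • v) t = expCurve v (a * t) := by
  have h := (isMIntegralCurve_expCurve v).comp_mul a
  rw [← mulInvariantVectorField_smul] at h
  have := eq_mul_expCurve h t
  simp only [Function.comp, zero_mul, expCurve_zero, one_mul] at this
  rw [← this, mul_comm]

/-- In a chart, the derivative of an integral curve is the coordinate expression of the field along
the curve, which is continuous. -/
theorem contMDiff_expCurve (v : GroupLieAlgebra 𝓘(ℝ, E) G) :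
    ContMDiff 𝓘(ℝ, ℝ) 𝓘(ℝ, E) 1 (expCurve v : ℝ → G) := by
  have : IsManifold 𝓘(ℝ, E) 1 G := isManifold_one
  have hc := (isMIntegralCurve_expCurve v).continuous
  intro t₀
  rw [contMDiffAt_iff]
  refine ⟨hc.continuousAt, ?_⟩
  simp only [mfld_simps, contDiffWithinAt_univ]
  have hd := ((isMIntegralCurve_expCurve v).isMIntegralCurveAt t₀).eventually_hasDerivAt
  have hcont : ContinuousOn (fun t => tangentCoordChange 𝓘(ℝ, E) (expCurve v t) (expCurve v t₀)
      (expCurve v t) (mulInvariantVectorField v (expCurve v t)))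
      (expCurve v ⁻¹' (chartAt E (expCurve v t₀ : G)).source) := by
    have h1 := ((contMDiff_leftInvariant v).continuous.comp hc)
    have h2 := (trivializationAt E (TangentSpace 𝓘(ℝ, E) : G → Type _)
      (expCurve v t₀)).continuousOn.comp (h1.continuousOn
        (s := expCurve v ⁻¹' (chartAt E (expCurve v t₀ : G)).source)) (fun t ht => by
          rw [Trivialization.mem_source]; exact ht)
    exact continuous_snd.comp_continuousOn h2
  have hO : expCurve v ⁻¹' (chartAt E (expCurve v t₀ : G)).source ∈ 𝓝 t₀ :=
    hc.continuousAt.preimage_mem_nhds (chart_source_mem_nhds E _)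
  rw [contDiffAt_one_iff]
  exact ⟨_, _, inter_mem hO hd, (ContinuousLinearMap.smulRightL ℝ ℝ E 1).continuous.comp_continuousOn
    (hcont.mono Set.inter_subset_left), fun t ht => ht.2.hasFDerivAt⟩

theorem hasDerivAt_comp_mul_expCurve {f : G → ℝ} (hf : MDifferentiable 𝓘(ℝ, E) 𝓘(ℝ, ℝ) f)
    (v : GroupLieAlgebra 𝓘(ℝ, E) G) (x : G) (t : ℝ) :
    HasDerivAt (fun s => f (x * expCurve v s))
      (mfderiv 𝓘(ℝ, E) 𝓘(ℝ, ℝ) f (x * expCurve v t)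
        (mulInvariantVectorField v (x * expCurve v t)) : ℝ) t := by
  have h := (hf (x * expCurve v t)).hasMFDerivAt.comp t (isMIntegralCurve_mul_expCurve v x t)
  rw [hasMFDerivAt_iff_hasFDerivAt] at h
  have h2 : HasDerivAt (fun s => f (x * expCurve v s)) _ t := HasFDerivAt.hasDerivAt h
  refine h2.congr_deriv ?_
  exact congrArg (mfderiv 𝓘(ℝ, E) 𝓘(ℝ, ℝ) f (x * expCurve v t) : E →L[ℝ] ℝ) (one_smul ℝ (_ : E))

/-- The vectors of a basis of the model space, as elements of the Lie algebra. -/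
def basisVec (G : Type*) [TopologicalSpace G] [ChartedSpace E G] [Group G]
    (i : Fin (Module.finrank ℝ E)) : GroupLieAlgebra 𝓘(ℝ, E) G :=
  Module.finBasis ℝ E i

/-- The product of `exp (aᵢ bᵢ)` over the indices `i` in a list, where `a = ∑ aᵢ bᵢ` for the
basis `b`. -/
def expProd (G : Type*) [TopologicalSpace G] [ChartedSpace E G] [Group G]
    (l : List (Fin (Module.finrank ℝ E))) (a : E) : G :=
  (l.map fun i => expCurve (basisVec G i) ((Module.finBasis ℝ E).coord i a)).prod

theorem expProd_cons (i : Fin (Module.finrank ℝ E)) (l : List (Fin (Module.finrank ℝ E))) (a : E) :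
    expProd G (i :: l) a =
      expCurve (basisVec G i) ((Module.finBasis ℝ E).coord i a) * expProd G l a := by
  simp [expProd]

theorem expProd_zero (l : List (Fin (Module.finrank ℝ E))) : expProd G l (0 : E) = 1 := by
  induction l with
  | nil => rfl
  | cons i l ih => rw [expProd_cons, ih, map_zero, expCurve_zero, one_mul]

theorem contMDiff_coord (i : Fin (Module.finrank ℝ E)) :
    ContMDiff 𝓘(ℝ, E) 𝓘(ℝ, ℝ) 1 (fun a : E => (Module.finBasis ℝ E).coord i a) :=
  ((Module.finBasis ℝ E).coord i).toContinuousLinearMap.contDiff.contMDiff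

theorem lieGroup_one : LieGroup 𝓘(ℝ, E) 1 G :=
  LieGroup.of_le (n := ∞) (by exact_mod_cast le_top)

theorem contMDiff_expProd (l : List (Fin (Module.finrank ℝ E))) :
    ContMDiff 𝓘(ℝ, E) 𝓘(ℝ, E) 1 (expProd G l : E → G) := by
  have : LieGroup 𝓘(ℝ, E) 1 G := lieGroup_one
  induction l with
  | nil => exact contMDiff_const
  | cons i l ih =>
    have h : (expProd G (i :: l) : E → G) = fun a =>
      expCurve (basisVec G i) ((Module.finBasis ℝ E).coord i a) * expProd G l a := funext fun a => expProd_cons i l a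
    rw [h]
    exact ((contMDiff_expCurve _).comp (contMDiff_coord i)).mul ih

theorem mfderiv_mul_one_one (g h : G) (hg : g = 1) (hh : h = 1) :
    (mfderiv (𝓘(ℝ, E).prod 𝓘(ℝ, E)) 𝓘(ℝ, E) (fun p : G × G => p.1 * p.2) (g, h) :
      E × E →L[ℝ] E) = ContinuousLinearMap.fst ℝ E E + ContinuousLinearMap.snd ℝ E E := by
  subst hg hh
  have hd := (contMDiff_mul (G := G) 𝓘(ℝ, E) ∞).mdifferentiableAt (x := ((1 : G), (1 : G)))
    (by simp)
  have e1 : (mfderiv 𝓘(ℝ, E) 𝓘(ℝ, E) (fun z : G => z * 1) 1 : E →L[ℝ] E) = .id ℝ E := by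
    have : (fun z : G => z * 1) = id := by funext z; simp
    rw [this]; exact mfderiv_id
  have e2 : (mfderiv 𝓘(ℝ, E) 𝓘(ℝ, E) (fun z : G => 1 * z) 1 : E →L[ℝ] E) = .id ℝ E := by
    have : (fun z : G => 1 * z) = id := by funext z; simp
    rw [this]; exact mfderiv_id
  refine ContinuousLinearMap.ext fun v => ?_
  refine (mfderiv_prod_eq_add_apply (v := v) hd).trans ?_
  exact congrArg₂ (fun a b : E => a + b) (congrArg (fun L : E →L[ℝ] E => L v.1) e1)
    (congrArg (fun L : E →L[ℝ] E => L v.2) e2)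

/-- Multiplication has differential `(a, b) ↦ a + b` at `(1, 1)`, so the derivatives of the factors
add up. Over the full list of indices the sum is the identity. -/
theorem hasMFDerivAt_expProd (l : List (Fin (Module.finrank ℝ E))) :
    HasMFDerivAt 𝓘(ℝ, E) 𝓘(ℝ, E) (expProd G l : E → G) 0
      ((l.map fun i => ((Module.finBasis ℝ E).coord i).toContinuousLinearMap.smulRight
        (Module.finBasis ℝ E i)).sum : E →L[ℝ] E) := by
  induction l with
  | nil => exact hasMFDerivAt_const _ _
  | cons i l ih =>
    have h : (expProd G (i :: l) : E → G) = fun a =>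
      expCurve (basisVec G i) ((Module.finBasis ℝ E).coord i a) * expProd G l a := funext fun a => expProd_cons i l a
    rw [h]
    have h1 : HasMFDerivAt 𝓘(ℝ, E) 𝓘(ℝ, E) (fun a : E =>
        expCurve (basisVec G i) ((Module.finBasis ℝ E).coord i a)) 0
        (((Module.finBasis ℝ E).coord i).toContinuousLinearMap.smulRight
          (Module.finBasis ℝ E i) : E →L[ℝ] E) := by
      have k1 : HasMFDerivAt 𝓘(ℝ, E) 𝓘(ℝ, ℝ) (fun a : E => (Module.finBasis ℝ E).coord i a) 0
          (((Module.finBasis ℝ E).coord i).toContinuousLinearMap : E →L[ℝ] ℝ) :=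
        (((Module.finBasis ℝ E).coord i).toContinuousLinearMap.hasFDerivAt).hasMFDerivAt
      have k2 := (isMIntegralCurve_expCurve (basisVec G i)
        ((Module.finBasis ℝ E).coord i 0)).comp (0 : E) k1
      refine k2.congr_mfderiv ?_
      have k3 : ∀ g : G, g = 1 →
          (mulInvariantVectorField (basisVec G i) g : E) = Module.finBasis ℝ E i := by
        rintro _ rfl
        have : (fun z : G => 1 * z) = id := by funext z; simp
        have e2 : (mfderiv 𝓘(ℝ, E) 𝓘(ℝ, E) (fun z : G => 1 * z) 1 : E →L[ℝ] E) = .id ℝ E := by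
          rw [this]; exact mfderiv_id
        exact congrArg (fun L : E →L[ℝ] E => L (Module.finBasis ℝ E i)) e2
      refine ContinuousLinearMap.ext fun a => ?_
      exact congrArg (fun w : E => (Module.finBasis ℝ E).coord i a • w)
        (k3 _ (by rw [map_zero, expCurve_zero]))
    have h2 := (h1.prodMk ih)
    have hd := ((contMDiff_mul (G := G) 𝓘(ℝ, E) ∞).mdifferentiableAt
      (x := (expCurve (basisVec G i) ((Module.finBasis ℝ E).coord i 0), expProd G l (0 : E)))
      (by simp)).hasMFDerivAt
    refine (hd.comp (0 : E) h2).congr_mfderiv ?_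
    refine ContinuousLinearMap.ext fun a => ?_
    exact (congrArg (fun L : E × E →L[ℝ] E => L _) (mfderiv_mul_one_one (E := E) _ _
      (by rw [map_zero, expCurve_zero]) (expProd_zero (G := G) l))).trans
        rfl

/-- The inverse function theorem, applied in a chart: the derivative at `0` is the identity. This is
how estimates along one-parameter subgroups are spread to a neighbourhood of `1`. -/
theorem map_expProd_nhds :
    (𝓝 (0 : E)).map (expProd G (List.finRange (Module.finrank ℝ E))) = 𝓝 (1 : G) := by
  have hc : ContDiffAt ℝ 1 (extChartAt 𝓘(ℝ, E) (expProd G (List.finRange _) (0 : E)) ∘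
      (expProd G (List.finRange (Module.finrank ℝ E)))) 0 := by
    have h := (contMDiffAt_iff.1 (contMDiff_expProd (G := G) (E := E) (List.finRange _) 0)).2
    simpa only [mfld_simps, contDiffWithinAt_univ, chartAt_self_eq, Function.comp_id] using h
  have hd : HasFDerivAt (extChartAt 𝓘(ℝ, E) (expProd G (List.finRange _) (0 : E)) ∘
      (expProd G (List.finRange (Module.finrank ℝ E)))) (ContinuousLinearMap.id ℝ E) 0 := by
    have h := (hasMFDerivAt_expProd (G := G) (E := E) (List.finRange _)).2
    have e : (((List.finRange (Module.finrank ℝ E)).map fun i =>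
      ((Module.finBasis ℝ E).coord i).toContinuousLinearMap.smulRight
        (Module.finBasis ℝ E i)).sum : E →L[ℝ] E) = ContinuousLinearMap.id ℝ E := by
      ext a
      rw [← List.ofFn_eq_map, List.sum_ofFn, sum_apply]
      simp only [ContinuousLinearMap.smulRight_apply]
      exact (Module.finBasis ℝ E).sum_repr a
    rw [e] at h
    simp only [mfld_simps, writtenInExtChartAt, chartAt_self_eq, Function.comp_id] at h ⊢
    exact hasFDerivWithinAt_univ.1 h
  have hs := hc.hasStrictFDerivAt' hd (by simp)
  have hm := hs.map_nhds_eq_of_equiv (f' := ContinuousLinearEquiv.refl ℝ E)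
  have hΨ := (contMDiff_expProd (G := G) (E := E) (List.finRange _)).continuous
  have he : (expProd G (List.finRange (Module.finrank ℝ E)) : E → G) =ᶠ[𝓝 0]
      (extChartAt 𝓘(ℝ, E) (expProd G (List.finRange _) (0 : E))).symm ∘
      (extChartAt 𝓘(ℝ, E) (expProd G (List.finRange _) (0 : E)) ∘
      (expProd G (List.finRange (Module.finrank ℝ E)))) := by
    filter_upwards [hΨ.continuousAt.preimage_mem_nhds (extChartAt_source_mem_nhds (I := 𝓘(ℝ, E))
      (expProd G (List.finRange _) (0 : E)))] with a ha
    exact ((extChartAt 𝓘(ℝ, E) _).left_inv ha).symm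
  rw [Filter.map_congr he, ← Filter.map_map, hm]
  have h := map_extChartAt_symm_nhdsWithin_range (I := 𝓘(ℝ, E))
    (expProd G (List.finRange _) (0 : E))
  rw [ModelWithCorners.range_eq_univ, nhdsWithin_univ] at h
  rw [Function.comp_apply, h, expProd_zero]

/-- Such a subgroup contains a neighbourhood of `1`, hence is open, hence closed, hence everything.
-/
theorem mem_of_expCurve_mem [ConnectedSpace G] (H : Subgroup G)
    (h : ∀ (v : GroupLieAlgebra 𝓘(ℝ, E) G) (t : ℝ), expCurve v t ∈ H) (g : G) : g ∈ H := by
  have : IsTopologicalGroup G := topologicalGroup_of_lieGroup 𝓘(ℝ, E) ∞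
  have h1 : (H : Set G) ∈ 𝓝 (1 : G) := by
    rw [← map_expProd_nhds (E := E)]
    refine Filter.mem_map.2 (Filter.univ_mem' fun a => ?_)
    refine H.list_prod_mem fun x hx => ?_
    obtain ⟨i, -, rfl⟩ := List.mem_map.1 hx
    exact h (basisVec G i) _
  have h2 : IsOpen (H : Set G) := H.isOpen_of_mem_nhds h1
  have h3 : IsClosed (H : Set G) := H.isClosed_of_isOpen h2
  have := IsClopen.eq_univ ⟨h3, h2⟩ ⟨1, H.one_mem⟩
  exact (Set.ext_iff.1 this g).2 trivial

end OneParameterSubgroups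

/-! ### Right translations and the modular function -/

section RightTranslation

open Measure

variable {G : Type*} [TopologicalSpace G] [Group G] [IsTopologicalGroup G] [T2Space G]
  [SecondCountableTopology G] [LocallyCompactSpace G] [MeasurableSpace G] [BorelSpace G]
  (μ : Measure G) [μ.IsHaarMeasure]

theorem lintegral_mul_right (f : G → ℝ≥0∞) (g : G) :
    ∫⁻ x, f (x * g) ∂μ = modularCharacterFun g * ∫⁻ x, f x ∂μ := by
  have h := lintegral_map_equiv (μ := μ) f (Homeomorph.mulRight g).toMeasurableEquiv
  have h2 : map (Homeomorph.mulRight g).toMeasurableEquiv μ = modularCharacterFun g • μ :=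
    map_right_mul_eq_modularCharacterFun_smul μ g
  rw [h2, lintegral_smul_measure] at h
  exact h.symm

theorem integral_mul_right (f : G → ℝ) (g : G) :
    ∫ x, f (x * g) ∂μ = modularCharacterFun g * ∫ x, f x ∂μ := by
  have h := integral_map_equiv (μ := μ) (Homeomorph.mulRight g).toMeasurableEquiv f
  have h2 : map (Homeomorph.mulRight g).toMeasurableEquiv μ = modularCharacterFun g • μ :=
    map_right_mul_eq_modularCharacterFun_smul μ g
  rw [h2, integral_smul_nnreal_measure] at h
  exact h.symm

theorem eLpNorm_mul_right {F : Type*} [NormedAddCommGroup F] {p : ℝ≥0∞} (hp : p ≠ ⊤) (f : G → F)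
    (g : G) : eLpNorm (fun x => f (x * g)) p μ =
      (modularCharacterFun g : ℝ≥0∞) ^ (1 / p).toReal * eLpNorm f p μ := by
  have h := (Homeomorph.mulRight g).toMeasurableEquiv.measurableEmbedding.eLpNorm_map_measure
    (μ := μ) (g := f) (p := p)
  have h2 : map (Homeomorph.mulRight g).toMeasurableEquiv μ =
      (modularCharacterFun g : ℝ≥0∞) • μ :=
    map_right_mul_eq_modularCharacterFun_smul μ g
  rw [h2, eLpNorm_smul_measure_of_ne_top hp, smul_eq_mul] at h
  exact h.symm

theorem quasiMeasurePreserving_mul_right' (g : G) :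
    QuasiMeasurePreserving (fun x => x * g) μ μ := by
  refine ⟨measurable_mul_const g, ?_⟩
  rw [map_right_mul_eq_modularCharacterFun_smul μ g]
  exact Measure.smul_absolutelyContinuous

/-- Up to the non-zero factor `∫ f`, the modular function is `g ↦ ∫ f (x g)` for a bump function
`f`. Inverting the variable gives `∫ f (y⁻¹ g)`, whose continuity in `g` is known. -/
theorem continuous_modularCharacterFun : Continuous (modularCharacterFun : G → NNReal) := by
  let ν := haar (G := G)
  obtain ⟨⟨f, f_cont⟩, f_comp, f_nonneg, f_one⟩ :
    ∃ f : C(G, ℝ), HasCompactSupport f ∧ 0 ≤ f ∧ f 1 ≠ 0 := exists_continuous_nonneg_pos 1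
  have h0 : ∫ x, f x ∂ν ≠ 0 :=
    ne_of_gt (f_cont.integral_pos_of_hasCompactSupport_nonneg_nonzero f_comp f_nonneg f_one)
  have h1 : Continuous fun g => ∫ x, f (x * g) ∂ν := by
    have h := continuous_integral_apply_inv_mul (μ := ν.inv) f_cont f_comp
    refine h.congr fun g => ?_
    refine (integral_map_equiv (MeasurableEquiv.inv G) (fun y => f (y⁻¹ * g))).trans ?_
    simp
  refine continuous_induced_rng.2 ?_
  refine (h1.div_const (∫ x, f x ∂ν)).congr fun g => ?_
  rw [integral_mul_right, mul_div_assoc, div_self h0, mul_one]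
  rfl

theorem locallyIntegrable_mul_right {f : G → ℝ} (hf : LocallyIntegrable f μ) (g : G) :
    LocallyIntegrable (fun x => f (x * g)) μ := by
  rw [locallyIntegrable_iff] at hf ⊢
  intro K hK
  have h1 : IsCompact ((fun x => x * g) '' K) := hK.image (continuous_mul_const g)
  have h2 := hf _ h1
  rw [← integrable_indicator_iff h1.measurableSet] at h2
  have e : K.indicator (fun x => f (x * g)) =
      fun x => ((fun x => x * g) '' K).indicator f (x * g) := by
    funext x
    by_cases hx : x ∈ K
    · rw [Set.indicator_of_mem hx, Set.indicator_of_mem (Set.mem_image_of_mem _ hx)]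
    · rw [Set.indicator_of_notMem hx, Set.indicator_of_notMem]
      rintro ⟨y, hy, hxy⟩
      exact hx (mul_right_cancel hxy ▸ hy)
  rw [← integrable_indicator_iff hK.measurableSet, e]
  have h3 : Integrable (((fun x => x * g) '' K).indicator f)
      (map (Homeomorph.mulRight g).toMeasurableEquiv μ) := by
    have h4 : map (Homeomorph.mulRight g).toMeasurableEquiv μ = modularCharacterFun g • μ :=
      map_right_mul_eq_modularCharacterFun_smul μ g
    rw [h4]
    exact h2.smul_measure_nnreal
  exact (integrable_map_equiv _ _).1 h3

/-- The logarithm of the modular function along `γ` is continuous and additive, hence linear. The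
sign is such that `c` turns out to be the divergence. -/
theorem exists_modularCharacterFun_eq_exp {γ : ℝ → G} (hγ : Continuous γ)
    (hadd : ∀ s t, γ (s + t) = γ s * γ t) :
    ∃ c : ℝ, ∀ t, (modularCharacterFun (γ t) : ℝ) = Real.exp (-(c * t)) := by
  have hpos (t : ℝ) : (0 : ℝ) < modularCharacterFun (γ t) := modularCharacterFun_pos _
  let F : ℝ →+ ℝ := AddMonoidHom.mk' (fun t => Real.log (modularCharacterFun (γ t))) (by
    intro s t
    rw [hadd, modularCharacterFun_map_mul, NNReal.coe_mul,
      Real.log_mul (hpos s).ne' (hpos t).ne'])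
  have hF : Continuous F :=
    (NNReal.continuous_coe.comp (continuous_modularCharacterFun.comp hγ)).log
      fun t => (hpos t).ne'
  refine ⟨-F 1, fun t => ?_⟩
  have h : F t = t * F 1 := by simpa using map_real_smul F hF t 1
  rw [← Real.exp_log (hpos t)]
  congr 1
  rw [neg_mul, neg_neg, mul_comm]
  exact h

end RightTranslation

/-! ### Test functions, their translates, and the divergence -/

section TestFunctions

open Measure

variable {E : Type*} [NormedAddCommGroup E] [NormedSpace ℝ E] [FiniteDimensional ℝ E]
  {G : Type*} [TopologicalSpace G] [ChartedSpace E G] [Group G] [LieGroup 𝓘(ℝ, E) ∞ G]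
  [T2Space G] [IsTopologicalGroup G]

/-- The right translate `x ↦ φ (x g)` of a test function. -/
def rightTranslate (g : G) (φ : TestFunction E G) : TestFunction E G :=
  ⟨fun x => φ.1 (x * g), φ.2.1.comp contMDiff_mul_right,
    φ.2.2.comp_homeomorph (Homeomorph.mulRight g)⟩

theorem mdifferentiable_testFunction (φ : TestFunction E G) :
    MDifferentiable 𝓘(ℝ, E) 𝓘(ℝ, ℝ) φ.1 :=
  φ.2.1.mdifferentiable (by simp)

theorem continuous_testFunction (φ : TestFunction E G) : Continuous φ.1 :=
  φ.2.1.continuous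

theorem hasDerivAt_mul_expCurve (φ : TestFunction E G) (v : GroupLieAlgebra 𝓘(ℝ, E) G)
    (x : G) (t : ℝ) :
    HasDerivAt (fun s => φ.1 (x * expCurve v s)) ((derivAlong v φ).1 (x * expCurve v t)) t :=
  hasDerivAt_comp_mul_expCurve (mdifferentiable_testFunction φ) v x t

/-- Identities between derivatives of test functions are checked along the curves `s ↦ x exp (s v)`,
by uniqueness of a one-variable derivative. -/
theorem derivAlong_eq {φ ψ : TestFunction E G} {v : GroupLieAlgebra 𝓘(ℝ, E) G} {x : G}
    (h : HasDerivAt (fun s => φ.1 (x * expCurve v s)) (ψ.1 x) 0) :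
    (derivAlong v φ).1 x = ψ.1 x := by
  have h1 := hasDerivAt_mul_expCurve φ v x 0
  rw [expCurve_zero, mul_one] at h1
  exact h1.unique h

theorem derivAlong_rightTranslate (φ : TestFunction E G) (v : GroupLieAlgebra 𝓘(ℝ, E) G) (t : ℝ) :
    derivAlong v (rightTranslate (expCurve v t) φ) =
      rightTranslate (expCurve v t) (derivAlong v φ) := by
  refine Subtype.ext (funext fun x => derivAlong_eq ?_)
  have h := HasDerivAt.comp_add_const (0 : ℝ) t (hasDerivAt_mul_expCurve φ v x (0 + t))
  simpa [rightTranslate, expCurve_add, mul_assoc] using h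

theorem derivAlong_add_left (v w : GroupLieAlgebra 𝓘(ℝ, E) G) (φ : TestFunction E G) :
    derivAlong (v + w) φ = derivAlong v φ + derivAlong w φ := by
  refine Subtype.ext (funext fun x => ?_)
  show mfderiv 𝓘(ℝ, E) 𝓘(ℝ, ℝ) φ.1 x (mulInvariantVectorField (v + w) x) = _
  rw [mulInvariantVectorField_add]
  exact map_add (mfderiv 𝓘(ℝ, E) 𝓘(ℝ, ℝ) φ.1 x : E →L[ℝ] ℝ) _ _

theorem derivAlong_smul_left (c : ℝ) (v : GroupLieAlgebra 𝓘(ℝ, E) G) (φ : TestFunction E G) :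
    derivAlong (c • v) φ = c • derivAlong v φ := by
  refine Subtype.ext (funext fun x => ?_)
  show mfderiv 𝓘(ℝ, E) 𝓘(ℝ, ℝ) φ.1 x (mulInvariantVectorField (c • v) x) = _
  rw [mulInvariantVectorField_smul]
  exact map_smul (mfderiv 𝓘(ℝ, E) 𝓘(ℝ, ℝ) φ.1 x : E →L[ℝ] ℝ) _ _

theorem derivAlong_add (v : GroupLieAlgebra 𝓘(ℝ, E) G) (φ ψ : TestFunction E G) :
    derivAlong v (φ + ψ) = derivAlong v φ + derivAlong v ψ := by
  refine Subtype.ext (funext fun x => derivAlong_eq ?_)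
  have h := (hasDerivAt_mul_expCurve φ v x 0).add (hasDerivAt_mul_expCurve ψ v x 0)
  simpa [expCurve_zero] using! h

theorem derivAlong_smul (v : GroupLieAlgebra 𝓘(ℝ, E) G) (c : ℝ) (φ : TestFunction E G) :
    derivAlong v (c • φ) = c • derivAlong v φ := by
  refine Subtype.ext (funext fun x => derivAlong_eq ?_)
  have h := (hasDerivAt_mul_expCurve φ v x 0).const_mul c
  simpa [expCurve_zero] using! h

variable [SecondCountableTopology G] [LocallyCompactSpace G]
  [MeasurableSpace G] [BorelSpace G] (μ : Measure G) [μ.IsHaarMeasure]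

theorem integrable_mul_testFunction {f : G → ℝ} (hf : LocallyIntegrable f μ)
    (φ : TestFunction E G) : Integrable (fun x => f x * φ.1 x) μ := by
  have h3 := hf.integrable_smul_right_of_hasCompactSupport φ.2.1.continuous φ.2.2
  simpa [mul_comm] using h3

theorem hasDerivAt_integral_mul_expCurve_zero {f : G → ℝ} (hf : LocallyIntegrable f μ)
    (φ : TestFunction E G) (v : GroupLieAlgebra 𝓘(ℝ, E) G) :
    HasDerivAt (fun t => ∫ x, f x * φ.1 (x * expCurve v t) ∂μ)
      (∫ x, f x * (derivAlong v φ).1 x ∂μ) 0 := by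
  have hexp : Continuous (expCurve v : ℝ → G) := (isMIntegralCurve_expCurve v).continuous
  obtain ⟨C, hC⟩ := (derivAlong v φ).2.2.exists_bound_of_continuous (continuous_testFunction (derivAlong v φ))
  -- For `|t| ≤ 1` the supports of the translated derivatives stay in this compact set, which
  -- carries the dominating function.
  set K : Set G := (fun q : G × ℝ => q.1 * (expCurve v q.2)⁻¹) ''
    (tsupport (derivAlong v φ).1 ×ˢ Set.Icc (-1) 1) with hKdef
  have hK : IsCompact K := ((derivAlong v φ).2.2.isCompact.prod isCompact_Icc).image
    (continuous_fst.mul (hexp.comp continuous_snd).inv)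
  have key := hasDerivAt_integral_of_dominated_loc_of_deriv_le (μ := μ)
    (F := fun t x => f x * φ.1 (x * expCurve v t))
    (F' := fun t x => f x * (derivAlong v φ).1 (x * expCurve v t)) (x₀ := (0 : ℝ))
    (s := Set.Icc (-1) 1) (bound := K.indicator fun x => ‖f x‖ * C)
    (Icc_mem_nhds (by norm_num) (by norm_num))
    (Eventually.of_forall fun t =>
      (integrable_mul_testFunction μ hf (rightTranslate (expCurve v t) φ)).aestronglyMeasurable)
    (integrable_mul_testFunction μ hf (rightTranslate (expCurve v 0) φ))
    (integrable_mul_testFunction μ hf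
      (rightTranslate (expCurve v 0) (derivAlong v φ))).aestronglyMeasurable
    ?_ ?_ ?_
  · simpa [expCurve_zero] using key.2
  · refine Eventually.of_forall fun x t ht => ?_
    by_cases hx : x ∈ K
    · rw [Set.indicator_of_mem hx, norm_mul]
      exact mul_le_mul_of_nonneg_left (hC _) (norm_nonneg _)
    · rw [Set.indicator_of_notMem hx]
      have : (derivAlong v φ).1 (x * expCurve v t) = 0 := by
        by_contra h
        exact hx ⟨(x * expCurve v t, t), ⟨subset_tsupport _ h, ht⟩, by simp⟩
      simp [this]
  · rw [integrable_indicator_iff hK.measurableSet]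
    exact (hf.integrableOn_isCompact hK).norm.mul_const C
  · exact Eventually.of_forall fun x t ht => (hasDerivAt_mul_expCurve φ v x t).const_mul (f x)

theorem hasDerivAt_integral_mul_expCurve {f : G → ℝ} (hf : LocallyIntegrable f μ)
    (φ : TestFunction E G) (v : GroupLieAlgebra 𝓘(ℝ, E) G) (t : ℝ) :
    HasDerivAt (fun t => ∫ x, f x * φ.1 (x * expCurve v t) ∂μ)
      (∫ x, f x * (derivAlong v φ).1 (x * expCurve v t) ∂μ) t := by
  have h := hasDerivAt_integral_mul_expCurve_zero μ hf (rightTranslate (expCurve v t) φ) v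
  rw [derivAlong_rightTranslate] at h
  have h2 : HasDerivAt (fun s => ∫ x, f x * φ.1 (x * expCurve v (s + t)) ∂μ)
      (∫ x, f x * (derivAlong v φ).1 (x * expCurve v t) ∂μ) (t - t) := by
    rw [sub_self]
    simpa [rightTranslate, expCurve_add, mul_assoc] using h
  simpa using h2.comp_sub_const t t

theorem exists_testFunction_integral_ne_zero : ∃ φ : TestFunction E G, ∫ x, φ.1 x ∂μ ≠ 0 := by
  have : IsManifold 𝓘(ℝ, E) ∞ G := inferInstance
  obtain ⟨f⟩ : Nonempty (SmoothBumpFunction 𝓘(ℝ, E) (1 : G)) := inferInstance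
  refine ⟨⟨f, f.contMDiff, f.hasCompactSupport⟩, ne_of_gt ?_⟩
  exact f.continuous.integral_pos_of_hasCompactSupport_nonneg_nonzero f.hasCompactSupport
    (fun x => f.nonneg) (x := 1) (by simp)

/-- Differentiating `∫ φ (x exp (t v)) = exp (-c t) ∫ φ` at `t = 0` shows that `c` satisfies the
identity defining the divergence. A test function with non-zero integral shows that no other
constant does, so the chosen constant is `c`. -/
theorem exists_divergence (v : GroupLieAlgebra 𝓘(ℝ, E) G) :
    (∀ φ : TestFunction E G, ∫ x, (derivAlong v φ).1 x ∂μ = -(divergence μ v * ∫ x, φ.1 x ∂μ)) ∧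
    ∀ t, (modularCharacterFun (expCurve v t) : ℝ) = Real.exp (-(divergence μ v * t)) := by
  obtain ⟨c, hc⟩ := exists_modularCharacterFun_eq_exp (γ := (expCurve v : ℝ → G))
    (isMIntegralCurve_expCurve v).continuous (expCurve_add v)
  have h1 : ∀ φ : TestFunction E G, ∫ x, (derivAlong v φ).1 x ∂μ = -(c * ∫ x, φ.1 x ∂μ) := by
    intro φ
    have h := hasDerivAt_integral_mul_expCurve_zero μ (f := fun _ => 1)
      (locallyIntegrable_const 1) φ v
    simp only [one_mul, integral_mul_right, hc] at h
    have h2 : HasDerivAt (fun t => Real.exp (-(c * t)) * ∫ x, φ.1 x ∂μ)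
        (Real.exp (-(c * 0)) * -(c * 1) * ∫ x, φ.1 x ∂μ) 0 :=
      (((hasDerivAt_id (0 : ℝ)).const_mul c).neg.exp).mul_const _
    rw [h.unique h2]
    simp
  have hex : ∃ c : ℝ, ∀ φ : TestFunction E G,
      ∫ x, (derivAlong v φ).1 x ∂μ = -(c * ∫ x, φ.1 x ∂μ) := ⟨c, h1⟩
  have h3 : divergence μ v = hex.choose := by rw [divergence, dif_pos hex]
  have h4 : divergence μ v = c := by
    obtain ⟨φ, hφ⟩ := exists_testFunction_integral_ne_zero (E := E) μ
    have h5 := hex.choose_spec φ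
    rw [← h3, h1 φ, neg_inj] at h5
    exact (mul_right_cancel₀ hφ h5).symm
  rw [h4]
  exact ⟨h1, hc⟩

theorem integral_derivAlong (v : GroupLieAlgebra 𝓘(ℝ, E) G) (φ : TestFunction E G) :
    ∫ x, (derivAlong v φ).1 x ∂μ = -(divergence μ v * ∫ x, φ.1 x ∂μ) :=
  (exists_divergence μ v).1 φ

theorem modularCharacterFun_expCurve (v : GroupLieAlgebra 𝓘(ℝ, E) G) (t : ℝ) :
    (modularCharacterFun (expCurve v t) : ℝ) = Real.exp (-(divergence μ v * t)) :=
  (exists_divergence μ v).2 t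

theorem divergence_add (v w : GroupLieAlgebra 𝓘(ℝ, E) G) :
    divergence μ (v + w) = divergence μ v + divergence μ w := by
  obtain ⟨φ, hφ⟩ := exists_testFunction_integral_ne_zero (E := E) μ
  have hi (ψ : TestFunction E G) : Integrable ψ.1 μ :=
    (continuous_testFunction ψ).integrable_of_hasCompactSupport ψ.2.2
  have h := integral_derivAlong μ (v + w) φ
  rw [derivAlong_add_left] at h
  have h2 : ∫ x, (derivAlong v φ + derivAlong w φ).1 x ∂μ = _ :=
    integral_add (hi (derivAlong v φ)) (hi (derivAlong w φ))
  rw [h2, integral_derivAlong, integral_derivAlong] at h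
  apply mul_right_cancel₀ hφ
  linarith

theorem divergence_smul (c : ℝ) (v : GroupLieAlgebra 𝓘(ℝ, E) G) :
    divergence μ (c • v) = c * divergence μ v := by
  obtain ⟨φ, hφ⟩ := exists_testFunction_integral_ne_zero (E := E) μ
  have h := integral_derivAlong μ (c • v) φ
  rw [derivAlong_smul_left] at h
  have h2 : ∫ x, (c • derivAlong v φ).1 x ∂μ = _ := integral_const_mul c _
  rw [h2, integral_derivAlong] at h
  apply mul_right_cancel₀ hφ
  linarith

end TestFunctions

/-! ### Measurability and Fubini for translates along a curve -/

section TranslateFubini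

open Measure

variable {G : Type*} [TopologicalSpace G] [Group G] [IsTopologicalGroup G] [T2Space G]
  [SecondCountableTopology G] [LocallyCompactSpace G] [MeasurableSpace G] [BorelSpace G]
  (μ : Measure G) [μ.IsHaarMeasure]
  {Y : Type*} [TopologicalSpace Y] [SecondCountableTopology Y] [MeasurableSpace Y] [BorelSpace Y]
  {ν : Measure Y} [SFinite ν]

/-- Preimages of null sets are null in the product, so functions defined almost everywhere can be
composed with `(y, x) ↦ x γ(y)`. -/
theorem quasiMeasurePreserving_mul_curve {γ : Y → G} (hγ : Continuous γ) :
    QuasiMeasurePreserving (fun q : Y × G => q.2 * γ q.1) (ν.prod μ) μ := by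
  refine QuasiMeasurePreserving.prod_of_right ?_ (Eventually.of_forall fun y =>
    quasiMeasurePreserving_mul_right' μ (γ y))
  exact measurable_snd.mul (hγ.measurable.comp measurable_fst)

theorem aestronglyMeasurable_mul_curve {F : Type*} [TopologicalSpace F] {γ : Y → G}
    (hγ : Continuous γ) {h : G → F} (hh : AEStronglyMeasurable h μ) :
    AEStronglyMeasurable (fun q : Y × G => h (q.2 * γ q.1)) (ν.prod μ) :=
  hh.comp_quasiMeasurePreserving (quasiMeasurePreserving_mul_curve μ hγ)

theorem integrable_mul_curve [IsFiniteMeasureOnCompacts ν] [T2Space Y] {γ : Y → G}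
    (hγ : Continuous γ) {h : G → ℝ}
    (hh : LocallyIntegrable h μ) {A : Set Y} (hA : IsCompact A) {K : Set G} (hK : IsCompact K) :
    Integrable (fun q : Y × G => h (q.2 * γ q.1)) ((ν.restrict A).prod (μ.restrict K)) := by
  have hm := aestronglyMeasurable_mul_curve (ν := ν) μ hγ hh.aestronglyMeasurable
  have hm' : AEStronglyMeasurable (fun q : Y × G => h (q.2 * γ q.1))
      ((ν.restrict A).prod (μ.restrict K)) := by
    rw [prod_restrict]
    exact hm.restrict
  refine ⟨hm', ?_⟩
  -- All translates `K γ(y)`, for `y ∈ A`, lie in one compact set, and the modular function is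
  -- bounded along `γ` on `A`.
  have hAK : IsCompact ((fun q : G × Y => q.1 * γ q.2) '' (K ×ˢ A)) :=
    (hK.prod hA).image (continuous_fst.mul (hγ.comp continuous_snd))
  set L := (fun q : G × Y => q.1 * γ q.2) '' (K ×ˢ A)
  obtain ⟨C, hC⟩ := hA.exists_bound_of_continuousOn
    (NNReal.continuous_coe.comp (continuous_modularCharacterFun.comp hγ)).continuousOn
  have hfin : ∫⁻ x in L, ‖h x‖ₑ ∂μ < ⊤ := (hh.integrableOn_isCompact hAK).2
  rw [hasFiniteIntegral_iff_enorm, lintegral_prod _ hm'.enorm]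
  calc ∫⁻ y in A, ∫⁻ x in K, ‖h (x * γ y)‖ₑ ∂μ ∂ν
      ≤ ∫⁻ y in A, ENNReal.ofReal C * ∫⁻ x in L, ‖h x‖ₑ ∂μ ∂ν := by
        refine setLIntegral_mono' hA.measurableSet fun y hy => ?_
        calc ∫⁻ x in K, ‖h (x * γ y)‖ₑ ∂μ
            ≤ ∫⁻ x, L.indicator (fun x => ‖h x‖ₑ) (x * γ y) ∂μ := by
              rw [← lintegral_indicator hK.measurableSet]
              refine lintegral_mono fun x => ?_
              by_cases hx : x ∈ K
              · have : x * γ y ∈ L := ⟨(x, y), ⟨hx, hy⟩, rfl⟩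
                rw [Set.indicator_of_mem hx, Set.indicator_of_mem this]
              · rw [Set.indicator_of_notMem hx]
                exact bot_le
          _ = modularCharacterFun (γ y) * ∫⁻ x in L, ‖h x‖ₑ ∂μ := by
              rw [lintegral_mul_right, lintegral_indicator hAK.measurableSet]
          _ ≤ ENNReal.ofReal C * ∫⁻ x in L, ‖h x‖ₑ ∂μ := by
              gcongr
              rw [← ENNReal.ofReal_coe_nnreal]
              exact ENNReal.ofReal_le_ofReal ((le_abs_self _).trans (hC y hy))
    _ < ⊤ := by
        rw [lintegral_const, restrict_apply_univ]
        exact ENNReal.mul_lt_top (ENNReal.mul_lt_top ENNReal.ofReal_lt_top hfin)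
          hA.measure_lt_top

theorem locallyIntegrable_integral_mul_curve [IsFiniteMeasureOnCompacts ν] [T2Space Y] {γ : Y → G}
    (hγ : Continuous γ) {h : G → ℝ} (hh : LocallyIntegrable h μ) {A : Set Y} (hA : IsCompact A) :
    LocallyIntegrable (fun x => ∫ y in A, h (x * γ y) ∂ν) μ := by
  rw [locallyIntegrable_iff]
  intro K hK
  exact (integrable_mul_curve (ν := ν) μ hγ hh hA hK).integral_prod_right

theorem integral_integral_mul_curve [IsFiniteMeasureOnCompacts ν] [T2Space Y] {γ : Y → G}
    (hγ : Continuous γ) {h : G → ℝ} (hh : LocallyIntegrable h μ) {A : Set Y} (hA : IsCompact A)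
    {φ : G → ℝ} (hφ : Continuous φ) (hφ' : HasCompactSupport φ) :
    ∫ y in A, ∫ x, h (x * γ y) * φ x ∂μ ∂ν = ∫ x, (∫ y in A, h (x * γ y) ∂ν) * φ x ∂μ := by
  have h1 := integrable_mul_curve (ν := ν) μ hγ hh hA hφ'.isCompact
  obtain ⟨C, hC⟩ := hφ'.exists_bound_of_continuous hφ
  have h2 : Integrable (fun q : Y × G => h (q.2 * γ q.1) * φ q.2)
      ((ν.restrict A).prod (μ.restrict (tsupport φ))) :=
    h1.mul_bdd (c := C) (hφ.comp continuous_snd).aestronglyMeasurable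
      (Eventually.of_forall fun q => hC q.2)
  have h3 := integral_integral_swap (f := fun y x => h (x * γ y) * φ x) h2
  have e (F : G → ℝ) : ∫ x in tsupport φ, F x * φ x ∂μ = ∫ x, F x * φ x ∂μ := by
    refine setIntegral_eq_integral_of_forall_compl_eq_zero fun x hx => ?_
    rw [image_eq_zero_of_notMem_tsupport hx, mul_zero]
  simp only [e, integral_mul_const] at h3
  exact h3

end TranslateFubini

/-! ### Weak derivatives and integration along the flow -/

section WeakDerivative

open Measure

variable {E : Type*} [NormedAddCommGroup E] [NormedSpace ℝ E] [FiniteDimensional ℝ E]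
  {G : Type*} [TopologicalSpace G] [ChartedSpace E G] [Group G] [LieGroup 𝓘(ℝ, E) ∞ G]
  [T2Space G] [IsTopologicalGroup G] [SecondCountableTopology G] [LocallyCompactSpace G]
  [MeasurableSpace G] [BorelSpace G] (μ : Measure G) [μ.IsHaarMeasure]

theorem continuous_expCurve (v : GroupLieAlgebra 𝓘(ℝ, E) G) :
    Continuous (expCurve v : ℝ → G) := (isMIntegralCurve_expCurve v).continuous

theorem adjDeriv_rightTranslate (v : GroupLieAlgebra 𝓘(ℝ, E) G) (φ : TestFunction E G) (t : ℝ) :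
    adjDeriv μ v (rightTranslate (expCurve v t) φ) =
      rightTranslate (expCurve v t) (adjDeriv μ v φ) := by
  rw [adjDeriv, derivAlong_rightTranslate]
  rfl

theorem integral_mul_right_mul (f φ : G → ℝ) (g : G) :
    ∫ x, f (x * g) * φ x ∂μ = modularCharacterFun g * ∫ x, f x * φ (x * g⁻¹) ∂μ := by
  rw [← integral_mul_right μ (fun x => f x * φ (x * g⁻¹))]
  simp

theorem integral_mul_expCurve_mul (f φ : G → ℝ) (v : GroupLieAlgebra 𝓘(ℝ, E) G) (t : ℝ) :
    ∫ x, f (x * expCurve v t) * φ x ∂μ =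
      Real.exp (-(divergence μ v * t)) * ∫ x, f x * φ (x * expCurve v (-t)) ∂μ := by
  rw [integral_mul_right_mul, modularCharacterFun_expCurve μ, expCurve_neg]

/-- Moving the translation onto `φ` costs the factor `exp (-t div v)`; differentiating this factor
produces the divergence term of `adjDeriv`. -/
theorem hasDerivAt_integral_translate {f : G → ℝ} (hf : LocallyIntegrable f μ)
    (φ : TestFunction E G) (v : GroupLieAlgebra 𝓘(ℝ, E) G) (t : ℝ) :
    HasDerivAt (fun t => ∫ x, f (x * expCurve v t) * φ.1 x ∂μ)
      (-∫ x, f (x * expCurve v t) * (adjDeriv μ v φ).1 x ∂μ) t := by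
  have h1 := (hasDerivAt_integral_mul_expCurve μ hf φ v (-t)).comp t (hasDerivAt_neg t)
  have h2 : HasDerivAt (fun t => Real.exp (-(divergence μ v * t)))
      (Real.exp (-(divergence μ v * t)) * -(divergence μ v * 1)) t :=
    ((hasDerivAt_id t).const_mul _).neg.exp
  have h3 := h2.mul h1
  simp only [integral_mul_expCurve_mul μ f]
  refine h3.congr_deriv ?_
  have h4 : ∫ x, f x * (adjDeriv μ v φ).1 (x * expCurve v (-t)) ∂μ =
      ∫ x, f x * (derivAlong v φ).1 (x * expCurve v (-t)) ∂μ +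
        divergence μ v * ∫ x, f x * φ.1 (x * expCurve v (-t)) ∂μ := by
    rw [← integral_const_mul]
    refine Eq.trans ?_ (integral_add
      (integrable_mul_testFunction μ hf (rightTranslate (expCurve v (-t)) (derivAlong v φ)))
      ((integrable_mul_testFunction μ hf (rightTranslate (expCurve v (-t)) φ)).const_mul _))
    refine integral_congr_ae (Eventually.of_forall fun x => ?_)
    show f x * ((derivAlong v φ).1 _ + divergence μ v * φ.1 _) =
      f x * (derivAlong v φ).1 _ + divergence μ v * (f x * φ.1 _)
    ring
  rw [h4]
  simp only [Function.comp]
  ring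

theorem continuous_integral_translate {f : G → ℝ} (hf : LocallyIntegrable f μ)
    (φ : TestFunction E G) (v : GroupLieAlgebra 𝓘(ℝ, E) G) :
    Continuous fun t => ∫ x, f (x * expCurve v t) * φ.1 x ∂μ :=
  continuous_iff_continuousAt.2 fun t => (hasDerivAt_integral_translate μ hf φ v t).continuousAt

theorem intervalIntegral_integral_translate {h : G → ℝ} (hh : LocallyIntegrable h μ)
    (φ : TestFunction E G) (v : GroupLieAlgebra 𝓘(ℝ, E) G) {t : ℝ} (ht : 0 ≤ t) :
    ∫ s in (0 : ℝ)..t, ∫ x, h (x * expCurve v s) * φ.1 x ∂μ =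
      ∫ x, (∫ s in (0 : ℝ)..t, h (x * expCurve v s)) * φ.1 x ∂μ := by
  simp only [intervalIntegral.integral_of_le ht, ← integral_Icc_eq_integral_Ioc]
  exact integral_integral_mul_curve μ (continuous_expCurve v) hh isCompact_Icc
    (continuous_testFunction φ) φ.2.2

theorem locallyIntegrable_intervalIntegral {h : G → ℝ} (hh : LocallyIntegrable h μ)
    (v : GroupLieAlgebra 𝓘(ℝ, E) G) {t : ℝ} (ht : 0 ≤ t) :
    LocallyIntegrable (fun x => ∫ s in (0 : ℝ)..t, h (x * expCurve v s)) μ := by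
  simp only [intervalIntegral.integral_of_le ht, ← integral_Icc_eq_integral_Ioc]
  exact locallyIntegrable_integral_mul_curve μ (continuous_expCurve v) hh isCompact_Icc

variable (E) in
theorem ae_eq_of_forall_testFunction {f h : G → ℝ} (hf : LocallyIntegrable f μ)
    (hh : LocallyIntegrable h μ)
    (H : ∀ φ : TestFunction E G, ∫ x, f x * φ.1 x ∂μ = ∫ x, h x * φ.1 x ∂μ) : f =ᵐ[μ] h := by
  have : IsManifold 𝓘(ℝ, E) ∞ G := inferInstance
  refine ae_eq_of_integral_contMDiff_smul_eq 𝓘(ℝ, E) hf hh fun g hg hg' => ?_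
  simpa [mul_comm] using H ⟨g, hg, hg'⟩

/-- If `h` is the derivative of `f` along the left-invariant field of `v` in the sense of
distributions, then `f` is recovered by integrating `h` along the flow. -/
theorem translate_sub_ae_eq {f h : G → ℝ} (hf : LocallyIntegrable f μ)
    (hh : LocallyIntegrable h μ) (v : GroupLieAlgebra 𝓘(ℝ, E) G)
    (H : ∀ φ : TestFunction E G, -∫ x, f x * (adjDeriv μ v φ).1 x ∂μ = ∫ x, h x * φ.1 x ∂μ)
    {t : ℝ} (ht : 0 ≤ t) :
    (fun x => f (x * expCurve v t) - f x) =ᵐ[μ]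
      fun x => ∫ s in (0 : ℝ)..t, h (x * expCurve v s) := by
  refine ae_eq_of_forall_testFunction E μ ((locallyIntegrable_mul_right μ hf _).sub hf)
    (locallyIntegrable_intervalIntegral μ hh v ht) fun φ => ?_
  -- The weak identity, tested on translates of `φ`, gives the derivative at every time `s`, because
  -- `adjDeriv μ v` commutes with the flow of `v`.
  have hd : ∀ s, HasDerivAt (fun t => ∫ x, f (x * expCurve v t) * φ.1 x ∂μ)
      (∫ x, h (x * expCurve v s) * φ.1 x ∂μ) s := fun s => by
    refine (hasDerivAt_integral_translate μ hf φ v s).congr_deriv ?_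
    rw [integral_mul_expCurve_mul μ h, integral_mul_expCurve_mul μ f, neg_mul_eq_mul_neg]
    congr 1
    have := H (rightTranslate (expCurve v (-s)) φ)
    rwa [adjDeriv_rightTranslate] at this
  have h1 := intervalIntegral.integral_eq_sub_of_hasDerivAt (a := 0) (b := t) (fun s _ => hd s)
    ((continuous_integral_translate μ hh φ v).intervalIntegrable _ _)
  rw [← intervalIntegral_integral_translate μ hh φ v ht, h1]
  simp only [expCurve_zero, mul_one, sub_mul]
  exact integral_sub (integrable_mul_testFunction μ (locallyIntegrable_mul_right μ hf _) φ)
    (integrable_mul_testFunction μ hf φ)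

/-- Converse of `translate_sub_ae_eq`: pair both sides with `φ` and compare right derivatives at `t
= 0`. -/
theorem weak_derivative_of_translate_sub {f h : G → ℝ} (hf : LocallyIntegrable f μ)
    (hh : LocallyIntegrable h μ) (v : GroupLieAlgebra 𝓘(ℝ, E) G)
    (H : ∀ t : ℝ, 0 ≤ t → (fun x => f (x * expCurve v t) - f x) =ᵐ[μ]
      fun x => ∫ s in (0 : ℝ)..t, h (x * expCurve v s)) (φ : TestFunction E G) :
    -∫ x, f x * (adjDeriv μ v φ).1 x ∂μ = ∫ x, h x * φ.1 x ∂μ := by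
  have h1 := (hasDerivAt_integral_translate μ hf φ v 0).hasDerivWithinAt (s := Set.Ici 0)
  have hc := continuous_integral_translate μ hh φ v
  have h2 := ((intervalIntegral.integral_hasDerivAt_right (hc.intervalIntegrable 0 0)
    hc.aestronglyMeasurable.stronglyMeasurableAtFilter hc.continuousAt).add_const
    (∫ x, f x * φ.1 x ∂μ)).hasDerivWithinAt (s := Set.Ici 0)
  have h3 : ∀ t ∈ Set.Ici (0 : ℝ), ∫ x, f (x * expCurve v t) * φ.1 x ∂μ =
      (∫ s in (0 : ℝ)..t, ∫ x, h (x * expCurve v s) * φ.1 x ∂μ) + ∫ x, f x * φ.1 x ∂μ := by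
    intro t ht
    rw [intervalIntegral_integral_translate μ hh φ v ht, ← sub_eq_iff_eq_add, ← integral_sub
      (integrable_mul_testFunction μ (locallyIntegrable_mul_right μ hf _) φ)
      (integrable_mul_testFunction μ hf φ)]
    refine integral_congr_ae ?_
    filter_upwards [H t ht] with x hx
    rw [← hx]
    ring
  have h4 := h2.congr h3 (h3 0 Set.self_mem_Ici)
  have h5 := (uniqueDiffWithinAt_Ici (0 : ℝ)).eq_deriv _ h1 h4
  simpa [expCurve_zero] using h5

end WeakDerivative

/-! ### The Lie bracket of vector fields as a commutator of derivations -/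

section Commutator

variable {E : Type*} [NormedAddCommGroup E] [NormedSpace ℝ E] [FiniteDimensional ℝ E]
  {M : Type*} [TopologicalSpace M] [ChartedSpace E M] [IsManifold 𝓘(ℝ, E) ∞ M]

open VectorField

/-- The derivative of a function along a vector field. -/
def fieldDeriv (V : Π x : M, TangentSpace 𝓘(ℝ, E) x) (f : M → ℝ) (x : M) : ℝ :=
  (mfderiv 𝓘(ℝ, E) 𝓘(ℝ, ℝ) f x : E →L[ℝ] ℝ) (V x)

theorem two_le_infty : (2 : WithTop ℕ∞) ≤ ((⊤ : ℕ∞) : WithTop ℕ∞) := WithTop.coe_le_coe.2 (le_top : (2 : ℕ∞) ≤ ⊤)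

/-- The derivative of the inverse of the chart at `x`. -/
def chartSymmDeriv (x : M) (y : E) : E →L[ℝ] E :=
  mfderiv 𝓘(ℝ, E) 𝓘(ℝ, E) (extChartAt 𝓘(ℝ, E) x).symm y

/-- A vector field written in a chart. -/
def chartField (V : Π x : M, TangentSpace 𝓘(ℝ, E) x) (x : M) (y : E) : E :=
  (chartSymmDeriv x y).inverse (V ((extChartAt 𝓘(ℝ, E) x).symm y))

theorem mfderiv_chartField (V : Π x : M, TangentSpace 𝓘(ℝ, E) x) (x : M) {y : E}
    (hy : y ∈ (extChartAt 𝓘(ℝ, E) x).target) :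
    chartSymmDeriv x y (chartField V x y) = V ((extChartAt 𝓘(ℝ, E) x).symm y) := by
  have : IsManifold 𝓘(ℝ, E) 1 M := IsManifold.of_le (n := ∞) (by exact_mod_cast le_top)
  have h := isInvertible_mfderivWithin_extChartAt_symm (I := 𝓘(ℝ, E)) hy
  rw [ModelWithCorners.range_eq_univ, mfderivWithin_univ] at h
  have h' : (chartSymmDeriv x y).IsInvertible := h
  exact h'.self_apply_inverse _

theorem fieldDeriv_eq_fderiv {V : Π x : M, TangentSpace 𝓘(ℝ, E) x} {f : M → ℝ} {x : M}
    (hf : ContMDiff 𝓘(ℝ, E) 𝓘(ℝ, ℝ) ∞ f) {y : E}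
    (hy : y ∈ (extChartAt 𝓘(ℝ, E) x).target) :
    fieldDeriv V f ((extChartAt 𝓘(ℝ, E) x).symm y) =
      fderiv ℝ (f ∘ (extChartAt 𝓘(ℝ, E) x).symm) y (chartField V x y) := by
  have : IsManifold 𝓘(ℝ, E) 1 M := IsManifold.of_le (n := ∞) (by exact_mod_cast le_top)
  have h1 : MDifferentiableAt 𝓘(ℝ, E) 𝓘(ℝ, E) (extChartAt 𝓘(ℝ, E) x).symm y := by
    have := mdifferentiableWithinAt_extChartAt_symm (I := 𝓘(ℝ, E)) hy
    rwa [ModelWithCorners.range_eq_univ, mdifferentiableWithinAt_univ] at this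
  have h2 := mfderiv_comp y (hf.mdifferentiable (by simp) _) h1
  rw [mfderiv_eq_fderiv] at h2
  rw [fieldDeriv, ← mfderiv_chartField V x hy]
  exact (congrArg (fun L : E →L[ℝ] ℝ => L (chartField V x y)) h2).symm

theorem contDiffAt_chart_symm {f : M → ℝ} (hf : ContMDiff 𝓘(ℝ, E) 𝓘(ℝ, ℝ) ∞ f) (x : M) :
    ContDiffAt ℝ ∞ (f ∘ (extChartAt 𝓘(ℝ, E) x).symm) (extChartAt 𝓘(ℝ, E) x x) := by
  have h := (contMDiffAt_iff.1 (hf x)).2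
  simpa only [mfld_simps, contDiffWithinAt_univ, chartAt_self_eq, Function.id_comp] using h

theorem differentiableAt_chartField {V : Π x : M, TangentSpace 𝓘(ℝ, E) x} (x : M)
    (hV : ContMDiff 𝓘(ℝ, E) 𝓘(ℝ, E).tangent ∞ (fun y => (⟨y, V y⟩ : TangentBundle 𝓘(ℝ, E) M))) :
    DifferentiableAt ℝ (chartField V x) (extChartAt 𝓘(ℝ, E) x x) := by
  have : CompleteSpace E := FiniteDimensional.complete ℝ E
  have : IsManifold 𝓘(ℝ, E) 2 M := IsManifold.of_le (n := ∞) two_le_infty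
  have h := ((hV.mdifferentiable (by simp) x).mdifferentiableWithinAt
      (s := Set.univ)).differentiableWithinAt_mpullbackWithin_vectorField
  rw [ModelWithCorners.range_eq_univ, mpullbackWithin_univ, Set.preimage_univ, Set.univ_inter]
    at h
  have h' : DifferentiableWithinAt ℝ (chartField V x) Set.univ (extChartAt 𝓘(ℝ, E) x x) := h
  exact differentiableWithinAt_univ.1 h'

theorem chartField_self (V : Π x : M, TangentSpace 𝓘(ℝ, E) x) (x : M) :
    chartField V x (extChartAt 𝓘(ℝ, E) x x) = V x := by
  have : IsManifold 𝓘(ℝ, E) 1 M := IsManifold.of_le (n := ∞) (by exact_mod_cast le_top)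
  have h := mfderivWithin_range_extChartAt_symm (I := 𝓘(ℝ, E)) (x := x)
  rw [ModelWithCorners.range_eq_univ, mfderivWithin_univ] at h
  have h2 : chartSymmDeriv x (extChartAt 𝓘(ℝ, E) x x) = ContinuousLinearMap.id ℝ E := h
  have h3 := mfderiv_chartField V x (mem_extChartAt_target (I := 𝓘(ℝ, E)) x)
  rw [h2] at h3
  have h4 : ∀ z, z = x → (V z : E) = V x := by rintro _ rfl; rfl
  exact h3.trans (h4 _ (extChartAt_to_inv x))

/-- The product rule in the chart at `x`. The second-derivative term is symmetric in the two fields,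
so only the first-order term survives in the commutator. -/
theorem fieldDeriv_fieldDeriv {V W : Π x : M, TangentSpace 𝓘(ℝ, E) x} {f : M → ℝ} {x : M}
    (hf : ContMDiff 𝓘(ℝ, E) 𝓘(ℝ, ℝ) ∞ f)
    (hW : ContMDiff 𝓘(ℝ, E) 𝓘(ℝ, E).tangent ∞ (fun y => (⟨y, W y⟩ : TangentBundle 𝓘(ℝ, E) M)))
    (hWf : MDifferentiable 𝓘(ℝ, E) 𝓘(ℝ, ℝ) (fieldDeriv W f)) :
    fieldDeriv V (fieldDeriv W f) x =
      fderiv ℝ (fderiv ℝ (f ∘ (extChartAt 𝓘(ℝ, E) x).symm)) (extChartAt 𝓘(ℝ, E) x x)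
        (chartField V x (extChartAt 𝓘(ℝ, E) x x)) (chartField W x (extChartAt 𝓘(ℝ, E) x x)) +
      fderiv ℝ (f ∘ (extChartAt 𝓘(ℝ, E) x).symm) (extChartAt 𝓘(ℝ, E) x x)
        (fderiv ℝ (chartField W x) (extChartAt 𝓘(ℝ, E) x x)
          (chartField V x (extChartAt 𝓘(ℝ, E) x x))) := by
  have : IsManifold 𝓘(ℝ, E) 1 M := IsManifold.of_le (n := ∞) (by exact_mod_cast le_top)
  set y := extChartAt 𝓘(ℝ, E) x x with hy
  have h1 : MDifferentiableAt 𝓘(ℝ, E) 𝓘(ℝ, E) (extChartAt 𝓘(ℝ, E) x).symm y := by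
    have := mdifferentiableWithinAt_extChartAt_symm (I := 𝓘(ℝ, E))
      (mem_extChartAt_target (I := 𝓘(ℝ, E)) x)
    rwa [ModelWithCorners.range_eq_univ, mdifferentiableWithinAt_univ] at this
  have h2 := mfderiv_comp y (hWf _) h1
  rw [mfderiv_eq_fderiv] at h2
  have h3 : ((fieldDeriv W f) ∘ (extChartAt 𝓘(ℝ, E) x).symm) =ᶠ[𝓝 y]
      fun z => fderiv ℝ (f ∘ (extChartAt 𝓘(ℝ, E) x).symm) z (chartField W x z) := by
    filter_upwards [extChartAt_target_mem_nhds (I := 𝓘(ℝ, E)) x] with z hz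
    exact fieldDeriv_eq_fderiv hf hz
  have h4 : DifferentiableAt ℝ (fderiv ℝ (f ∘ (extChartAt 𝓘(ℝ, E) x).symm)) y :=
    ((contDiffAt_chart_symm hf x).fderiv_right (m := 1)
      (by rw [one_add_one_eq_two]; exact two_le_infty)).differentiableAt
      (by simp)
  have h5 := h4.hasFDerivAt.clm_apply (differentiableAt_chartField x hW).hasFDerivAt
  have h6 := (h5.congr_of_eventuallyEq h3).fderiv
  have h7 : ∀ z, z = x → fieldDeriv V (fieldDeriv W f) z = fieldDeriv V (fieldDeriv W f) x := by
    rintro _ rfl; rfl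
  rw [← h7 _ (extChartAt_to_inv (I := 𝓘(ℝ, E)) x), fieldDeriv,
    ← mfderiv_chartField V x (mem_extChartAt_target (I := 𝓘(ℝ, E)) x)]
  refine (congrArg (fun L : E →L[ℝ] ℝ => L (chartField V x y)) h2).symm.trans ?_
  refine (congrArg (fun L : E →L[ℝ] ℝ => L (chartField V x y)) h6).trans ?_
  rw [add_apply, add_comm]
  rfl

/-- The Lie bracket of vector fields is the commutator of the derivations they define. -/
theorem fieldDeriv_mlieBracket {V W : Π x : M, TangentSpace 𝓘(ℝ, E) x} {f : M → ℝ}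
    (hf : ContMDiff 𝓘(ℝ, E) 𝓘(ℝ, ℝ) ∞ f)
    (hV : ContMDiff 𝓘(ℝ, E) 𝓘(ℝ, E).tangent ∞ (fun y => (⟨y, V y⟩ : TangentBundle 𝓘(ℝ, E) M)))
    (hW : ContMDiff 𝓘(ℝ, E) 𝓘(ℝ, E).tangent ∞ (fun y => (⟨y, W y⟩ : TangentBundle 𝓘(ℝ, E) M)))
    (hVf : MDifferentiable 𝓘(ℝ, E) 𝓘(ℝ, ℝ) (fieldDeriv V f))
    (hWf : MDifferentiable 𝓘(ℝ, E) 𝓘(ℝ, ℝ) (fieldDeriv W f)) (x : M) :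
    fieldDeriv (mlieBracket 𝓘(ℝ, E) V W) f x =
      fieldDeriv V (fieldDeriv W f) x - fieldDeriv W (fieldDeriv V f) x := by
  have : IsManifold 𝓘(ℝ, E) 1 M := IsManifold.of_le (n := ∞) (by exact_mod_cast le_top)
  set y := extChartAt 𝓘(ℝ, E) x x with hy
  -- At the centre of its own chart the chart map has identity differential, so the bracket is the
  -- one computed in coordinates.
  have hb : (mlieBracket 𝓘(ℝ, E) V W x : E) = lieBracket ℝ (chartField V x) (chartField W x) y := by
    rw [mlieBracket, mlieBracketWithin_apply]
    simp only [ModelWithCorners.range_eq_univ, mpullbackWithin_univ, Set.preimage_univ,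
      Set.univ_inter]
    have h := mfderiv_extChartAt_self (I := 𝓘(ℝ, E)) (x := x)
    have h' : (mfderiv 𝓘(ℝ, E) 𝓘(ℝ, E) (extChartAt 𝓘(ℝ, E) x) x : E →L[ℝ] E) =
      ContinuousLinearMap.id ℝ E := h
    have h2 := congrArg (fun L : E →L[ℝ] E => L.inverse
      (lieBracketWithin ℝ (chartField V x) (chartField W x) Set.univ y)) h'
    refine Eq.trans ?_ (h2.trans ?_)
    · rfl
    · rw [ContinuousLinearMap.inverse_id, lieBracketWithin_univ]
      rfl
  rw [fieldDeriv_fieldDeriv hf hW hWf, fieldDeriv_fieldDeriv hf hV hVf, ← hy, fieldDeriv, hb]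
  have hs : IsSymmSndFDerivAt ℝ (f ∘ (extChartAt 𝓘(ℝ, E) x).symm) y :=
    (contDiffAt_chart_symm hf x).isSymmSndFDerivAt (by
      simp only [minSmoothness_of_isRCLikeNormedField]
      exact two_le_infty)
  have h1 : (mfderiv 𝓘(ℝ, E) 𝓘(ℝ, ℝ) f x : E →L[ℝ] ℝ) =
      fderiv ℝ (f ∘ (extChartAt 𝓘(ℝ, E) x).symm) y := by
    refine ContinuousLinearMap.ext fun a => ?_
    let A : Π z : M, TangentSpace 𝓘(ℝ, E) z := fun _ => (a : E)
    have h2 := fieldDeriv_eq_fderiv (V := A) hf (mem_extChartAt_target (I := 𝓘(ℝ, E)) x)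
    rw [chartField_self, extChartAt_to_inv] at h2
    exact h2
  rw [show (mfderiv 𝓘(ℝ, E) 𝓘(ℝ, ℝ) f x : E →L[ℝ] ℝ) = _ from h1, hs.eq, lieBracket]
  refine (map_sub (fderiv ℝ (f ∘ (extChartAt 𝓘(ℝ, E) x).symm) y) _ _).trans ?_
  ring

end Commutator

/-! ### Brackets, the adjoint representation, and `d ∘ d = 0` -/

section Lie

variable {E : Type*} [NormedAddCommGroup E] [NormedSpace ℝ E] [FiniteDimensional ℝ E]
  {G : Type*} [TopologicalSpace G] [ChartedSpace E G] [Group G] [LieGroup 𝓘(ℝ, E) ∞ G]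
  [T2Space G] [IsTopologicalGroup G]

theorem derivAlong_lie (v w : GroupLieAlgebra 𝓘(ℝ, E) G) (φ : TestFunction E G) :
    derivAlong ⁅v, w⁆ φ = derivAlong v (derivAlong w φ) - derivAlong w (derivAlong v φ) := by
  have : CompleteSpace E := FiniteDimensional.complete ℝ E
  have : LieGroup 𝓘(ℝ, E) (minSmoothness ℝ 3) G := by
    rw [minSmoothness_of_isRCLikeNormedField]
    exact LieGroup.of_le (n := ∞) (WithTop.coe_le_coe.2 (le_top : (3 : ℕ∞) ≤ ⊤))
  refine Subtype.ext (funext fun x => ?_)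
  have h := fieldDeriv_mlieBracket (f := φ.1) φ.2.1 (contMDiff_leftInvariant v)
    (contMDiff_leftInvariant w) (mdifferentiable_testFunction (derivAlong v φ))
    (mdifferentiable_testFunction (derivAlong w φ)) x
  rw [← mulInvariantVector_mlieBracket] at h
  exact h

theorem exists_testFunction_ne {g h : G} (hgh : g ≠ h) :
    ∃ φ : TestFunction E G, φ.1 g ≠ φ.1 h := by
  have : IsManifold 𝓘(ℝ, E) ∞ G := inferInstance
  obtain ⟨f, -, hf⟩ := (SmoothBumpFunction.nhds_basis_tsupport (I := 𝓘(ℝ, E)) g).mem_iff.1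
    (isOpen_compl_singleton.mem_nhds hgh : ({h}ᶜ : Set G) ∈ 𝓝 g)
  refine ⟨⟨f, f.contMDiff, f.hasCompactSupport⟩, ?_⟩
  have h1 : f h = 0 := image_eq_zero_of_notMem_tsupport fun hh => hf hh rfl
  show f g ≠ f h
  rw [h1, f.eq_one]
  exact one_ne_zero

theorem mulInvariantVectorField_of_eq_one (a : GroupLieAlgebra 𝓘(ℝ, E) G) :
    ∀ g : G, g = 1 → (mulInvariantVectorField a g : E) = a := by
  rintro _ rfl
  have : (fun z : G => 1 * z) = id := by funext z; simp
  have e2 : (mfderiv 𝓘(ℝ, E) 𝓘(ℝ, E) (fun z : G => 1 * z) 1 : E →L[ℝ] E) = .id ℝ E := by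
    rw [this]; exact mfderiv_id
  exact congrArg (fun L : E →L[ℝ] E => L a) e2

theorem eq_of_expCurve_eq {a b : GroupLieAlgebra 𝓘(ℝ, E) G}
    (h : ∀ t, expCurve a t = expCurve b t) : a = b := by
  have h1 := isMIntegralCurve_expCurve a 0
  have h2 := isMIntegralCurve_expCurve b 0
  rw [show expCurve b = expCurve a from funext fun t => (h t).symm] at h2
  have h3 : ((1 : ℝ →L[ℝ] ℝ).smulRight (mulInvariantVectorField a (expCurve a 0) : E)) =
    ((1 : ℝ →L[ℝ] ℝ).smulRight (mulInvariantVectorField b (expCurve a 0) : E)) :=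
    hasMFDerivAt_unique h1 h2
  have h4 := congrArg (fun L : ℝ →L[ℝ] E => L 1) h3
  have h5 : ∀ c : E, (1 : ℝ →L[ℝ] ℝ).smulRight c 1 = c := fun c => one_smul ℝ c
  have h6 := (h5 _).symm.trans (h4.trans (h5 _))
  rw [mulInvariantVectorField_of_eq_one a _ (expCurve_zero a),
    mulInvariantVectorField_of_eq_one b _ (expCurve_zero a)] at h6
  exact h6

/-- Every test function is then constant along `exp (t a)`, and test functions separate points, so
this curve is constant. -/
theorem eq_zero_of_derivAlong_eq_zero {a : GroupLieAlgebra 𝓘(ℝ, E) G}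
    (h : ∀ φ : TestFunction E G, derivAlong a φ = 0) : a = 0 := by
  have h0 : ∀ t, expCurve (0 : GroupLieAlgebra 𝓘(ℝ, E) G) t = 1 := fun t => by
    have := expCurve_smul (0 : GroupLieAlgebra 𝓘(ℝ, E) G) 0 t
    rwa [zero_mul, expCurve_zero, smul_zero] at this
  refine eq_of_expCurve_eq fun t => ?_
  rw [h0]
  by_contra hne
  obtain ⟨φ, hφ⟩ := exists_testFunction_ne (E := E) hne
  refine hφ ?_
  have hd : ∀ s, HasDerivAt (fun s => φ.1 (1 * expCurve a s)) 0 s := fun s => by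
    have := hasDerivAt_mul_expCurve φ a 1 s
    rwa [h] at this
  have := is_const_of_deriv_eq_zero (fun s => (hd s).differentiableAt) (fun s => (hd s).deriv) t 0
  simpa [expCurve_zero] using this

/-- A one-parameter subgroup is an integral curve of a left-invariant vector field. -/
theorem eq_expCurve_of_hasMFDerivAt {γ : ℝ → G} (hadd : ∀ s t, γ (s + t) = γ s * γ t)
    {a : GroupLieAlgebra 𝓘(ℝ, E) G}
    (hγ : HasMFDerivAt 𝓘(ℝ, ℝ) 𝓘(ℝ, E) γ 0 ((1 : ℝ →L[ℝ] ℝ).smulRight (a : E) : ℝ →L[ℝ] E))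
    (t : ℝ) : γ t = expCurve a t := by
  have h0 : γ 0 = 1 := by simpa using hadd 0 0
  have hint : IsMIntegralCurve (I := 𝓘(ℝ, E)) γ (mulInvariantVectorField a) := by
    intro t
    have d : MDifferentiable 𝓘(ℝ, E) 𝓘(ℝ, E) (fun x : G => γ t * x) :=
      (contMDiff_mul_left (I := 𝓘(ℝ, E)) (n := ∞)).mdifferentiable (by simp)
    have e : γ = fun s => γ t * γ (s - t) := funext fun s => by rw [← hadd]; simp
    have h1 : HasMFDerivAt 𝓘(ℝ, ℝ) 𝓘(ℝ, ℝ) (fun s : ℝ => s - t) t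
        (ContinuousLinearMap.id ℝ ℝ : ℝ →L[ℝ] ℝ) :=
      ((hasFDerivAt_id (𝕜 := ℝ) t).sub_const t).hasMFDerivAt
    have h2 : HasMFDerivAt 𝓘(ℝ, ℝ) 𝓘(ℝ, E) γ (t - t)
        ((1 : ℝ →L[ℝ] ℝ).smulRight (a : E) : ℝ →L[ℝ] E) := by rw [sub_self]; exact hγ
    have h3 := (d (γ (t - t))).hasMFDerivAt.comp t
      (HasMFDerivAt.comp (f := fun s : ℝ => s - t) t h2 h1)
    have h4 : ∀ g, g = 1 → (mfderiv 𝓘(ℝ, E) 𝓘(ℝ, E) (fun x : G => γ t * x) g : E →L[ℝ] E) =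
      (mfderiv 𝓘(ℝ, E) 𝓘(ℝ, E) (fun x : G => γ t * x) 1 : E →L[ℝ] E) := by rintro _ rfl; rfl
    have h5 := h3.congr_of_eventuallyEq (f₁ := γ) (Eventually.of_forall fun s => congrFun e s)
    refine h5.congr_mfderiv ?_
    refine ContinuousLinearMap.ext fun (r : ℝ) => ?_
    refine (congrArg (fun L : E →L[ℝ] E => L (r • (a : E)))
      (h4 _ (by rw [sub_self, h0]))).trans ?_
    exact map_smul (mfderiv 𝓘(ℝ, E) 𝓘(ℝ, E) (fun x : G => γ t * x) 1 : E →L[ℝ] E) r (a : E)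
  have := eq_mul_expCurve hint t
  rwa [h0, one_mul] at this

variable (E) in
/-- The adjoint representation, as a map on the model space. -/
def adMap (g : G) : E →L[ℝ] E :=
  mfderiv 𝓘(ℝ, E) 𝓘(ℝ, E) (fun x : G => g * x * g⁻¹) 1

/-- The adjoint representation. -/
def Ad (g : G) (w : GroupLieAlgebra 𝓘(ℝ, E) G) : GroupLieAlgebra 𝓘(ℝ, E) G := adMap E g w

theorem contMDiff_conj (g : G) : ContMDiff 𝓘(ℝ, E) 𝓘(ℝ, E) ∞ (fun x : G => g * x * g⁻¹) :=
  (contMDiff_mul_right (I := 𝓘(ℝ, E)) (n := ∞) (a := g⁻¹)).comp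
    (contMDiff_mul_left (I := 𝓘(ℝ, E)) (n := ∞) (a := g))

theorem expCurve_Ad (g : G) (w : GroupLieAlgebra 𝓘(ℝ, E) G) (t : ℝ) :
    expCurve (Ad g w) t = g * expCurve w t * g⁻¹ := by
  refine (eq_expCurve_of_hasMFDerivAt (γ := fun t => g * expCurve w t * g⁻¹)
    (fun s t => ?_) ?_ t).symm
  · simp [expCurve_add, mul_assoc]
  · have h1 := ((contMDiff_conj (E := E) g).mdifferentiable (by simp) (expCurve w 0)).hasMFDerivAt
    have h2 := h1.comp (0 : ℝ) (isMIntegralCurve_expCurve w 0)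
    refine h2.congr_mfderiv ?_
    have h4 : ∀ h, h = 1 → (mfderiv 𝓘(ℝ, E) 𝓘(ℝ, E) (fun x : G => g * x * g⁻¹) h : E →L[ℝ] E) =
      (mfderiv 𝓘(ℝ, E) 𝓘(ℝ, E) (fun x : G => g * x * g⁻¹) 1 : E →L[ℝ] E) := by rintro _ rfl; rfl
    refine ContinuousLinearMap.ext fun (r : ℝ) => ?_
    refine (congrArg₂ (fun (L : E →L[ℝ] E) (b : E) => L (r • b)) (h4 _ (expCurve_zero w))
      (mulInvariantVectorField_of_eq_one w _ (expCurve_zero w))).trans ?_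
    exact map_smul (mfderiv 𝓘(ℝ, E) 𝓘(ℝ, E) (fun x : G => g * x * g⁻¹) 1 : E →L[ℝ] E) r (w : E)

theorem Ad_mul (g h : G) (w : GroupLieAlgebra 𝓘(ℝ, E) G) : Ad (g * h) w = Ad g (Ad h w) := by
  refine eq_of_expCurve_eq fun t => ?_
  simp [expCurve_Ad, mul_assoc]

theorem Ad_one (w : GroupLieAlgebra 𝓘(ℝ, E) G) : Ad (1 : G) w = w := by
  refine eq_of_expCurve_eq fun t => ?_
  simp [expCurve_Ad]

theorem derivAlong_rightTranslate' (φ : TestFunction E G)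
    (w : GroupLieAlgebra 𝓘(ℝ, E) G) (g : G) :
    derivAlong w (rightTranslate g φ) = rightTranslate g (derivAlong (Ad g⁻¹ w) φ) := by
  refine Subtype.ext (funext fun x => derivAlong_eq ?_)
  have h := hasDerivAt_mul_expCurve φ (Ad g⁻¹ w) (x * g) 0
  simp only [expCurve_Ad] at h
  simpa [rightTranslate, mul_assoc, expCurve_zero] using h

/-- `Ad g w` is the image of the vector `(0, w)` at `(g, 1)` under the tangent map of `(g, x) ↦ g x
g⁻¹`. This image always lies over `1`, so reading it in the trivialization at `1` gives a smooth map
to `E`. -/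
theorem contMDiff_adMap (w : E) :
    ContMDiff 𝓘(ℝ, E) 𝓘(ℝ, E) ∞ (fun g : G => adMap E g w) := by
  let fg : G → TangentBundle 𝓘(ℝ, E) G := fun g => TotalSpace.mk' E g 0
  have sfg : ContMDiff 𝓘(ℝ, E) 𝓘(ℝ, E).tangent ∞ fg := contMDiff_zeroSection _ _
  let fv : G → TangentBundle 𝓘(ℝ, E) G := fun _ => TotalSpace.mk' E 1 w
  have sfv : ContMDiff 𝓘(ℝ, E) 𝓘(ℝ, E).tangent ∞ fv := contMDiff_const
  let F₁ : G → (TangentBundle 𝓘(ℝ, E) G × TangentBundle 𝓘(ℝ, E) G) := fun g => (fg g, fv g)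
  have S₁ : ContMDiff 𝓘(ℝ, E) (𝓘(ℝ, E).tangent.prod 𝓘(ℝ, E).tangent) ∞ F₁ := sfg.prodMk sfv
  let F₂ : (TangentBundle 𝓘(ℝ, E) G × TangentBundle 𝓘(ℝ, E) G) →
      TangentBundle (𝓘(ℝ, E).prod 𝓘(ℝ, E)) (G × G) :=
    (equivTangentBundleProd 𝓘(ℝ, E) G 𝓘(ℝ, E) G).symm
  have S₂ : ContMDiff (𝓘(ℝ, E).tangent.prod 𝓘(ℝ, E).tangent)
      (𝓘(ℝ, E).prod 𝓘(ℝ, E)).tangent ∞ F₂ := contMDiff_equivTangentBundleProd_symm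
  have hc : ContMDiff (𝓘(ℝ, E).prod 𝓘(ℝ, E)) 𝓘(ℝ, E) ∞
      (fun p : G × G => p.1 * p.2 * p.1⁻¹) :=
    (contMDiff_fst.mul contMDiff_snd).mul contMDiff_fst.inv
  let F₃ : TangentBundle (𝓘(ℝ, E).prod 𝓘(ℝ, E)) (G × G) → TangentBundle 𝓘(ℝ, E) G :=
    tangentMap (𝓘(ℝ, E).prod 𝓘(ℝ, E)) 𝓘(ℝ, E) (fun (p : G × G) => p.1 * p.2 * p.1⁻¹)
  have S₃ : ContMDiff (𝓘(ℝ, E).prod 𝓘(ℝ, E)).tangent 𝓘(ℝ, E).tangent ∞ F₃ :=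
    ContMDiff.contMDiff_tangentMap hc (m := ∞) (by simp)
  have S := (S₃.comp S₂).comp S₁
  have hbase : ∀ g, ((F₃ ∘ F₂) ∘ F₁) g = (⟨g * 1 * g⁻¹, adMap E g w⟩ : TangentBundle 𝓘(ℝ, E) G) := by
    intro g
    refine congrArg (fun b : E => (⟨g * 1 * g⁻¹, b⟩ : TangentBundle 𝓘(ℝ, E) G)) ?_
    refine (mfderiv_prod_eq_add_apply (v := ((0 : E), (w : E)))
      (hc.mdifferentiableAt (x := (g, 1)) (by simp))).trans ?_
    exact (congrArg₂ (fun a b : E => a + b) (ContinuousLinearMap.map_zero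
      (mfderiv 𝓘(ℝ, E) 𝓘(ℝ, E) (fun z : G => z * 1 * z⁻¹) g)) rfl).trans (zero_add _)
  have key : ∀ (y : G) (b : E), y = 1 → (trivializationAt E (TangentSpace 𝓘(ℝ, E) : G → Type _) 1
      (⟨y, b⟩ : TangentBundle 𝓘(ℝ, E) G)).2 = b := by
    rintro _ b rfl
    exact (tangentBundleCore 𝓘(ℝ, E) G).coordChange_self (achart E (1 : G)) 1
      (mem_chart_source E (1 : G)) b
  intro g
  have h1 := ((trivializationAt E (TangentSpace 𝓘(ℝ, E) : G → Type _) 1).contMDiffAt_iff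
    (IM := 𝓘(ℝ, E)) (IB := 𝓘(ℝ, E)) (n := ∞) (f := (F₃ ∘ F₂) ∘ F₁) (x₀ := g) ?_).1 (S g)
  · refine h1.2.congr_of_eventuallyEq (Eventually.of_forall fun z => ?_)
    simp only [hbase]
    exact (key _ _ (by simp)).symm
  · rw [hbase, Trivialization.mem_source]
    simp

theorem differentiable_adMap_expCurve (v : GroupLieAlgebra 𝓘(ℝ, E) G) (w : E) :
    Differentiable ℝ (fun s : ℝ => adMap E (expCurve v s) w) := by
  have h0 : ContMDiff 𝓘(ℝ, E) 𝓘(ℝ, E) 1 (fun g : G => adMap E g w) :=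
    (contMDiff_adMap w).of_le (by exact_mod_cast le_top)
  have h := h0.comp (contMDiff_expCurve v)
  exact h.contDiff.differentiable (by simp)

variable [SecondCountableTopology G] [LocallyCompactSpace G]
  [MeasurableSpace G] [BorelSpace G] (μ : Measure G) [μ.IsHaarMeasure]

theorem integrable_testFunction (φ : TestFunction E G) : Integrable φ.1 μ :=
  (continuous_testFunction φ).integrable_of_hasCompactSupport φ.2.2

theorem divergence_lie (v w : GroupLieAlgebra 𝓘(ℝ, E) G) : divergence μ ⁅v, w⁆ = 0 := by
  obtain ⟨φ, hφ⟩ := exists_testFunction_integral_ne_zero (E := E) μ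
  have h := integral_derivAlong μ ⁅v, w⁆ φ
  rw [derivAlong_lie] at h
  have h2 : ∫ x, (derivAlong v (derivAlong w φ) - derivAlong w (derivAlong v φ)).1 x ∂μ = _ :=
    integral_sub (integrable_testFunction μ (derivAlong v (derivAlong w φ)))
      (integrable_testFunction μ (derivAlong w (derivAlong v φ)))
  rw [h2, integral_derivAlong, integral_derivAlong, integral_derivAlong, integral_derivAlong] at h
  apply mul_right_cancel₀ hφ
  linarith

theorem adjDeriv_commutator (v w : GroupLieAlgebra 𝓘(ℝ, E) G) (φ : TestFunction E G) :
    adjDeriv μ v (adjDeriv μ w φ) - adjDeriv μ w (adjDeriv μ v φ) = adjDeriv μ ⁅v, w⁆ φ := by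
  simp only [adjDeriv, divergence_lie, derivAlong_lie, derivAlong_add, derivAlong_smul, smul_add]
  rw [smul_comm (divergence μ w) (divergence μ v) φ]
  module

/-- `d ∘ d = 0` is the transpose of the commutator relation for the operators `adjDeriv`. -/
theorem isClosed_distD {u : G → ℝ} (hu : LocallyIntegrable u μ) :
    GenForm.IsClosed μ (distD (E := E) μ u) := by
  intro v w φ
  have h := integrable_mul_testFunction (E := E) μ hu
  have e := adjDeriv_commutator μ w v φ
  have e3 : adjDeriv μ ⁅v, w⁆ φ = -adjDeriv μ ⁅w, v⁆ φ := by
    rw [← adjDeriv_commutator, ← adjDeriv_commutator, neg_sub]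
  simp only [distD, neg_neg]
  rw [e3, ← e]
  have h1 : ∫ x, u x * (-(adjDeriv μ w (adjDeriv μ v φ) - adjDeriv μ v (adjDeriv μ w φ))).1 x ∂μ =
      ∫ x, (u x * (adjDeriv μ v (adjDeriv μ w φ)).1 x -
        u x * (adjDeriv μ w (adjDeriv μ v φ)).1 x) ∂μ := by
    refine integral_congr_ae (Eventually.of_forall fun x => ?_)
    show u x * (-((adjDeriv μ w (adjDeriv μ v φ)).1 x - (adjDeriv μ v (adjDeriv μ w φ)).1 x)) =
      u x * (adjDeriv μ v (adjDeriv μ w φ)).1 x - u x * (adjDeriv μ w (adjDeriv μ v φ)).1 x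
    ring
  rw [h1, integral_sub (h _) (h _)]
  ring

theorem isClosed_of_hasWeakDifferential {u : G → ℝ} {α : G → (E →L[ℝ] ℝ)} (h : HasWeakDifferential μ u α) :
    GenForm.IsClosed μ (formDist μ α) := by
  rw [← h.2]
  exact isClosed_distD μ h.1

/-- Integration by parts against a left-invariant field. -/
theorem integral_mul_derivAlong (f φ : TestFunction E G) (w : GroupLieAlgebra 𝓘(ℝ, E) G) :
    ∫ x, f.1 x * (derivAlong w φ).1 x ∂μ = -∫ x, (adjDeriv μ w f).1 x * φ.1 x ∂μ := by
  have hf (f : TestFunction E G) : LocallyIntegrable f.1 μ :=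
    (continuous_testFunction f).locallyIntegrable
  have h1 := hasDerivAt_integral_mul_expCurve_zero μ (hf f) φ w
  have h2 := hasDerivAt_integral_translate μ (hf φ) f w 0
  simp only [expCurve_zero, mul_one] at h2
  rw [h1.unique (h2.congr_of_eventuallyEq
    (Eventually.of_forall fun t => integral_congr_ae (Eventually.of_forall fun x => mul_comm _ _)))]
  simp only [mul_comm]

theorem adjDeriv_add_left (v w : GroupLieAlgebra 𝓘(ℝ, E) G) (φ : TestFunction E G) :
    adjDeriv μ (v + w) φ = adjDeriv μ v φ + adjDeriv μ w φ := by
  simp only [adjDeriv, derivAlong_add_left, divergence_add]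
  module

theorem adjDeriv_smul_left (c : ℝ) (v : GroupLieAlgebra 𝓘(ℝ, E) G) (φ : TestFunction E G) :
    adjDeriv μ (c • v) φ = c • adjDeriv μ v φ := by
  simp only [adjDeriv, derivAlong_smul_left, divergence_smul]
  module

/-- The product rule for `s ↦ B s (a s)` when `B` is known to be differentiable only on each fixed
vector; expansion in a basis reduces it to the scalar rule. -/
theorem hasDerivAt_linearMap_apply {B : ℝ → E →ₗ[ℝ] ℝ} {B' : E →ₗ[ℝ] ℝ} {a : ℝ → E} {A : E}
    {s₀ : ℝ} (hB : ∀ b, HasDerivAt (fun s => B s b) (B' b) s₀) (ha : HasDerivAt a A s₀) :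
    HasDerivAt (fun s => B s (a s)) (B s₀ A + B' (a s₀)) s₀ := by
  have e (L : E →ₗ[ℝ] ℝ) (b : E) : L b =
      ∑ i, (Module.finBasis ℝ E).coord i b * L (Module.finBasis ℝ E i) := by
    calc L b = L (∑ i, (Module.finBasis ℝ E).repr b i • Module.finBasis ℝ E i) := by
          rw [(Module.finBasis ℝ E).sum_repr]
      _ = _ := by simp only [map_sum, map_smul, smul_eq_mul, Module.Basis.coord_apply]
  have h1 (i) : HasDerivAt (fun s => (Module.finBasis ℝ E).coord i (a s))
      ((Module.finBasis ℝ E).coord i A) s₀ :=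
    ((Module.finBasis ℝ E).coord i).toContinuousLinearMap.hasFDerivAt.comp_hasDerivAt s₀ ha
  have h2 := HasDerivAt.fun_sum (u := Finset.univ) fun i _ => (h1 i).mul (hB (Module.finBasis ℝ E i))
  simp only [Finset.sum_add_distrib] at h2
  rw [e (B s₀) A, e B' (a s₀)]
  simp only [e (B _) (a _)]
  exact h2

theorem rightTranslate_one (φ : TestFunction E G) : rightTranslate 1 φ = φ :=
  Subtype.ext (funext fun x => by simp [rightTranslate])

/-- The pairing of the formal adjoint derivatives of a test function with another one. -/
def adjPairing (f φ : TestFunction E G) : E →ₗ[ℝ] ℝ where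
  toFun b := ∫ x, (adjDeriv μ (b : GroupLieAlgebra 𝓘(ℝ, E) G) f).1 x * φ.1 x ∂μ
  map_add' a b := by
    have hli (f : TestFunction E G) : LocallyIntegrable f.1 μ :=
      (continuous_testFunction f).locallyIntegrable
    rw [← integral_add (integrable_mul_testFunction μ (hli _) φ)
      (integrable_mul_testFunction μ (hli _) φ)]
    have h := adjDeriv_add_left μ (a : GroupLieAlgebra 𝓘(ℝ, E) G) b f
    refine integral_congr_ae (Eventually.of_forall fun x => ?_)
    exact (congrArg (fun ψ : TestFunction E G => ψ.1 x * φ.1 x) h).trans (add_mul _ _ _)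
  map_smul' c a := by
    have h := adjDeriv_smul_left μ c (a : GroupLieAlgebra 𝓘(ℝ, E) G) f
    refine Eq.trans ?_ (integral_const_mul c _)
    refine integral_congr_ae (Eventually.of_forall fun x => ?_)
    exact (congrArg (fun ψ : TestFunction E G => ψ.1 x * φ.1 x) h).trans (mul_assoc _ _ _)

/-- Differentiability is known; let `A` be the derivative. Along `g = exp (-s v)`, the field of `Ad
g w` applied to `φ ∘ R_g` equals `(w φ) ∘ R_g`. Differentiating this at `s = 0`, paired with a test
function, gives `A φ - w v φ = -v w φ`, so `A` and `⁅w, v⁆` act alike on all test functions. -/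
theorem hasDerivAt_adMap_zero (v w : GroupLieAlgebra 𝓘(ℝ, E) G) :
    HasDerivAt (fun s => adMap E (expCurve v (-s)) (w : E)) (⁅w, v⁆ : GroupLieAlgebra 𝓘(ℝ, E) G)
      0 := by
  obtain ⟨A₀, hd⟩ : ∃ A : E, HasDerivAt (fun s => adMap E (expCurve v (-s)) (w : E)) A 0 :=
    ⟨_, (((differentiable_adMap_expCurve v (w : E)).comp differentiable_neg) 0).hasDerivAt⟩
  let A : GroupLieAlgebra 𝓘(ℝ, E) G := A₀
  suffices h : A - ⁅w, v⁆ = 0 by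
    have h' : A₀ = (⁅w, v⁆ : GroupLieAlgebra 𝓘(ℝ, E) G) := sub_eq_zero.1 h
    exact hd.congr_deriv h'
  obtain ⟨μ, hμ⟩ : ∃ μ : Measure G, μ.IsHaarMeasure := ⟨Measure.haar, inferInstance⟩
  refine eq_zero_of_derivAlong_eq_zero fun φ => ?_
  have hli (f : TestFunction E G) : LocallyIntegrable f.1 μ :=
    (continuous_testFunction f).locallyIntegrable
  have key (f : TestFunction E G) :
      ∫ x, (derivAlong A φ).1 x * f.1 x ∂μ = ∫ x, (derivAlong ⁅w, v⁆ φ).1 x * f.1 x ∂μ := by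
    have h1 (b : GroupLieAlgebra 𝓘(ℝ, E) G) :
        HasDerivAt (fun s => adjPairing μ f (rightTranslate (expCurve v (-s)) φ) b)
          ((-adjPairing μ f (derivAlong v φ)) b) 0 := by
      have h := hasDerivAt_integral_mul_expCurve μ (hli (adjDeriv μ b f)) φ v (-0)
      have h2 := h.comp (0 : ℝ) (hasDerivAt_neg (0 : ℝ))
      refine h2.congr_deriv ?_
      rw [neg_zero, expCurve_zero, mul_neg_one]
      simp only [mul_one]
      rfl
    have h2 : HasDerivAt (fun s => adjPairing μ f (rightTranslate (expCurve v (-s)) φ)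
        (adMap E (expCurve v (-s)) (w : E))) (adjPairing μ f (rightTranslate (expCurve v (-0)) φ) A₀
          + (-adjPairing μ f (derivAlong v φ)) (adMap E (expCurve v (-0)) (w : E))) 0 :=
      hasDerivAt_linearMap_apply (B := fun s => adjPairing μ f (rightTranslate (expCurve v (-s)) φ))
        h1 hd
    have h3 : (fun s => adjPairing μ f (rightTranslate (expCurve v (-s)) φ)
        (adMap E (expCurve v (-s)) (w : E))) =
        fun s => -∫ x, f.1 x * (derivAlong w φ).1 (x * expCurve v (-s)) ∂μ := by
      funext s
      have h4 := integral_mul_derivAlong μ f (rightTranslate (expCurve v (-s)) φ)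
        (Ad (expCurve v (-s)) w)
      rw [derivAlong_rightTranslate', ← Ad_mul, inv_mul_cancel, Ad_one] at h4
      rw [← neg_eq_iff_eq_neg]
      exact h4.symm
    rw [h3] at h2
    have h5 := ((hasDerivAt_integral_mul_expCurve μ (hli f) (derivAlong w φ) v (-0)).comp (0 : ℝ)
      (hasDerivAt_neg (0 : ℝ))).neg
    have h6 := h2.unique h5
    have h7 : adjPairing μ f (rightTranslate (expCurve v (-0)) φ) A₀ =
        -∫ x, f.1 x * (derivAlong A φ).1 x ∂μ := by
      rw [neg_zero, expCurve_zero, integral_mul_derivAlong, neg_neg]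
      simp only [rightTranslate_one]
      rfl
    have h8 : adMap E (expCurve v (-0)) (w : E) = (w : E) := by
      simp only [neg_zero, expCurve_zero]
      exact Ad_one w
    have h9 : (-adjPairing μ f (derivAlong v φ)) (adMap E (expCurve v (-0)) (w : E)) =
        ∫ x, f.1 x * (derivAlong w (derivAlong v φ)).1 x ∂μ := by
      rw [h8, integral_mul_derivAlong]
      rfl
    rw [h7, h9] at h6
    simp only [neg_zero, expCurve_zero, mul_one, mul_neg, neg_neg] at h6
    have h10 : ∫ x, f.1 x * (derivAlong ⁅w, v⁆ φ).1 x ∂μ =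
        ∫ x, f.1 x * (derivAlong w (derivAlong v φ)).1 x ∂μ -
        ∫ x, f.1 x * (derivAlong v (derivAlong w φ)).1 x ∂μ := by
      rw [← integral_sub (integrable_mul_testFunction μ (hli f) _)
        (integrable_mul_testFunction μ (hli f) _), derivAlong_lie]
      exact integral_congr_ae (Eventually.of_forall fun x => mul_sub _ _ _)
    simp only [mul_comm _ (f.1 _)]
    linarith
  have h1 := ae_eq_of_forall_testFunction E μ (hli (derivAlong A φ)) (hli (derivAlong ⁅w, v⁆ φ)) key
  have h2 := ((continuous_testFunction (derivAlong A φ)).ae_eq_iff_eq μ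
    (continuous_testFunction (derivAlong ⁅w, v⁆ φ))).1 h1
  have h3 : derivAlong A φ = derivAlong ⁅w, v⁆ φ := Subtype.ext h2
  have h4 : derivAlong (A - ⁅w, v⁆) φ = derivAlong A φ - derivAlong ⁅w, v⁆ φ := by
    rw [sub_eq_add_neg, ← neg_one_smul ℝ ⁅w, v⁆, derivAlong_add_left, derivAlong_smul_left]
    module
  rw [h4, h3, sub_self]

theorem hasDerivAt_adMap (v w : GroupLieAlgebra 𝓘(ℝ, E) G) (s : ℝ) :
    HasDerivAt (fun s => adMap E (expCurve v (-s)) (w : E))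
      (⁅Ad (expCurve v (-s)) w, v⁆ : GroupLieAlgebra 𝓘(ℝ, E) G) s := by
  have h := hasDerivAt_adMap_zero v (Ad (expCurve v (-s)) w)
  have h1 : HasDerivAt (fun r => adMap E (expCurve v (-(r + s))) (w : E))
      (⁅Ad (expCurve v (-s)) w, v⁆ : GroupLieAlgebra 𝓘(ℝ, E) G) (s - s) := by
    rw [sub_self]
    refine h.congr_of_eventuallyEq (Eventually.of_forall fun r => ?_)
    have := Ad_mul (expCurve v (-r)) (expCurve v (-s)) w
    rw [← expCurve_add, ← neg_add] at this
    exact this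
  simpa using h1.comp_sub_const s s

end Lie

/-! ### Functions with zero differential, and Cartan's formula for translates -/

section Cocycle

open Measure

/-- The converse of `MeasureTheory.Measure.ae_ae_of_ae_prod` for null-measurable predicates. -/
theorem ae_prod_of_ae_ae {X Y : Type*} [MeasurableSpace X] [MeasurableSpace Y] {μ : Measure X}
    {ν : Measure Y} [SFinite ν] {P : X × Y → Prop}
    (hm : NullMeasurableSet {q | P q} (μ.prod ν)) (h : ∀ᵐ x ∂μ, ∀ᵐ y ∂ν, P (x, y)) :
    ∀ᵐ q ∂(μ.prod ν), P q := by
  obtain ⟨t, hts, ht, hte⟩ := hm.compl.exists_measurable_subset_ae_eq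
  show (μ.prod ν) {q | P q}ᶜ = 0
  rw [← measure_congr hte, measure_prod_null ht]
  filter_upwards [h] with x hx
  exact measure_mono_null (fun y hy => hts hy) hx

theorem ae_swap {X Y : Type*} [MeasurableSpace X] [MeasurableSpace Y] {μ : Measure X}
    {ν : Measure Y} [SFinite μ] [SFinite ν] {P : X × Y → Prop} (h : ∀ᵐ q ∂(μ.prod ν), P q) :
    ∀ᵐ q ∂(ν.prod μ), P (q.2, q.1) :=
  (measurePreserving_swap (μ := ν) (ν := μ)).quasiMeasurePreserving.ae h

variable {E : Type*} [NormedAddCommGroup E] [NormedSpace ℝ E] [FiniteDimensional ℝ E]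
  {G : Type*} [TopologicalSpace G] [ChartedSpace E G] [Group G] [LieGroup 𝓘(ℝ, E) ∞ G]
  [T2Space G] [IsTopologicalGroup G] [SecondCountableTopology G] [LocallyCompactSpace G]
  [MeasurableSpace G] [BorelSpace G] (μ : Measure G) [μ.IsHaarMeasure]

/-- A function invariant under all right translations, up to null sets, is constant. -/
theorem ae_const_of_forall_translate {f : G → ℝ} (hf : AEStronglyMeasurable f μ)
    (h : ∀ g, (fun x => f (x * g)) =ᵐ[μ] f) : ∃ c : ℝ, f =ᵐ[μ] fun _ => c := by
  have hc : Continuous (fun g : G => g) := continuous_id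
  have h1 := aestronglyMeasurable_mul_curve (ν := μ) μ hc hf
  have h2 : AEStronglyMeasurable (fun q : G × G => f q.2) (μ.prod μ) := hf.comp_snd
  have h3 : ∀ᵐ q ∂(μ.prod μ), f (q.2 * q.1) = f q.2 := by
    have hm : NullMeasurableSet {q : G × G | f (q.2 * q.1) = f q.2} (μ.prod μ) :=
      nullMeasurableSet_eq_fun h1.aemeasurable h2.aemeasurable
    exact ae_prod_of_ae_ae hm (Eventually.of_forall fun g => h g)
  have h4 : ∀ᵐ x ∂μ, ∀ᵐ g ∂μ, f (x * g) = f x :=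
    ae_ae_of_ae_prod (ae_swap h3)
  -- For one such `x`, `f (x g) = f x` for almost every `g`; by left invariance of `μ`, `y = x g`
  -- covers almost all of `G`.
  obtain ⟨x, hx⟩ := h4.exists
  refine ⟨f x, ?_⟩
  have h5 := (measurePreserving_mul_left μ x⁻¹).quasiMeasurePreserving.ae hx
  filter_upwards [h5] with y hy
  simpa using hy

/-- The elements whose right translation fixes `f` almost everywhere form a subgroup. Integration
along flows puts every `exp (t v)` in it, and connectedness does the rest. -/
theorem ae_const_of_distD_eq_zero [ConnectedSpace G] {f : G → ℝ} (hf : LocallyIntegrable f μ)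
    (h : distD (E := E) μ f = 0) : ∃ c : ℝ, f =ᵐ[μ] fun _ => c := by
  let H : Subgroup G :=
    { carrier := {g | (fun x => f (x * g)) =ᵐ[μ] f}
      one_mem' := by simp
      mul_mem' := by
        intro a b ha hb
        have h1 := (quasiMeasurePreserving_mul_right' μ a).ae hb
        show (fun x => f (x * (a * b))) =ᵐ[μ] f
        filter_upwards [h1, ha] with x hx hx'
        rw [← mul_assoc, hx, hx']
      inv_mem' := by
        intro a ha
        have h1 := (quasiMeasurePreserving_mul_right' μ a⁻¹).ae ha
        show (fun x => f (x * a⁻¹)) =ᵐ[μ] f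
        filter_upwards [h1] with x hx
        simpa using hx.symm }
  refine ae_const_of_forall_translate μ hf.aestronglyMeasurable fun g => ?_
  refine mem_of_expCurve_mem (E := E) H (fun v t => ?_) g
  have key : ∀ t : ℝ, 0 ≤ t → expCurve v t ∈ H := fun t ht => by
    have h1 := translate_sub_ae_eq μ hf (locallyIntegrable_zero (X := G) (μ := μ)) v
      (fun φ => by simpa [distD] using congrFun (congrFun h v) φ) ht
    show (fun x => f (x * expCurve v t)) =ᵐ[μ] f
    filter_upwards [h1] with x hx
    simpa [sub_eq_zero] using hx
  rcases le_total 0 t with ht | ht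
  · exact key t ht
  · have := H.inv_mem (key (-t) (by linarith))
    rwa [← expCurve_neg, neg_neg] at this

/-- The divergence is the infinitesimal modular character, and a character is invariant under
conjugation. -/
theorem divergence_Ad (g : G) (w : GroupLieAlgebra 𝓘(ℝ, E) G) :
    divergence μ (Ad g w) = divergence μ w := by
  have h1 := modularCharacterFun_expCurve μ (Ad g w) 1
  rw [expCurve_Ad, modularCharacterFun_map_mul, modularCharacterFun_map_mul, mul_right_comm,
    ← modularCharacterFun_map_mul, mul_inv_cancel, modularCharacterFun_map_one, one_mul,
    modularCharacterFun_expCurve μ w 1] at h1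
  simpa using (Real.exp_injective h1).symm

theorem rightTranslate_mul (g h : G) (φ : TestFunction E G) :
    rightTranslate (g * h) φ = rightTranslate g (rightTranslate h φ) :=
  Subtype.ext (funext fun x => by simp [rightTranslate, mul_assoc])

theorem rightTranslate_adjDeriv (w : GroupLieAlgebra 𝓘(ℝ, E) G) (φ : TestFunction E G) (g : G) :
    rightTranslate g (adjDeriv μ w φ) = adjDeriv μ (Ad g w) (rightTranslate g φ) := by
  rw [adjDeriv, adjDeriv, derivAlong_rightTranslate', ← Ad_mul, inv_mul_cancel, Ad_one,
    divergence_Ad]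
  rfl

/-- The pullback of a generalized one-form by a right translation. -/
def GenForm.pull (g : G) (T : GenForm E G) : GenForm E G :=
  fun w φ => (modularCharacterFun g : ℝ) * T (Ad g⁻¹ w) (rightTranslate g⁻¹ φ)

theorem GenForm.pull_one (T : GenForm E G) : T.pull 1 = T := by
  funext w φ
  simp [GenForm.pull, rightTranslate_one, Ad_one, modularCharacterFun_map_one]

theorem GenForm.pull_mul (g h : G) (T : GenForm E G) : T.pull (g * h) = (T.pull h).pull g := by
  funext w φ
  simp only [GenForm.pull, mul_inv_rev, Ad_mul, rightTranslate_mul, modularCharacterFun_map_mul,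
    NNReal.coe_mul, mul_assoc]

theorem GenForm.pull_sub (g : G) (T S : GenForm E G) : (T - S).pull g = T.pull g - S.pull g := by
  funext w φ
  simp [GenForm.pull, mul_sub]

theorem distD_mul_right (f : G → ℝ) (g : G) :
    distD (E := E) μ (fun x => f (x * g)) = (distD μ f).pull g := by
  funext w φ
  simp only [distD, GenForm.pull]
  rw [integral_mul_right_mul, ← rightTranslate_adjDeriv, mul_neg]
  rfl

theorem distD_sub {u w : G → ℝ} (hu : LocallyIntegrable u μ) (hw : LocallyIntegrable w μ) :
    distD (E := E) μ (u - w) = distD μ u - distD μ w := by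
  have h := distD_add (E := E) μ hu (hw.smul (-1 : ℝ))
  rw [distD_smul] at h
  have e : u - w = u + (-1 : ℝ) • w := by funext x; simp [sub_eq_add_neg]
  rw [e, h]
  funext v φ
  simp [sub_eq_add_neg]

theorem distD_congr {u w : G → ℝ} (h : u =ᵐ[μ] w) : distD (E := E) μ u = distD μ w := by
  funext v φ
  simp only [distD]
  congr 1
  refine integral_congr_ae ?_
  filter_upwards [h] with x hx
  rw [hx]

theorem distD_const (c : ℝ) : distD (E := E) (G := G) μ (fun _ => c) = 0 := by
  funext v φ
  simp only [distD, integral_const_mul]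
  have h1 : ∫ x, (adjDeriv μ v φ).1 x ∂μ =
      ∫ x, (derivAlong v φ).1 x ∂μ + ∫ x, divergence μ v * φ.1 x ∂μ :=
    integral_add (integrable_testFunction μ _) ((integrable_testFunction μ φ).const_mul _)
  rw [h1, integral_derivAlong, integral_const_mul]
  simp

theorem lie_neg_swap (v w : GroupLieAlgebra 𝓘(ℝ, E) G) : ⁅w, v⁆ = -⁅v, w⁆ := by
  have : CompleteSpace E := FiniteDimensional.complete ℝ E
  have : LieGroup 𝓘(ℝ, E) (minSmoothness ℝ 3) G := by
    rw [minSmoothness_of_isRCLikeNormedField]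
    exact LieGroup.of_le (n := ∞) (WithTop.coe_le_coe.2 (le_top : (3 : ℕ∞) ≤ ⊤))
  exact (lie_skew w v).symm

/-- For a closed form `α`, integrating along right translates by `exp (s v)` gives a primitive of
`R_{exp v}^* α - α`. -/
theorem distD_integral_translate {α : G → (E →L[ℝ] ℝ)}
    (hα : ∀ w : E, LocallyIntegrable (fun x => α x w) μ)
    (hc : GenForm.IsClosed μ (formDist μ α)) (v : GroupLieAlgebra 𝓘(ℝ, E) G) :
    distD (E := E) μ (fun x => ∫ s in (0 : ℝ)..1, α (x * expCurve v s) (v : E)) =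
      (formDist μ α).pull (expCurve v 1) - formDist μ α := by
  funext w φ
  -- `P s` is the pairing of the pullback of `α` by `exp (s v)` with `(w, φ)`. For closed `α`,
  -- Cartan's formula says that its derivative is the pairing of the differential of the translated
  -- function `α(v)`; integration over `[0, 1]` then gives the claim.
  let P : ℝ → ℝ := fun s => (formDist μ α).pull (expCurve v s) w φ
  let B : ℝ → TestFunction E G → E →ₗ[ℝ] ℝ := fun s ψ =>
    { toFun := fun b => ∫ x, α (x * expCurve v s) b * ψ.1 x ∂μ
      map_add' := fun a b => by
        simp only [map_add, add_mul]
        exact integral_add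
          (integrable_mul_testFunction μ (locallyIntegrable_mul_right μ (hα a) _) ψ)
          (integrable_mul_testFunction μ (locallyIntegrable_mul_right μ (hα b) _) ψ)
      map_smul' := fun c a => by
        simp only [map_smul, smul_eq_mul, mul_assoc]
        exact integral_const_mul c _ }
  have hPB : ∀ s, P s = B s φ (adMap E (expCurve v (-s)) (w : E)) := fun s => by
    have h := integral_mul_right_mul μ (fun x => α x (adMap E (expCurve v (-s)) (w : E))) φ.1
      (expCurve v s)
    rw [expCurve_neg] at h ⊢
    exact h.symm
  have hP : ∀ s, HasDerivAt P
      (-∫ x, α (x * expCurve v s) (v : E) * (adjDeriv μ w φ).1 x ∂μ) s := fun s => by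
    have h1 (b : E) : HasDerivAt (fun s => B s φ b) ((-B s (adjDeriv μ v φ)) b) s :=
      hasDerivAt_integral_translate μ (hα b) φ v s
    have h2 := hasDerivAt_linearMap_apply (B := fun s => B s φ) h1 (hasDerivAt_adMap v w s)
    have h3 : P = fun s => B s φ (adMap E (expCurve v (-s)) (w : E)) := funext hPB
    rw [h3]
    refine h2.congr_deriv ?_
    have e (b : GroupLieAlgebra 𝓘(ℝ, E) G) (ψ : TestFunction E G) : B s ψ b =
        (modularCharacterFun (expCurve v s) : ℝ) *
          formDist μ α b (rightTranslate (expCurve v (-s)) ψ) := by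
      have h := integral_mul_right_mul μ (fun x => α x (b : E)) ψ.1 (expCurve v s)
      rw [expCurve_neg]
      exact h
    -- Closedness is applied to `v` and the moving vector `Ad (exp (-s v)) w`; its bracket term
    -- cancels the one from the derivative of the adjoint action.
    have hcl := hc v (Ad (expCurve v (-s)) w) (rightTranslate (expCurve v (-s)) φ)
    rw [← rightTranslate_adjDeriv, adjDeriv_rightTranslate] at hcl
    have e2 := e (Ad (expCurve v (-s)) w) (adjDeriv μ v φ)
    have e3 := e v (adjDeriv μ w φ)
    have e4 : B s φ (⁅Ad (expCurve v (-s)) w, v⁆ : GroupLieAlgebra 𝓘(ℝ, E) G) =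
        -((modularCharacterFun (expCurve v s) : ℝ) *
          formDist μ α ⁅v, Ad (expCurve v (-s)) w⁆ (rightTranslate (expCurve v (-s)) φ)) := by
      rw [← e ⁅v, Ad (expCurve v (-s)) w⁆ φ]
      refine (congrArg (fun a : E => B s φ a) (lie_neg_swap v (Ad (expCurve v (-s)) w))).trans ?_
      exact map_neg (B s φ) (⁅v, Ad (expCurve v (-s)) w⁆ : GroupLieAlgebra 𝓘(ℝ, E) G)
    have e6 : (-B s (adjDeriv μ v φ)) (adMap E (expCurve v (-s)) (w : E)) =
        -B s (adjDeriv μ v φ) (Ad (expCurve v (-s)) w) := rfl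
    have e7 : ∫ x, α (x * expCurve v s) (v : E) * (adjDeriv μ w φ).1 x ∂μ =
        B s (adjDeriv μ w φ) v := rfl
    rw [e6, e7, e2, e3]
    refine (congrArg (· + _) e4).trans ?_
    linear_combination (modularCharacterFun (expCurve v s) : ℝ) * hcl
  have hcont : Continuous fun s => -∫ x, α (x * expCurve v s) (v : E) * (adjDeriv μ w φ).1 x ∂μ :=
    (continuous_integral_translate μ (hα v) (adjDeriv μ w φ) v).neg
  have hF := intervalIntegral.integral_eq_sub_of_hasDerivAt (a := 0) (b := 1)
    (fun s _ => hP s) (hcont.intervalIntegrable 0 1)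
  rw [intervalIntegral.integral_neg,
    intervalIntegral_integral_translate μ (hα v) (adjDeriv μ w φ) v zero_le_one] at hF
  have h0 : P 0 = formDist μ α w φ := by
    show (formDist μ α).pull (expCurve v 0) w φ = _
    rw [expCurve_zero, GenForm.pull_one]
  rw [h0] at hF
  exact hF

end Cocycle

/-! ### Averages of translates in `L^p` -/

section Averages

open Measure

/-- Jensen's inequality for the probability measure `ν`, followed by Tonelli. -/
theorem lintegral_rpow_lintegral_le {X Y : Type*} [MeasurableSpace X] [MeasurableSpace Y]
    {ν : Measure Y} [IsProbabilityMeasure ν] {μ : Measure X} [SFinite μ] {f : Y × X → ℝ≥0∞}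
    (hf : AEMeasurable f (ν.prod μ)) {q : ℝ} (hq : 1 ≤ q) :
    ∫⁻ x, (∫⁻ y, f (y, x) ∂ν) ^ q ∂μ ≤ ∫⁻ y, ∫⁻ x, f (y, x) ^ q ∂μ ∂ν := by
  have hq0 : 0 < q := by linarith
  have h1 : ∀ᵐ x ∂μ, AEMeasurable (fun y => f (y, x)) ν := by
    have h := hf.prod_swap
    obtain ⟨g, hg, hfg⟩ := h
    filter_upwards [ae_ae_of_ae_prod hfg] with x hx
    exact ⟨fun y => g (x, y), hg.comp measurable_prodMk_left, hx⟩
  rw [lintegral_lintegral_swap (f := fun y x => f (y, x) ^ q) (hf.pow_const q)]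
  refine lintegral_mono_ae ?_
  filter_upwards [h1] with x hx
  have h2 := eLpNorm'_le_eLpNorm'_of_exponent_le (p := 1) one_pos hq ν hx.aestronglyMeasurable
  simp only [eLpNorm', enorm_eq_self, ENNReal.rpow_one, div_one, one_div] at h2
  calc (∫⁻ y, f (y, x) ∂ν) ^ q ≤ ((∫⁻ y, f (y, x) ^ q ∂ν) ^ q⁻¹) ^ q :=
        ENNReal.rpow_le_rpow h2 hq0.le
    _ = _ := by rw [← ENNReal.rpow_mul, inv_mul_cancel₀ hq0.ne', ENNReal.rpow_one]

variable {G : Type*} [TopologicalSpace G] [Group G] [IsTopologicalGroup G] [T2Space G]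
  [SecondCountableTopology G] [LocallyCompactSpace G] [MeasurableSpace G] [BorelSpace G]
  (μ : Measure G) [μ.IsHaarMeasure]
  {Y : Type*} [TopologicalSpace Y] [SecondCountableTopology Y] [MeasurableSpace Y]
  [BorelSpace Y] {ν : Measure Y} [IsProbabilityMeasure ν]

/-- The weight `k` allows an integral over a half-line to be written as an average against a
probability measure; each translate contributes its modular factor. -/
theorem lintegral_rpow_translate_le {γ : Y → G} (hγ : Continuous γ) {h : G → ℝ}
    (hh : AEStronglyMeasurable h μ) {k : Y → ℝ≥0∞} (hk : Measurable k) {q : ℝ} (hq : 1 ≤ q) :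
    ∫⁻ x, (∫⁻ y, k y * ‖h (x * γ y)‖ₑ ∂ν) ^ q ∂μ ≤
      (∫⁻ y, k y ^ q * (modularCharacterFun (γ y) : ℝ≥0∞) ∂ν) * ∫⁻ x, ‖h x‖ₑ ^ q ∂μ := by
  have hm : AEMeasurable (fun z : Y × G => k z.1 * ‖h (z.2 * γ z.1)‖ₑ) (ν.prod μ) :=
    (hk.comp measurable_fst).aemeasurable.mul (aestronglyMeasurable_mul_curve μ hγ hh).enorm
  refine (lintegral_rpow_lintegral_le hm hq).trans (le_of_eq ?_)
  have hc : Measurable fun y => (modularCharacterFun (γ y) : ℝ≥0∞) :=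
    (ENNReal.continuous_coe.comp (continuous_modularCharacterFun.comp hγ)).measurable
  rw [← lintegral_mul_const _ (show Measurable fun y => k y ^ q *
    (modularCharacterFun (γ y) : ℝ≥0∞) from (hk.pow_const q).mul hc)]
  refine lintegral_congr fun y => ?_
  simp only [ENNReal.mul_rpow_of_nonneg _ _ (zero_le_one.trans hq)]
  have e : AEMeasurable (fun x => ‖h (x * γ y)‖ₑ ^ q) μ :=
    ((hh.comp_quasiMeasurePreserving (quasiMeasurePreserving_mul_right' μ (γ y))).enorm).pow_const q
  rw [lintegral_const_mul'' _ e,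
    lintegral_mul_right μ (fun x => ‖h x‖ₑ ^ q), mul_assoc]

theorem eLpNorm_rpow_toReal {X F : Type*} [MeasurableSpace X] [NormedAddCommGroup F]
    {μ : Measure X} {p : ℝ≥0∞} (h0 : p ≠ 0) (hp : p ≠ ⊤) (f : X → F) :
    eLpNorm f p μ ^ p.toReal = ∫⁻ x, ‖f x‖ₑ ^ p.toReal ∂μ := by
  rw [eLpNorm_eq_lintegral_rpow_enorm_toReal h0 hp, ← ENNReal.rpow_mul, one_div,
    inv_mul_cancel₀ (ENNReal.toReal_pos h0 hp).ne', ENNReal.rpow_one]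

theorem eLpNorm_integral_translate_le {p : ℝ≥0∞} (hp1 : 1 ≤ p) (hp : p ≠ ⊤) {γ : Y → G}
    (hγ : Continuous γ) {h : G → ℝ} (hh : AEStronglyMeasurable h μ) {K : ℝ≥0∞}
    (hK : ∀ᵐ y ∂ν, (modularCharacterFun (γ y) : ℝ≥0∞) ≤ K) :
    eLpNorm (fun x => ∫ y, h (x * γ y) ∂ν) p μ ≤ K ^ (p.toReal⁻¹) * eLpNorm h p μ := by
  have h0 : p ≠ 0 := (zero_lt_one.trans_le hp1).ne'
  have hq0 := ENNReal.toReal_pos h0 hp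
  have hq : 1 ≤ p.toReal := by simpa using ENNReal.toReal_mono hp hp1
  rw [← ENNReal.rpow_le_rpow_iff hq0, ENNReal.mul_rpow_of_nonneg _ _ hq0.le, ← ENNReal.rpow_mul,
    inv_mul_cancel₀ hq0.ne', ENNReal.rpow_one, eLpNorm_rpow_toReal h0 hp, eLpNorm_rpow_toReal h0 hp]
  calc ∫⁻ x, ‖∫ y, h (x * γ y) ∂ν‖ₑ ^ p.toReal ∂μ
      ≤ ∫⁻ x, (∫⁻ y, 1 * ‖h (x * γ y)‖ₑ ∂ν) ^ p.toReal ∂μ := by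
        refine lintegral_mono fun x => ENNReal.rpow_le_rpow ?_ hq0.le
        simpa using enorm_integral_le_lintegral_enorm _
    _ ≤ _ := lintegral_rpow_translate_le μ hγ hh measurable_const hq
    _ ≤ _ := by
        gcongr
        calc ∫⁻ y, 1 ^ p.toReal * (modularCharacterFun (γ y) : ℝ≥0∞) ∂ν
            ≤ ∫⁻ y, K ∂ν := lintegral_mono_ae (by simpa using hK)
          _ = K := by simp

end Averages

/-! ### The `L^p` cocycle of a closed form -/

section Cocycle

open Measure

variable {E : Type*} [NormedAddCommGroup E] [NormedSpace ℝ E] [FiniteDimensional ℝ E]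
  {G : Type*} [TopologicalSpace G] [ChartedSpace E G] [Group G] [LieGroup 𝓘(ℝ, E) ∞ G]
  [T2Space G] [IsTopologicalGroup G] [SecondCountableTopology G] [LocallyCompactSpace G]
  [MeasurableSpace G] [BorelSpace G] (μ : Measure G) [μ.IsHaarMeasure]

/-- Right translations would preserve a finite total mass, forcing the modular function to be `1`
along `exp (t v)`. -/
theorem measure_univ_eq_top (v : GroupLieAlgebra 𝓘(ℝ, E) G) (hv : divergence μ v ≠ 0) :
    μ Set.univ = ⊤ := by
  by_contra hfin
  have h := lintegral_mul_right μ (fun _ => 1) (expCurve v 1)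
  simp only [lintegral_const, one_mul] at h
  have h1 : (modularCharacterFun (expCurve v 1) : ℝ≥0∞) = 1 := by
    have := (ENNReal.mul_eq_right (NeZero.ne (μ Set.univ)) hfin).1 h.symm
    exact this
  have h2 := modularCharacterFun_expCurve μ v 1
  rw [ENNReal.coe_eq_one.1 h1, NNReal.coe_one, eq_comm, Real.exp_eq_one_iff] at h2
  exact hv (by linarith)

/-- The difference is a constant in `L^p`, and infinite volume leaves only zero. Because of this
uniqueness, the primitives below satisfy the cocycle identity itself, not just up to constants. -/
theorem ae_eq_of_distD_eq [ConnectedSpace G] {p : ℝ≥0∞} (hp1 : 1 ≤ p) (hp : p ≠ ⊤)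
    (hμ : μ Set.univ = ⊤) {f g : G → ℝ} (hf : MemLp f p μ) (hg : MemLp g p μ)
    (h : distD (E := E) μ f = distD μ g) : f =ᵐ[μ] g := by
  have hf' := hf.locallyIntegrable hp1
  have hg' := hg.locallyIntegrable hp1
  obtain ⟨c, hc⟩ := ae_const_of_distD_eq_zero (E := E) μ (hf'.sub hg') (by
    rw [distD_sub μ hf' hg', h, sub_self])
  have h1 : MemLp (fun _ : G => c) p μ := (memLp_congr_ae hc).1 (hf.sub hg)
  rw [memLp_const_iff (zero_lt_one.trans_le hp1).ne' hp, hμ] at h1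
  have hc0 : c = 0 := by simpa using h1
  filter_upwards [hc] with x hx
  rw [hc0] at hx
  exact sub_eq_zero.1 hx

theorem memLp_mul_right {F : Type*} [NormedAddCommGroup F] {p : ℝ≥0∞} (hp : p ≠ ⊤) {f : G → F}
    (hf : MemLp f p μ) (g : G) : MemLp (fun x => f (x * g)) p μ := by
  refine ⟨hf.1.comp_quasiMeasurePreserving (quasiMeasurePreserving_mul_right' μ g), ?_⟩
  rw [eLpNorm_mul_right μ hp]
  exact ENNReal.mul_lt_top (ENNReal.rpow_lt_top_of_nonneg (by positivity) ENNReal.coe_ne_top) hf.2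

theorem eLpNorm_form_apply_le {p : ℝ≥0∞} (α : G → (E →L[ℝ] ℝ)) (v : E) :
    eLpNorm (fun x => α x v) p μ ≤ ‖v‖ₑ * eLpNorm α p μ := by
  have h := eLpNorm_le_nnreal_smul_eLpNorm_of_ae_le_mul (μ := μ) (f := fun x => α x v) (g := α)
    (c := ‖v‖₊) (Eventually.of_forall fun x => by
      rw [mul_comm]; exact (α x).le_opNNNorm v) p
  rwa [ENNReal.smul_def, smul_eq_mul] at h

theorem memLp_form_apply {p : ℝ≥0∞} {α : G → (E →L[ℝ] ℝ)} (hα : MemLp α p μ) (v : E) :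
    MemLp (fun x => α x v) p μ :=
  (ContinuousLinearMap.apply (E := E) ℝ ℝ v).comp_memLp' hα

/-- The bound for the integral of a form along the right translates by `exp (s t v)`. -/
theorem eLpNorm_integral_form_le {p : ℝ≥0∞} (hp1 : 1 ≤ p) (hp : p ≠ ⊤) {α : G → (E →L[ℝ] ℝ)}
    (hα : MemLp α p μ) (v : GroupLieAlgebra 𝓘(ℝ, E) G) {t : ℝ} (ht : |t| ≤ 1) :
    eLpNorm (fun x => ∫ s in (0 : ℝ)..1, α (x * expCurve (t • v) s) (t • v : E)) p μ ≤
      ENNReal.ofReal (Real.exp |divergence μ v|) ^ p.toReal⁻¹ *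
        (‖t‖ₑ * enorm (E := E) v * eLpNorm α p μ) := by
  have : IsProbabilityMeasure (volume.restrict (Set.Ioc (0 : ℝ) 1)) := ⟨by simp⟩
  simp only [intervalIntegral.integral_of_le zero_le_one]
  refine (eLpNorm_integral_translate_le μ hp1 hp (continuous_expCurve (t • v))
    (memLp_form_apply μ hα _).1 (K := ENNReal.ofReal (Real.exp |divergence μ v|)) ?_).trans ?_
  · filter_upwards [ae_restrict_mem measurableSet_Ioc] with s hs
    rw [← ENNReal.ofReal_coe_nnreal, modularCharacterFun_expCurve μ, divergence_smul]
    refine ENNReal.ofReal_le_ofReal (Real.exp_le_exp.2 ?_)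
    calc -(t * divergence μ v * s) ≤ |t * divergence μ v * s| := neg_le_abs _
      _ = |t| * |divergence μ v| * |s| := by rw [abs_mul, abs_mul]
      _ ≤ 1 * |divergence μ v| * 1 := by
        gcongr
        rw [abs_of_pos hs.1]; exact hs.2
      _ = |divergence μ v| := by ring
  · gcongr
    exact (eLpNorm_form_apply_le μ α _).trans
      (le_of_eq (congrArg (· * eLpNorm α p μ) (enorm_smul t (show E from v))))

variable {μ}

/-- The cocycle of a closed `L^p` form `α`: the family of `L^p` primitives `F g` of
`R_g^* α - α`. -/
structure IsCocycle {p : ℝ≥0∞} (α : Lp (E →L[ℝ] ℝ) p μ) (F : G → Lp ℝ p μ) : Prop where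
  mul : ∀ g h, F (g * h) =ᵐ[μ] fun x => F g x + F h (x * g)
  expCurve : ∀ v : GroupLieAlgebra 𝓘(ℝ, E) G,
    F (expCurve v 1) =ᵐ[μ] fun x => ∫ s in (0 : ℝ)..1, α (x * expCurve v s) (v : E)

/-- The elements `g` for which `R_g^* α - α` has an `L^p` primitive form a subgroup, which contains
all exponentials by `distD_integral_translate`. Both sides of the cocycle identity are `L^p`
primitives of the same form, hence equal. -/
theorem exists_isCocycle [ConnectedSpace G] {p : ℝ≥0∞} [Fact (1 ≤ p)] (hp : p ≠ ⊤)
    (hμ : μ Set.univ = ⊤) {α : Lp (E →L[ℝ] ℝ) p μ} (hα : α ∈ closedForms (G := G) E μ p) :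
    ∃ F : G → Lp ℝ p μ, IsCocycle α F := by
  have hp1 : 1 ≤ p := Fact.out
  set T : GenForm E G := formDist μ α with hT
  have hli (w : E) : LocallyIntegrable (fun x => α x w) μ :=
    (memLp_form_apply μ (Lp.memLp α) w).locallyIntegrable hp1
  have hexp (v : GroupLieAlgebra 𝓘(ℝ, E) G) :
      MemLp (fun x => ∫ s in (0 : ℝ)..1, α (x * expCurve v s) (v : E)) p μ := by
    refine ⟨(locallyIntegrable_intervalIntegral μ (hli v) v zero_le_one).aestronglyMeasurable, ?_⟩
    have h := eLpNorm_integral_form_le μ hp1 hp (Lp.memLp α) v (t := 1) (by simp)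
    simp only [one_smul] at h
    refine h.trans_lt (ENNReal.mul_lt_top (ENNReal.rpow_lt_top_of_nonneg (by positivity)
      ENNReal.ofReal_ne_top) (ENNReal.mul_lt_top ?_ (Lp.eLpNorm_lt_top α)))
    exact ENNReal.mul_lt_top enorm_lt_top enorm_lt_top
  let H : Subgroup G :=
    { carrier := {g | ∃ f : G → ℝ, MemLp f p μ ∧ distD μ f = T.pull g - T}
      one_mem' := ⟨0, MemLp.zero, by
        rw [GenForm.pull_one, sub_self]; exact distD_const (E := E) μ 0⟩
      mul_mem' := by
        rintro a b ⟨f, hf, hf'⟩ ⟨k, hk, hk'⟩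
        have hk2 := memLp_mul_right μ hp hk a
        refine ⟨f + fun x => k (x * a), hf.add hk2, ?_⟩
        rw [distD_add μ (hf.locallyIntegrable hp1) (hk2.locallyIntegrable hp1), distD_mul_right,
          hf', hk', GenForm.pull_mul, GenForm.pull_sub]
        abel
      inv_mem' := by
        rintro a ⟨f, hf, hf'⟩
        have hk2 := memLp_mul_right μ hp hf a⁻¹
        refine ⟨(-1 : ℝ) • fun x => f (x * a⁻¹), hk2.const_smul _, ?_⟩
        rw [distD_smul, distD_mul_right, hf', GenForm.pull_sub, ← GenForm.pull_mul,
          inv_mul_cancel, GenForm.pull_one]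
        module }
  have hH : ∀ g, ∃ f : G → ℝ, MemLp f p μ ∧ distD μ f = T.pull g - T := fun g => by
    refine mem_of_expCurve_mem (E := E) H (fun v t => ?_) g
    refine ⟨_, hexp (t • v), ?_⟩
    rw [distD_integral_translate μ hli hα]
    have h := expCurve_smul v t 1
    rw [mul_one] at h
    rw [h]
  choose f hf hf' using hH
  refine ⟨fun g => (hf g).toLp, fun g h => ?_, fun v => ?_⟩
  · have h2 := memLp_mul_right μ hp (hf h) g
    have h1 : f (g * h) =ᵐ[μ] f g + fun x => f h (x * g) := by
      refine ae_eq_of_distD_eq (E := E) μ hp1 hp hμ (hf _) ((hf g).add h2) ?_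
      rw [distD_add μ ((hf g).locallyIntegrable hp1) (h2.locallyIntegrable hp1), distD_mul_right,
        hf', hf', hf', GenForm.pull_mul, GenForm.pull_sub]
      abel
    filter_upwards [h1, (hf (g * h)).coeFn_toLp, (hf g).coeFn_toLp,
      (quasiMeasurePreserving_mul_right' μ g).ae (hf h).coeFn_toLp] with x h3 h4 h5 h6
    rw [h4, h5, h6, h3]
    rfl
  · refine (hf _).coeFn_toLp.trans ?_
    refine ae_eq_of_distD_eq (E := E) μ hp1 hp hμ (hf _) (hexp v) ?_
    rw [hf', distD_integral_translate μ hli hα]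

/-- The difference `F (g * h) - F g` is the right translate of `F h` by `g`. This reduces continuity
of `F` to continuity at `1`. -/
theorem IsCocycle.norm_mul_le {p : ℝ≥0∞} [Fact (1 ≤ p)] (hp : p ≠ ⊤)
    {α : Lp (E →L[ℝ] ℝ) p μ} {F : G → Lp ℝ p μ} (hF : IsCocycle α F) (g h : G) :
    ‖F (g * h) - F g‖ = (modularCharacterFun g : ℝ) ^ (1 / p).toReal * ‖F h‖ := by
  have h1 : eLpNorm (F (g * h) - F g : Lp ℝ p μ) p μ =
      (modularCharacterFun g : ℝ≥0∞) ^ (1 / p).toReal * eLpNorm (F h) p μ := by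
    rw [← eLpNorm_mul_right μ hp]
    refine eLpNorm_congr_ae ?_
    filter_upwards [hF.mul g h, Lp.coeFn_sub (F (g * h)) (F g)] with x h1 h2
    rw [h2, Pi.sub_apply, h1]
    ring
  rw [Lp.norm_def, Lp.norm_def, h1, ENNReal.toReal_mul, ← ENNReal.toReal_rpow]
  rfl

/-- The explicit integral gives `‖F (exp (t v))‖ = O(t)`. Subadditivity of the norm along products
carries this to `expProd`, hence to a neighbourhood of `1`, and `norm_mul_le` carries it to any
other point. -/
theorem IsCocycle.continuous {p : ℝ≥0∞} [Fact (1 ≤ p)] (hp : p ≠ ⊤)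
    {α : Lp (E →L[ℝ] ℝ) p μ} {F : G → Lp ℝ p μ} (hF : IsCocycle α F) : Continuous F := by
  have hp1 : 1 ≤ p := Fact.out
  have h1 : F 1 = 0 := by
    have h := hF.norm_mul_le hp 1 1
    rw [modularCharacterFun_map_one] at h
    simpa using h.symm
  have hexp (v : GroupLieAlgebra 𝓘(ℝ, E) G) :
      Tendsto (fun t => ‖F (LpCohomology.expCurve v t)‖) (𝓝 0) (𝓝 0) := by
    set C := (ENNReal.ofReal (Real.exp |divergence μ v|) ^ p.toReal⁻¹).toReal
    have hb : ∀ᶠ t in 𝓝 (0 : ℝ), ‖F (LpCohomology.expCurve v t)‖ ≤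
        C * (|t| * norm (E := E) v * ‖α‖) := by
      filter_upwards [Metric.closedBall_mem_nhds (0 : ℝ) one_pos] with t ht
      have ht' : |t| ≤ 1 := by simpa using ht
      have h := eLpNorm_integral_form_le μ hp1 hp (Lp.memLp α) v ht'
      have h2 := expCurve_smul v t 1
      rw [mul_one] at h2
      have h3 := hF.expCurve (t • v)
      rw [h2] at h3
      have h4 := (eLpNorm_congr_ae h3).trans_le h
      have h5 := ENNReal.toReal_mono (ENNReal.mul_ne_top (ENNReal.rpow_ne_top_of_nonneg
        (by positivity) ENNReal.ofReal_ne_top) (ENNReal.mul_ne_top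
          (ENNReal.mul_ne_top enorm_ne_top enorm_ne_top) (Lp.eLpNorm_ne_top α))) h4
      rw [ENNReal.toReal_mul, ENNReal.toReal_mul, ENNReal.toReal_mul, toReal_enorm,
        Real.norm_eq_abs] at h5
      exact h5
    refine squeeze_zero' (Eventually.of_forall fun t => norm_nonneg _) hb ?_
    have : Continuous fun t : ℝ => C * (|t| * norm (E := E) v * ‖α‖) := by fun_prop
    simpa using this.tendsto 0
  have hsub (g h : G) : ‖F (g * h)‖ ≤ ‖F g‖ + (modularCharacterFun g : ℝ) ^ (1 / p).toReal * ‖F h‖ := by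
    rw [← hF.norm_mul_le hp]
    have := norm_add_le (F g) (F (g * h) - F g)
    rwa [add_sub_cancel] at this
  have hprod (l : List (Fin (Module.finrank ℝ E))) :
      Tendsto (fun a : E => ‖F (expProd G l a)‖) (𝓝 0) (𝓝 0) := by
    induction l with
    | nil => simp [expProd, h1]
    | cons i l ih =>
      have hc : Tendsto (fun a : E => (Module.finBasis ℝ E).coord i a) (𝓝 0) (𝓝 0) := by
        have := ((Module.finBasis ℝ E).coord i).toContinuousLinearMap.continuous.tendsto 0
        rw [map_zero] at this
        exact this
      have hmod : Tendsto (fun a : E => (modularCharacterFun (LpCohomology.expCurve (basisVec G i)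
          ((Module.finBasis ℝ E).coord i a)) : ℝ) ^ (1 / p).toReal) (𝓝 0) (𝓝 1) := by
        have h2 : Continuous fun t : ℝ => (modularCharacterFun
            (LpCohomology.expCurve (basisVec G i) t) : ℝ) ^ (1 / p).toReal :=
          (NNReal.continuous_coe.comp (continuous_modularCharacterFun.comp
            (continuous_expCurve _))).rpow_const fun _ => Or.inr (by positivity)
        have h3 := (h2.tendsto 0).comp hc
        rwa [expCurve_zero, modularCharacterFun_map_one, NNReal.coe_one, Real.one_rpow] at h3
      have hlim := ((hexp (basisVec G i)).comp hc).add (hmod.mul ih)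
      rw [mul_zero, add_zero] at hlim
      refine squeeze_zero (fun a => norm_nonneg _) (fun a => ?_) hlim
      rw [expProd_cons]
      exact hsub _ _
  have hone : Tendsto (fun h => ‖F h‖) (𝓝 1) (𝓝 0) := by
    rw [← map_expProd_nhds (E := E), tendsto_map'_iff]
    exact hprod _
  refine continuous_iff_continuousAt.2 fun g => ?_
  rw [ContinuousAt, ← map_mul_left_nhds_one g, tendsto_map'_iff, tendsto_iff_norm_sub_tendsto_zero]
  simp only [Function.comp, hF.norm_mul_le hp]
  simpa using hone.const_mul ((modularCharacterFun g : ℝ) ^ (1 / p).toReal)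

end Cocycle

/-! ### Jointly measurable representatives -/

section JointMeasurability

/-- A continuous family of `L^p` functions has a jointly measurable representative. -/
theorem exists_measurable_uncurry {X Y : Type*} [MeasurableSpace X] {μ : Measure X}
    [TopologicalSpace Y] [SecondCountableTopology Y] [MeasurableSpace Y] [BorelSpace Y] [Nonempty Y]
    {p : ℝ≥0∞} [Fact (1 ≤ p)] {F : Y → Lp ℝ p μ} (hF : Continuous F) :
    ∃ f : Y × X → ℝ, Measurable f ∧ ∀ y, (fun x => f (y, x)) =ᵐ[μ] F y := by
  classical
  let d := TopologicalSpace.denseSeq Y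
  -- Half of `2⁻ⁿ`: two approximations from stage `N` on then differ by less than `2⁻ᴺ`, and this
  -- summable bound gives convergence almost everywhere for each fixed `y`.
  let ε : ℕ → ℝ := fun n => (1 / 2) ^ n / 2
  have hε : ∀ n, 0 < ε n := fun n => by positivity
  have hk : ∀ n y, ∃ k, ‖F (d k) - F y‖ < ε n := fun n y => by
    have hopen : IsOpen {z | ‖F z - F y‖ < ε n} :=
      isOpen_lt (hF.sub continuous_const).norm continuous_const
    obtain ⟨k, hz⟩ := (TopologicalSpace.denseRange_denseSeq Y).exists_mem_open hopen
      ⟨y, by simpa using hε n⟩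
    exact ⟨k, hz⟩
  -- Taking the first sufficiently close point of the dense sequence makes the choice countably
  -- valued and measurable in `y`.
  let k : ℕ → Y → ℕ := fun n y => Nat.find (hk n y)
  have hkm : ∀ n, Measurable (k n) := fun n => measurable_find _ fun j =>
    (isOpen_lt (continuous_const.sub hF).norm continuous_const).measurableSet
  have hgm : Measurable fun z : ℕ × X => F (d z.1) z.2 :=
    measurable_from_prod_countable_right fun j => (Lp.stronglyMeasurable (F (d j))).measurable
  let fn : ℕ → Y × X → ℝ := fun n z => F (d (k n z.1)) z.2
  have hfn : ∀ n, Measurable (fn n) := fun n =>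
    hgm.comp (((hkm n).comp measurable_fst).prodMk measurable_snd)
  refine ⟨fun z => limsup (fun n => fn n z) atTop, Measurable.limsup hfn, fun y => ?_⟩
  have hb : ∀ n, ‖F (d (k n y)) - F y‖ < ε n := fun n => Nat.find_spec (hk n y)
  have hε0 : Tendsto ε atTop (𝓝 0) := by
    have := (tendsto_pow_atTop_nhds_zero_of_lt_one (r := (1 / 2 : ℝ)) (by norm_num)
      (by norm_num)).div_const 2
    simpa [ε] using this
  have hlim : Tendsto (fun n => F (d (k n y))) atTop (𝓝 (F y)) :=
    tendsto_iff_norm_sub_tendsto_zero.2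
      (squeeze_zero (fun n => norm_nonneg _) (fun n => (hb n).le) hε0)
  have hcau : ∀ᵐ x ∂μ, ∃ l : ℝ, Tendsto (fun n => F (d (k n y)) x) atTop (𝓝 l) := by
    refine Lp.ae_tendsto_of_cauchy_eLpNorm (p := p) (fun n => (Lp.aestronglyMeasurable _)) Fact.out
      (B := fun n => ENNReal.ofReal ((1 / 2) ^ n)) ?_ fun N n m hn hm => ?_
    · rw [← ENNReal.ofReal_tsum_of_nonneg (fun n => by positivity) summable_geometric_two]
      exact ENNReal.ofReal_ne_top
    · rw [← eLpNorm_congr_ae (Lp.coeFn_sub _ _), ← Lp.enorm_def, ← ofReal_norm]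
      refine (ENNReal.ofReal_lt_ofReal_iff (by positivity)).2 ?_
      have hmono : ∀ n, N ≤ n → ε n ≤ ε N := fun n hn => by
        simp only [ε]
        gcongr ?_ / 2
        exact pow_le_pow_of_le_one (by norm_num) (by norm_num) hn
      calc ‖F (d (k n y)) - F (d (k m y))‖ ≤ ‖F (d (k n y)) - F y‖ + ‖F (d (k m y)) - F y‖ :=
            by simpa using norm_sub_le (F (d (k n y)) - F y) (F (d (k m y)) - F y)
        _ < ε n + ε m := add_lt_add (hb n) (hb m)
        _ ≤ ε N + ε N := add_le_add (hmono n hn) (hmono m hm)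
        _ = (1 / 2) ^ N := by simp [ε]
  obtain ⟨ns, hns, hns'⟩ := (tendstoInMeasure_of_tendsto_Lp hlim).exists_seq_tendsto_ae
  filter_upwards [hcau, hns'] with x ⟨l, hl⟩ hx
  have : l = F y x := tendsto_nhds_unique (hl.comp hns.tendsto_atTop) hx
  rw [this] at hl
  exact hl.limsup_eq

end JointMeasurability

/-! ### Continuous cocycles are coboundaries -/

section Primitive

variable {G : Type*} [TopologicalSpace G] [Group G] [IsTopologicalGroup G] [T2Space G]
  [SecondCountableTopology G] [LocallyCompactSpace G] [MeasurableSpace G] [BorelSpace G]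
  {μ : Measure G} [μ.IsHaarMeasure]

open Measure

theorem ae_of_forall_isCompact {P : G → Prop} (h : ∀ A : Set G, IsCompact A → ∀ᵐ x ∂μ.restrict A, P x) :
    ∀ᵐ x ∂μ, P x := by
  rw [← restrict_univ (μ := μ), ← iUnion_compactCovering G, ae_restrict_iUnion_iff]
  exact fun n => h _ (isCompact_compactCovering G n)

/-- A continuous `L^p`-valued cocycle is the coboundary of a locally `L^p` function. -/
theorem exists_sub_ae_eq_of_cocycle {p : ℝ≥0∞} [Fact (1 ≤ p)] (hp : p ≠ ⊤) {F : G → Lp ℝ p μ}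
    (hF : Continuous F) (hmul : ∀ g h, F (g * h) =ᵐ[μ] fun x => F g x + F h (x * g)) :
    ∃ u : G → ℝ, (∀ K, IsCompact K → MemLp u p (μ.restrict K)) ∧
      ∀ h, (fun x => u (x * h) - u x) =ᵐ[μ] F h := by
  have hp1 : 1 ≤ p := Fact.out
  have h0 : p ≠ 0 := (zero_lt_one.trans_le hp1).ne'
  have hq0 := ENNReal.toReal_pos h0 hp
  have hq : 1 ≤ p.toReal := by simpa using ENNReal.toReal_mono hp hp1
  obtain ⟨f, hf, hfF⟩ := exists_measurable_uncurry hF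
  obtain ⟨K, hK, hK1⟩ := exists_compact_mem_nhds (1 : G)
  have hμK : μ K ≠ 0 := (measure_pos_of_mem_nhds μ hK1).ne'
  have hμK' : μ K ≠ ⊤ := hK.measure_lt_top.ne
  let ν : Measure G := (μ K)⁻¹ • μ.restrict K
  have hν : IsProbabilityMeasure ν := ⟨by simp [ν, ENNReal.inv_mul_cancel hμK hμK']⟩
  have hνμ : ν ≪ μ := (smul_absolutelyContinuous).trans absolutelyContinuous_restrict
  -- If `F h` were `u ∘ R_h - u`, then `F (x⁻¹ y)` at `x` would be `u y - u x`. So `D (x, y)` stands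
  -- for `u y - u x`, and averaging over `x ∈ K` recovers `u` up to a constant.
  let D : G × G → ℝ := fun z => f (z.1⁻¹ * z.2, z.1)
  have hD : Measurable D :=
    hf.comp ((measurable_fst.inv.mul measurable_snd).prodMk measurable_fst)
  let u : G → ℝ := fun y => ∫ x, D (x, y) ∂ν
  have hum : StronglyMeasurable u :=
    (hD.stronglyMeasurable.comp_measurable measurable_swap).integral_prod_right'
  -- Jensen, then the substitution `y = x g`, which preserves `μ`; then `g` ranges in the compact
  -- set `K⁻¹ A`, on which `‖F g‖` is bounded.
  have hbound (A : Set G) (hA : IsCompact A) :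
      ∫⁻ y in A, (∫⁻ x, ‖D (x, y)‖ₑ ∂ν) ^ p.toReal ∂μ < ⊤ := by
    let B : Set G := (fun z : G × G => z.1⁻¹ * z.2) '' (K ×ˢ A)
    have hB : IsCompact B := (hK.prod hA).image (continuous_fst.inv.mul continuous_snd)
    have hfq : Measurable fun z : G × G => ‖f z‖ₑ ^ p.toReal := hf.enorm.pow_const _
    calc ∫⁻ y in A, (∫⁻ x, ‖D (x, y)‖ₑ ∂ν) ^ p.toReal ∂μ
        ≤ ∫⁻ x, ∫⁻ y in A, ‖D (x, y)‖ₑ ^ p.toReal ∂μ ∂ν :=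
          lintegral_rpow_lintegral_le (f := fun z => ‖D z‖ₑ) hD.enorm.aemeasurable hq
      _ ≤ ∫⁻ x, ∫⁻ g in B, ‖f (g, x)‖ₑ ^ p.toReal ∂μ ∂ν := by
          refine lintegral_mono_ae ?_
          have hmem : ∀ᵐ x ∂ν, x ∈ K :=
            (smul_absolutelyContinuous (c := (μ K)⁻¹)).ae_le (ae_restrict_mem hK.measurableSet)
          filter_upwards [hmem] with x hx
          rw [← lintegral_indicator hA.measurableSet, ← lintegral_indicator hB.measurableSet,
            ← lintegral_mul_left_eq_self _ x]
          refine lintegral_mono fun g => ?_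
          by_cases hg : x * g ∈ A
          · have : g ∈ B := ⟨(x, x * g), ⟨hx, hg⟩, by simp⟩
            simp [this, hg, D]
          · simp [hg]
      _ = ∫⁻ g in B, ∫⁻ x, ‖f (g, x)‖ₑ ^ p.toReal ∂ν ∂μ :=
          lintegral_lintegral_swap (hfq.comp measurable_swap).aemeasurable
      _ ≤ ∫⁻ g in B, (μ K)⁻¹ * ‖F g‖ₑ ^ p.toReal ∂μ := by
          refine lintegral_mono fun g => ?_
          rw [lintegral_smul_measure, smul_eq_mul]
          gcongr
          refine (setLIntegral_le_lintegral _ _).trans (le_of_eq ?_)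
          rw [Lp.enorm_def, eLpNorm_rpow_toReal h0 hp]
          refine lintegral_congr_ae ?_
          filter_upwards [hfF g] with x hx
          rw [hx]
      _ < ⊤ := by
          obtain ⟨C, hC⟩ := hB.exists_bound_of_continuousOn hF.continuousOn
          have h1 : ∀ g ∈ B, (μ K)⁻¹ * ‖F g‖ₑ ^ p.toReal ≤
              (μ K)⁻¹ * ENNReal.ofReal C ^ p.toReal := fun g hg => by
            gcongr
            rw [← ofReal_norm]
            exact ENNReal.ofReal_le_ofReal (hC g hg)
          refine (setLIntegral_mono measurable_const h1).trans_lt ?_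
          rw [setLIntegral_const]
          exact ENNReal.mul_lt_top (ENNReal.mul_lt_top (by simpa using pos_iff_ne_zero.2 hμK)
            (ENNReal.rpow_lt_top_of_nonneg hq0.le ENNReal.ofReal_ne_top)) hB.measure_lt_top
  have hint : ∀ᵐ y ∂μ, Integrable (fun x => D (x, y)) ν := by
    refine ae_of_forall_isCompact fun A hA => ?_
    have hm : Measurable fun y => (∫⁻ x, ‖D (x, y)‖ₑ ∂ν) ^ p.toReal :=
      (Measurable.lintegral_prod_left hD.enorm).pow_const _
    filter_upwards [ae_lt_top hm (hbound A hA).ne] with y hy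
    refine ⟨(hD.comp measurable_prodMk_right).aestronglyMeasurable, ?_⟩
    exact (ENNReal.rpow_lt_top_iff_of_pos hq0).1 hy
  refine ⟨u, fun A hA => ⟨hum.aestronglyMeasurable, ?_⟩, fun h => ?_⟩
  · rw [eLpNorm_lt_top_iff_lintegral_rpow_enorm_lt_top h0 hp]
    refine (lintegral_mono fun y => ?_).trans_lt (hbound A hA)
    exact ENNReal.rpow_le_rpow (enorm_integral_le_lintegral_enorm _) hq0.le
  · have h1 : ∀ᵐ z ∂(μ.prod μ), f (z.1 * h, z.2) = f z + f (h, z.2 * z.1) := by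
      have hms : MeasurableSet {z : G × G | f (z.1 * h, z.2) = f z + f (h, z.2 * z.1)} :=
        measurableSet_eq_fun
          (hf.comp ((measurable_fst.mul_const h).prodMk measurable_snd))
          (hf.add (hf.comp (measurable_const.prodMk (measurable_snd.mul measurable_fst))))
      rw [ae_prod_iff_ae_ae hms]
      refine Eventually.of_forall fun g => ?_
      filter_upwards [hmul g h, hfF (g * h), hfF g,
        (quasiMeasurePreserving_mul_right' μ g).ae (hfF h)] with x e1 e2 e3 e4
      rw [e2, e1, e3, e4]
    -- This is the cocycle identity at `g = x⁻¹ y`; averaging it over `x` gives `u (y h) = u y + F h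
    -- y`.
    have h2 : ∀ᵐ x ∂μ, ∀ᵐ y ∂μ, D (x, y * h) = D (x, y) + f (h, y) := by
      filter_upwards [ae_ae_of_ae_prod (ae_swap h1)] with x hx
      have := (measurePreserving_mul_left μ x⁻¹).quasiMeasurePreserving.ae hx
      filter_upwards [this] with y hy
      simpa [D, mul_assoc] using hy
    have hms : MeasurableSet {z : G × G | D (z.1, z.2 * h) = D (z.1, z.2) + f (h, z.2)} :=
      measurableSet_eq_fun
        (hD.comp (measurable_fst.prodMk (measurable_snd.mul_const h)))
        (hD.add (hf.comp (measurable_const.prodMk measurable_snd)))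
    have h3 := (ae_ae_comm hms).1 h2
    filter_upwards [h3, hint, hfF h] with y hy hy' hy''
    have e : u (y * h) = ∫ x, (D (x, y) + f (h, y)) ∂ν := integral_congr_ae (hνμ.ae_le hy)
    rw [← hy'', e, integral_add hy' (integrable_const _)]
    simp [u]

end Primitive

/-! ### Primitives of closed `L^p` forms -/

section WeakPrimitive

variable {E : Type*} [NormedAddCommGroup E] [NormedSpace ℝ E] [FiniteDimensional ℝ E]
  {G : Type*} [TopologicalSpace G] [ChartedSpace E G] [Group G] [LieGroup 𝓘(ℝ, E) ∞ G]
  [T2Space G] [IsTopologicalGroup G] [SecondCountableTopology G] [LocallyCompactSpace G]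
  [MeasurableSpace G] [BorelSpace G] {μ : Measure G} [μ.IsHaarMeasure]

theorem IsCocycle.expCurve' {p : ℝ≥0∞} {α : Lp (E →L[ℝ] ℝ) p μ} {F : G → Lp ℝ p μ}
    (hF : IsCocycle α F) (v : GroupLieAlgebra 𝓘(ℝ, E) G) (t : ℝ) :
    F (LpCohomology.expCurve v t) =ᵐ[μ]
      fun x => ∫ s in (0 : ℝ)..t, α (x * LpCohomology.expCurve v s) (v : E) := by
  have h2 := expCurve_smul v t 1
  rw [mul_one] at h2
  have h3 := hF.expCurve (t • v)
  rw [h2] at h3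
  filter_upwards [h3] with x hx
  rw [hx]
  have h4 := intervalIntegral.smul_integral_comp_mul_left (a := 0) (b := 1)
    (fun s => α (x * LpCohomology.expCurve v s) (v : E)) t
  rw [mul_zero, mul_one] at h4
  rw [← h4, ← intervalIntegral.integral_smul]
  refine intervalIntegral.integral_congr fun s _ => ?_
  simp only [expCurve_smul]
  exact map_smul (α (x * LpCohomology.expCurve v (t * s))) t (v : E)

theorem locallyIntegrable_of_memLp_restrict {p : ℝ≥0∞} (hp1 : 1 ≤ p) {u : G → ℝ}
    (hu : ∀ K, IsCompact K → MemLp u p (μ.restrict K)) : LocallyIntegrable u μ := by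
  rw [locallyIntegrable_iff]
  intro K hK
  have : IsFiniteMeasure (μ.restrict K) := ⟨by simpa using hK.measure_lt_top⟩
  exact (hu K hK).integrable hp1

/-- Closed `L^p` forms are differentials. -/
theorem IsCocycle.exists_primitive {p : ℝ≥0∞} [Fact (1 ≤ p)] (hp : p ≠ ⊤)
    {α : Lp (E →L[ℝ] ℝ) p μ} {F : G → Lp ℝ p μ} (hF : IsCocycle α F) :
    ∃ u : G → ℝ, (∀ K, IsCompact K → MemLp u p (μ.restrict K)) ∧ HasWeakDifferential μ u α ∧
      ∀ h, (fun x => u (x * h) - u x) =ᵐ[μ] F h := by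
  have hp1 : 1 ≤ p := Fact.out
  obtain ⟨u, hu, huF⟩ := exists_sub_ae_eq_of_cocycle hp (hF.continuous hp) hF.mul
  have hul := locallyIntegrable_of_memLp_restrict hp1 hu
  refine ⟨u, hu, ⟨hul, ?_⟩, huF⟩
  funext v φ
  exact weak_derivative_of_translate_sub μ hul
    ((memLp_form_apply μ (Lp.memLp α) (v : E)).locallyIntegrable hp1) v
    (fun t _ => (huF _).trans (hF.expCurve' v t)) φ

/-- Any primitive differs by a constant from the one built from the cocycle, and a constant affects
neither local `L^p` integrability nor the differences with translates. -/
theorem HasWeakDifferential.of_isCocycle [ConnectedSpace G] {p : ℝ≥0∞} [Fact (1 ≤ p)] (hp : p ≠ ⊤)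
    {α : Lp (E →L[ℝ] ℝ) p μ} {F : G → Lp ℝ p μ} (hF : IsCocycle α F) {u : G → ℝ}
    (hu : HasWeakDifferential μ u α) : (∀ K, IsCompact K → MemLp u p (μ.restrict K)) ∧
      ∀ h, (fun x => u (x * h) - u x) =ᵐ[μ] F h := by
  obtain ⟨w, hw, hw', hwF⟩ := hF.exists_primitive hp
  obtain ⟨c, hc⟩ := ae_const_of_distD_eq_zero (E := E) μ (hu.1.sub hw'.1) (by
    rw [distD_sub μ hu.1 hw'.1, hu.2, hw'.2, sub_self])
  have hc' : u =ᵐ[μ] w + fun _ => c := by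
    filter_upwards [hc] with x hx
    simp only [Pi.sub_apply] at hx
    simp [← hx]
  refine ⟨fun K hK => ?_, fun h => ?_⟩
  · have : IsFiniteMeasure (μ.restrict K) := ⟨by simpa using hK.measure_lt_top⟩
    exact (memLp_congr_ae (ae_restrict_of_ae hc')).2 ((hw K hK).add (memLp_const c))
  · filter_upwards [hwF h, hc', (quasiMeasurePreserving_mul_right' μ h).ae hc'] with x h1 h2 h3
    rw [h2, h3, ← h1]
    simp

end WeakPrimitive

/-! ### Boundary values along the contracting flow -/

section BoundaryValue

open Measure

variable {E : Type*} [NormedAddCommGroup E] [NormedSpace ℝ E] [FiniteDimensional ℝ E]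
  {G : Type*} [TopologicalSpace G] [ChartedSpace E G] [Group G] [LieGroup 𝓘(ℝ, E) ∞ G]
  [T2Space G] [IsTopologicalGroup G] [SecondCountableTopology G] [LocallyCompactSpace G]
  [MeasurableSpace G] [BorelSpace G] {μ : Measure G} [μ.IsHaarMeasure]
  {ξ : GroupLieAlgebra 𝓘(ℝ, E) G} {p : ℝ≥0∞}

/-- The integral of `h` along the half-line `s ↦ x exp (s ξ)`. -/
def tailIntegral (ξ : GroupLieAlgebra 𝓘(ℝ, E) G) (h : G → ℝ) (x : G) : ℝ :=
  ∫ s in Set.Ioi (0 : ℝ), h (x * expCurve ξ s)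

theorem exists_lintegral_tail_le (hξ : 0 < divergence μ ξ) {q : ℝ} (hq : 1 ≤ q) :
    ∃ C : ℝ≥0∞, C ≠ ⊤ ∧ ∀ h : G → ℝ, AEStronglyMeasurable h μ →
      ∫⁻ x, (∫⁻ s in Set.Ioi (0 : ℝ), ‖h (x * expCurve ξ s)‖ₑ) ^ q ∂μ ≤
        C * ∫⁻ x, ‖h x‖ₑ ^ q ∂μ := by
  set τ := divergence μ ξ with hτ
  have hq0 : 0 < q := by linarith
  -- `ρ` is the density of the exponential law of rate `a` and `k` is its reciprocal. With `a = τ /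
  -- q`, the growth `exp (τ s)` of `k ^ q` cancels the modular factor `exp (-τ s)`, and the constant
  -- is the finite number `a⁻¹ ^ q`.
  set a := τ / q with ha
  have ha0 : 0 < a := by positivity
  let ρ : ℝ → ℝ≥0∞ := fun s => ENNReal.ofReal (a * Real.exp (-a * s))
  let k : ℝ → ℝ≥0∞ := fun s => ENNReal.ofReal (Real.exp (a * s) / a)
  have hρ : Measurable ρ := by fun_prop
  have hk : Measurable k := by fun_prop
  let ν : Measure ℝ := (volume.restrict (Set.Ioi 0)).withDensity ρ
  have hν : IsProbabilityMeasure ν := by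
    refine ⟨?_⟩
    rw [withDensity_apply _ MeasurableSet.univ, Measure.restrict_univ,
      ← ofReal_integral_eq_lintegral_ofReal ((integrableOn_exp_mul_Ioi (by linarith) 0).const_mul a)
        (Eventually.of_forall fun s => by positivity), integral_const_mul,
      integral_exp_mul_Ioi (by linarith) 0]
    simp [ha0.ne']
  have hconv (g : ℝ → ℝ≥0∞) : ∫⁻ s, g s ∂ν = ∫⁻ s in Set.Ioi (0 : ℝ), ρ s * g s :=
    lintegral_withDensity_eq_lintegral_mul_non_measurable _ hρ
      (Eventually.of_forall fun s => ENNReal.ofReal_lt_top) g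
  have hρk (s : ℝ) : ρ s * k s = 1 := by
    simp only [ρ, k]
    rw [← ENNReal.ofReal_mul (by positivity), mul_div_assoc', mul_assoc, ← Real.exp_add]
    simp [ha0.ne']
  refine ⟨∫⁻ s, k s ^ q * (modularCharacterFun (expCurve ξ s) : ℝ≥0∞) ∂ν, ?_, fun h hh => ?_⟩
  · rw [hconv]
    have e : ∀ s, ρ s * (k s ^ q * (modularCharacterFun (expCurve ξ s) : ℝ≥0∞)) =
        ENNReal.ofReal (a * a⁻¹ ^ q * Real.exp (-a * s)) := by
      intro s
      simp only [ρ, k]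
      rw [← ENNReal.ofReal_coe_nnreal, modularCharacterFun_expCurve μ,
        ENNReal.ofReal_rpow_of_nonneg (by positivity) hq0.le, ← ENNReal.ofReal_mul (by positivity),
        ← ENNReal.ofReal_mul (by positivity), div_eq_mul_inv,
        Real.mul_rpow (by positivity) (by positivity), ← Real.exp_mul]
      congr 1
      have : a * s * q = τ * s := by rw [ha]; field_simp
      rw [this, ← hτ, Real.exp_neg (τ * s)]
      have := (Real.exp_pos (τ * s)).ne'
      field_simp
    simp only [e]
    rw [← ofReal_integral_eq_lintegral_ofReal
      ((integrableOn_exp_mul_Ioi (by linarith) 0).const_mul _)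
      (Eventually.of_forall fun s => by positivity)]
    exact ENNReal.ofReal_ne_top
  · refine le_trans (le_of_eq ?_)
      (lintegral_rpow_translate_le (ν := ν) μ (continuous_expCurve ξ) hh hk hq)
    refine lintegral_congr fun x => ?_
    rw [hconv]
    simp only [← mul_assoc, hρk, one_mul]

theorem exists_eLpNorm_tailIntegral_le [Fact (1 ≤ p)] (hp : p ≠ ⊤) (hξ : 0 < divergence μ ξ) :
    ∃ C : ℝ≥0∞, C ≠ ⊤ ∧ ∀ h : G → ℝ, MemLp h p μ →
      (∀ᵐ x ∂μ, IntegrableOn (fun s => h (x * expCurve ξ s)) (Set.Ioi 0)) ∧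
      AEStronglyMeasurable (tailIntegral ξ h) μ ∧
      eLpNorm (tailIntegral ξ h) p μ ≤ C * eLpNorm h p μ := by
  have hp1 : 1 ≤ p := Fact.out
  have h0 : p ≠ 0 := (zero_lt_one.trans_le hp1).ne'
  have hq0 := ENNReal.toReal_pos h0 hp
  have hq : 1 ≤ p.toReal := by simpa using ENNReal.toReal_mono hp hp1
  obtain ⟨C, hC, hCb⟩ := exists_lintegral_tail_le (μ := μ) hξ hq
  refine ⟨C ^ p.toReal⁻¹, ENNReal.rpow_ne_top_of_nonneg (by positivity) hC, fun h hh => ?_⟩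
  have hm := aestronglyMeasurable_mul_curve (ν := volume.restrict (Set.Ioi (0 : ℝ))) μ
    (continuous_expCurve ξ) hh.1
  have hb := hCb h hh.1
  have hfin : C * ∫⁻ x, ‖h x‖ₑ ^ p.toReal ∂μ < ⊤ := by
    rw [← eLpNorm_rpow_toReal h0 hp]
    exact ENNReal.mul_lt_top hC.lt_top (ENNReal.rpow_lt_top_of_nonneg hq0.le hh.2.ne)
  refine ⟨?_, hm.prod_swap.integral_prod_right', ?_⟩
  · have hm2 : AEMeasurable (fun x => (∫⁻ s in Set.Ioi (0 : ℝ), ‖h (x * expCurve ξ s)‖ₑ) ^ p.toReal)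
        μ := hm.prod_swap.enorm.lintegral_prod_right'.pow_const _
    filter_upwards [ae_lt_top' hm2 (hb.trans_lt hfin).ne, hm.prod_swap.prodMk_left] with x hx hx'
    exact ⟨hx', (ENNReal.rpow_lt_top_iff_of_pos hq0).1 hx⟩
  · rw [← ENNReal.rpow_le_rpow_iff hq0, ENNReal.mul_rpow_of_nonneg _ _ hq0.le, ← ENNReal.rpow_mul,
      inv_mul_cancel₀ hq0.ne', ENNReal.rpow_one, eLpNorm_rpow_toReal h0 hp,
      eLpNorm_rpow_toReal h0 hp]
    refine le_trans (lintegral_mono fun x => ?_) hb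
    exact ENNReal.rpow_le_rpow (enorm_integral_le_lintegral_enorm _) hq0.le

theorem memLp_tailIntegral [Fact (1 ≤ p)] (hp : p ≠ ⊤) (hξ : 0 < divergence μ ξ) {h : G → ℝ}
    (hh : MemLp h p μ) : MemLp (tailIntegral ξ h) p μ := by
  obtain ⟨C, hC, hCb⟩ := exists_eLpNorm_tailIntegral_le (μ := μ) hp hξ
  exact ⟨(hCb h hh).2.1, (hCb h hh).2.2.trans_lt (ENNReal.mul_lt_top hC.lt_top hh.2)⟩

theorem ae_integrableOn_tail [Fact (1 ≤ p)] (hp : p ≠ ⊤) (hξ : 0 < divergence μ ξ) {h : G → ℝ}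
    (hh : MemLp h p μ) :
    ∀ᵐ x ∂μ, IntegrableOn (fun s => h (x * expCurve ξ s)) (Set.Ioi 0) := by
  obtain ⟨C, hC, hCb⟩ := exists_eLpNorm_tailIntegral_le (μ := μ) hp hξ
  exact (hCb h hh).1

theorem tailIntegral_mul_expCurve {h : G → ℝ} {x : G}
    (hx : IntegrableOn (fun s => h (x * expCurve ξ s)) (Set.Ioi 0)) {t : ℝ} (ht : 0 ≤ t) :
    tailIntegral ξ h (x * expCurve ξ t) =
      tailIntegral ξ h x - ∫ s in (0 : ℝ)..t, h (x * expCurve ξ s) := by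
  have e := (measurePreserving_add_left (volume : Measure ℝ) t).setIntegral_preimage_emb
    (MeasurableEquiv.addLeft t).measurableEmbedding (fun s => h (x * expCurve ξ s)) (Set.Ioi t)
  have e2 : (fun s : ℝ => t + s) ⁻¹' Set.Ioi t = Set.Ioi 0 := by ext; simp
  have e3 : tailIntegral ξ h (x * expCurve ξ t) = ∫ s in Set.Ioi t, h (x * expCurve ξ s) := by
    rw [← e, e2]
    simp only [tailIntegral, expCurve_add, mul_assoc]
  rw [e3, ← intervalIntegral.integral_Ioi_sub_Ioi hx ht, tailIntegral]
  ring

theorem tendsto_modularCharacterFun (hξ : 0 < divergence μ ξ) :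
    Tendsto (fun t : ℝ => (modularCharacterFun (expCurve ξ t) : ℝ≥0∞)) atTop (𝓝 0) := by
  have h1 : Tendsto (fun t : ℝ => Real.exp (-(divergence μ ξ * t))) atTop (𝓝 0) :=
    Real.tendsto_exp_neg_atTop_nhds_zero.comp (tendsto_id.const_mul_atTop hξ)
  have h2 := ENNReal.tendsto_ofReal h1
  rw [ENNReal.ofReal_zero] at h2
  refine h2.congr fun t => ?_
  rw [← modularCharacterFun_expCurve μ, ENNReal.ofReal_coe_nnreal]

/-- The `L^p` norm is multiplied by the power `1 / p` of the modular function, which decays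
exponentially since the divergence is positive. -/
theorem tendsto_eLpNorm_mul_right [Fact (1 ≤ p)] (hp : p ≠ ⊤) (hξ : 0 < divergence μ ξ) {h : G → ℝ}
    (hh : MemLp h p μ) :
    Tendsto (fun t : ℝ => eLpNorm (fun x => h (x * expCurve ξ t)) p μ) atTop (𝓝 0) := by
  have hp1 : 1 ≤ p := Fact.out
  have hq0 := ENNReal.toReal_pos (zero_lt_one.trans_le hp1).ne' hp
  simp only [eLpNorm_mul_right μ hp]
  have hq1 : 0 < (1 / p).toReal := by rw [ENNReal.toReal_div]; simpa using hq0
  have h1 := ENNReal.Tendsto.mul_const ((ENNReal.continuous_rpow_const (y := (1 / p).toReal)).tendsto 0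
    |>.comp (tendsto_modularCharacterFun hξ)) (Or.inr hh.2.ne)
  simpa [ENNReal.zero_rpow_of_pos hq1, Function.comp_def, hq0] using h1

variable [Fact (1 ≤ p)]

theorem HasWeakDifferential.translate_sub {u : G → ℝ} {α : Lp (E →L[ℝ] ℝ) p μ}
    (hu : HasWeakDifferential μ u α) (v : GroupLieAlgebra 𝓘(ℝ, E) G) {t : ℝ} (ht : 0 ≤ t) :
    (fun x => u (x * expCurve v t) - u x) =ᵐ[μ]
      fun x => ∫ s in (0 : ℝ)..t, α (x * expCurve v s) (v : E) :=
  translate_sub_ae_eq μ hu.1 ((memLp_form_apply μ (Lp.memLp α) (v : E)).locallyIntegrable Fact.out) v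
    (fun φ => congrFun (congrFun hu.2 v) φ) ht

/-- The boundary value of a function with `L^p` gradient. -/
def boundaryValue (ξ : GroupLieAlgebra 𝓘(ℝ, E) G) (u : G → ℝ) (α : G → (E →L[ℝ] ℝ)) : G → ℝ :=
  fun x => u x + tailIntegral ξ (fun x => α x (ξ : E)) x

/-- What remains between time `t` and the boundary is the tail integral started at `x exp (t ξ)`: a
translate of a fixed `L^p` function, so it tends to zero in norm. -/
theorem translate_sub_boundaryValue (hp : p ≠ ⊤) (hξ : 0 < divergence μ ξ) {u : G → ℝ}
    {α : Lp (E →L[ℝ] ℝ) p μ} (hu : HasWeakDifferential μ u α) {t : ℝ} (ht : 0 ≤ t) :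
    (fun x => u (x * expCurve ξ t) - boundaryValue ξ u α x) =ᵐ[μ]
      fun x => -tailIntegral ξ (fun x => α x (ξ : E)) (x * expCurve ξ t) := by
  filter_upwards [hu.translate_sub ξ ht,
    ae_integrableOn_tail hp hξ (memLp_form_apply μ (Lp.memLp α) (ξ : E))] with x hx hx'
  rw [tailIntegral_mul_expCurve hx' ht, ← hx, boundaryValue]
  ring

theorem isBoundaryValue_boundaryValue (hp : p ≠ ⊤) (hξ : 0 < divergence μ ξ) {u : G → ℝ}
    {α : Lp (E →L[ℝ] ℝ) p μ} (hu : HasWeakDifferential μ u α) :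
    IsBoundaryValue μ p ξ u (boundaryValue ξ u α) := by
  have hH := memLp_tailIntegral hp hξ (memLp_form_apply μ (Lp.memLp α) (ξ : E))
  refine ⟨hu.1.aestronglyMeasurable.add hH.1, ?_⟩
  refine (tendsto_eLpNorm_mul_right hp hξ hH).congr' ?_
  filter_upwards [eventually_ge_atTop 0] with t ht
  rw [eLpNorm_congr_ae (translate_sub_boundaryValue hp hξ hu ht)]
  exact (eLpNorm_neg (fun x => tailIntegral ξ (fun x => α x (ξ : E)) (x * expCurve ξ t)) p μ).symm

theorem IsBoundaryValue.ae_eq {u v v' : G → ℝ} (hu : AEStronglyMeasurable u μ)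
    (h : IsBoundaryValue μ p ξ u v) (h' : IsBoundaryValue μ p ξ u v') : v' =ᵐ[μ] v := by
  have hp1 : 1 ≤ p := Fact.out
  have hm (t : ℝ) : AEStronglyMeasurable (fun x => u (x * expCurve ξ t)) μ :=
    hu.comp_quasiMeasurePreserving (quasiMeasurePreserving_mul_right' μ _)
  have hb : ∀ t : ℝ, eLpNorm (v' - v) p μ ≤ eLpNorm (fun x => u (x * expCurve ξ t) - v x) p μ +
      eLpNorm (fun x => u (x * expCurve ξ t) - v' x) p μ := fun t => by
    have e : v' - v = (fun x => u (x * expCurve ξ t) - v x) -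
        (fun x => u (x * expCurve ξ t) - v' x) := by
      funext x
      simp
    rw [e]
    exact eLpNorm_sub_le ((hm t).sub h.1) ((hm t).sub h'.1) hp1
  have hl := h.2.add h'.2
  rw [add_zero] at hl
  have h0 : eLpNorm (v' - v) p μ = 0 := le_antisymm (ge_of_tendsto' hl hb) bot_le
  rw [eLpNorm_eq_zero_iff (h'.1.sub h.1) (zero_lt_one.trans_le hp1).ne'] at h0
  filter_upwards [h0] with x hx
  exact sub_eq_zero.1 hx

theorem ae_invariant_of_nonneg {w : G → ℝ}
    (h : ∀ t : ℝ, 0 ≤ t → (fun x => w (x * expCurve ξ t)) =ᵐ[μ] w) (t : ℝ) :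
    (fun x => w (x * expCurve ξ t)) =ᵐ[μ] w := by
  rcases le_total 0 t with ht | ht
  · exact h t ht
  · have h1 := (quasiMeasurePreserving_mul_right' μ (expCurve ξ t)).ae (h (-t) (by linarith))
    filter_upwards [h1] with x hx
    rw [mul_assoc, ← expCurve_add, add_neg_cancel, expCurve_zero, mul_one] at hx
    exact hx.symm

theorem boundaryValue_invariant (hp : p ≠ ⊤) (hξ : 0 < divergence μ ξ) {u : G → ℝ}
    {α : Lp (E →L[ℝ] ℝ) p μ} (hu : HasWeakDifferential μ u α) (t : ℝ) :
    (fun x => boundaryValue ξ u α (x * expCurve ξ t)) =ᵐ[μ] boundaryValue ξ u α := by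
  refine ae_invariant_of_nonneg (fun t ht => ?_) t
  filter_upwards [translate_sub_boundaryValue hp hξ hu ht] with x hx
  have : boundaryValue ξ u α (x * expCurve ξ t) = u (x * expCurve ξ t) +
    tailIntegral ξ (fun x => α x (ξ : E)) (x * expCurve ξ t) := rfl
  rw [this]
  linarith

/-- An almost everywhere invariant function agrees almost everywhere with an invariant one. -/
theorem exists_invariant_ae_eq {v : G → ℝ} (hv : AEStronglyMeasurable v μ)
    (h : ∀ t : ℝ, (fun x => v (x * expCurve ξ t)) =ᵐ[μ] v) :
    ∃ w : G → ℝ, w =ᵐ[μ] v ∧ ∀ x t, w (x * expCurve ξ t) = w x := by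
  classical
  -- The new value at `x` is the almost everywhere constant value of `v` on the orbit of `x`, if
  -- there is one. Translation invariance of Lebesgue measure makes this independent of the point of
  -- the orbit.
  let P : G → ℝ → Prop := fun x c => ∀ᵐ t : ℝ, v (x * expCurve ξ t) = c
  have hP : ∀ x c c', P x c → P x c' → c = c' := fun x c c' h1 h2 => by
    obtain ⟨t, ht, ht'⟩ := (h1.and h2).exists
    exact ht.symm.trans ht'
  have hPt : ∀ x s c, P x c → P (x * expCurve ξ s) c := fun x s c h1 => by
    have := (measurePreserving_add_left (volume : Measure ℝ) s).quasiMeasurePreserving.ae h1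
    filter_upwards [this] with t ht
    rw [← ht, expCurve_add, mul_assoc]
  have hPt' : ∀ x s c, P (x * expCurve ξ s) c ↔ P x c := fun x s c => by
    refine ⟨fun h1 => ?_, hPt x s c⟩
    have := hPt _ (-s) c h1
    rwa [mul_assoc, ← expCurve_add, add_neg_cancel, expCurve_zero, mul_one] at this
  refine ⟨fun x => if hx : ∃ c, P x c then hx.choose else 0, ?_, fun x t => ?_⟩
  · have hm := aestronglyMeasurable_mul_curve (ν := (volume : Measure ℝ)) μ (continuous_expCurve ξ) hv
    have h2 : AEStronglyMeasurable (fun q : ℝ × G => v q.2) ((volume : Measure ℝ).prod μ) :=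
      hv.comp_snd
    have h3 := ae_prod_of_ae_ae (nullMeasurableSet_eq_fun hm.aemeasurable h2.aemeasurable)
      (Eventually.of_forall fun t => h t)
    have h4 := ae_ae_of_ae_prod (ae_swap h3)
    filter_upwards [h4] with x hx
    have hex : ∃ c, P x c := ⟨v x, hx⟩
    simp only [dif_pos hex]
    exact hP x _ _ hex.choose_spec hx
  · by_cases hx : ∃ c, P x c
    · have hx' : ∃ c, P (x * expCurve ξ t) c := hx.imp fun c => (hPt' x t c).2
      simp only [dif_pos hx, dif_pos hx']
      exact hP x _ _ ((hPt' x t _).1 hx'.choose_spec) hx.choose_spec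
    · have hx' : ¬∃ c, P (x * expCurve ξ t) c := fun h => hx (h.imp fun c => (hPt' x t c).1)
      simp only [dif_neg hx, dif_neg hx']

/-- The representative is `w` minus the tail integral, with `w` a strictly invariant version of the
boundary value: along almost every orbit `w` is constant and the tail integral tends to zero. -/
theorem exists_ae_eq_tendsto (hp : p ≠ ⊤) (hξ : 0 < divergence μ ξ) {u : G → ℝ}
    {α : Lp (E →L[ℝ] ℝ) p μ} (hu : HasWeakDifferential μ u α) :
    ∃ u' : G → ℝ, u' =ᵐ[μ] u ∧ ∀ᵐ x ∂μ,
      Tendsto (fun t : ℝ => u' (x * expCurve ξ t)) atTop (𝓝 (boundaryValue ξ u α x)) := by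
  obtain ⟨w, hw, hw'⟩ := exists_invariant_ae_eq (isBoundaryValue_boundaryValue hp hξ hu).1
    (boundaryValue_invariant hp hξ hu)
  refine ⟨fun x => w x - tailIntegral ξ (fun x => α x (ξ : E)) x, ?_, ?_⟩
  · filter_upwards [hw] with x hx
    rw [hx, boundaryValue]
    ring
  · filter_upwards [hw, ae_integrableOn_tail hp hξ (memLp_form_apply μ (Lp.memLp α) (ξ : E))]
      with x hx hx'
    have h1 := intervalIntegral_tendsto_integral_Ioi 0 hx' tendsto_id
    have h2 := (h1.const_sub (tailIntegral ξ (fun x => α x (ξ : E)) x)).const_sub (w x)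
    have h3 : w x - (tailIntegral ξ (fun x => α x (ξ : E)) x -
        ∫ s in Set.Ioi (0 : ℝ), α (x * expCurve ξ s) (ξ : E)) = boundaryValue ξ u α x := by
      rw [tailIntegral, sub_self, sub_zero, hx]
    rw [h3] at h2
    refine h2.congr' ?_
    filter_upwards [eventually_ge_atTop 0] with t ht
    rw [tailIntegral_mul_expCurve hx' ht, hw']
    rfl

end BoundaryValue

/-! ### The unit ball of the left-invariant length metric -/

section UnitBall

variable {E : Type*} [NormedAddCommGroup E] [NormedSpace ℝ E] [FiniteDimensional ℝ E]
  {G : Type*} [TopologicalSpace G] [ChartedSpace E G] [Group G] [LieGroup 𝓘(ℝ, E) ∞ G]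
  [T2Space G] [IsTopologicalGroup G]

variable (E) in
/-- The Maurer–Cartan form, which translates a tangent vector at `x` to the identity. -/
def maurerCartan (x : G) : E →L[ℝ] E := mfderiv 𝓘(ℝ, E) 𝓘(ℝ, E) (fun y : G => x⁻¹ * y) x

/-- The form is a partial tangent map of `(x, y) ↦ x⁻¹ y` on the diagonal. Its values lie over `1`,
where a fixed trivialization reads them as elements of `E`. -/
theorem continuous_maurerCartan :
    Continuous (fun z : TangentBundle 𝓘(ℝ, E) G => maurerCartan E z.1 (z.2 : E)) := by
  let fg : TangentBundle 𝓘(ℝ, E) G → TangentBundle 𝓘(ℝ, E) G := fun z => TotalSpace.mk' E z.1 0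
  have sfg : Continuous fg :=
    (contMDiff_zeroSection (n := 1) ℝ (TangentSpace 𝓘(ℝ, E) : G → Type _) (IB := 𝓘(ℝ, E))
      (F := E)).continuous.comp (FiberBundle.continuous_proj E _)
  let F₁ : TangentBundle 𝓘(ℝ, E) G → (TangentBundle 𝓘(ℝ, E) G × TangentBundle 𝓘(ℝ, E) G) :=
    fun z => (fg z, z)
  have S₁ : Continuous F₁ := sfg.prodMk continuous_id
  let F₂ : (TangentBundle 𝓘(ℝ, E) G × TangentBundle 𝓘(ℝ, E) G) →
      TangentBundle (𝓘(ℝ, E).prod 𝓘(ℝ, E)) (G × G) :=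
    (equivTangentBundleProd 𝓘(ℝ, E) G 𝓘(ℝ, E) G).symm
  have S₂' : ContMDiff (𝓘(ℝ, E).tangent.prod 𝓘(ℝ, E).tangent)
      (𝓘(ℝ, E).prod 𝓘(ℝ, E)).tangent ∞ F₂ := contMDiff_equivTangentBundleProd_symm
  have S₂ : Continuous F₂ := S₂'.continuous
  have hc : ContMDiff (𝓘(ℝ, E).prod 𝓘(ℝ, E)) 𝓘(ℝ, E) ∞ (fun p : G × G => p.1⁻¹ * p.2) :=
    contMDiff_fst.inv.mul contMDiff_snd
  let F₃ : TangentBundle (𝓘(ℝ, E).prod 𝓘(ℝ, E)) (G × G) → TangentBundle 𝓘(ℝ, E) G :=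
    tangentMap (𝓘(ℝ, E).prod 𝓘(ℝ, E)) 𝓘(ℝ, E) (fun (p : G × G) => p.1⁻¹ * p.2)
  have S₃' : ContMDiff (𝓘(ℝ, E).prod 𝓘(ℝ, E)).tangent 𝓘(ℝ, E).tangent ∞ F₃ :=
    ContMDiff.contMDiff_tangentMap hc (m := ∞) (by simp)
  have S₃ : Continuous F₃ := S₃'.continuous
  have S : Continuous ((F₃ ∘ F₂) ∘ F₁) := (S₃.comp S₂).comp S₁
  have hbase : ∀ z, ((F₃ ∘ F₂) ∘ F₁) z =
      (⟨z.1⁻¹ * z.1, maurerCartan E z.1 (z.2 : E)⟩ : TangentBundle 𝓘(ℝ, E) G) := by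
    intro z
    have aux : ∀ (x : G) (w : E), (mfderiv (𝓘(ℝ, E).prod 𝓘(ℝ, E)) 𝓘(ℝ, E)
        (fun p : G × G => p.1⁻¹ * p.2) (x, x) ((0 : E), w) : E) = maurerCartan E x w := fun x w => by
      refine (mfderiv_prod_eq_add_apply (v := ((0 : E), w))
        (hc.mdifferentiableAt (x := (x, x)) (by simp))).trans ?_
      exact (congrArg₂ (fun a b : E => a + b) (ContinuousLinearMap.map_zero
        (mfderiv 𝓘(ℝ, E) 𝓘(ℝ, E) (fun y : G => y⁻¹ * x) x)) rfl).trans (zero_add _)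
    exact congrArg (fun b : E => (⟨z.1⁻¹ * z.1, b⟩ : TangentBundle 𝓘(ℝ, E) G)) (aux z.1 z.2)
  have key : ∀ (y : G) (b : E), y = 1 → (trivializationAt E (TangentSpace 𝓘(ℝ, E) : G → Type _) 1
      (⟨y, b⟩ : TangentBundle 𝓘(ℝ, E) G)).2 = b := by
    rintro _ b rfl
    exact (tangentBundleCore 𝓘(ℝ, E) G).coordChange_self (achart E (1 : G)) 1
      (mem_chart_source E (1 : G)) b
  have hS : ∀ z, ((F₃ ∘ F₂) ∘ F₁) z ∈
      (trivializationAt E (TangentSpace 𝓘(ℝ, E) : G → Type _) 1).source := fun z => by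
    rw [hbase, Trivialization.mem_source]
    simp
  have h1 := continuous_snd.comp ((trivializationAt E
    (TangentSpace 𝓘(ℝ, E) : G → Type _) 1).continuousOn.comp_continuous S hS)
  refine h1.congr fun z => ?_
  simp only [Function.comp_apply]
  have h2 := hbase z
  simp only [Function.comp_apply] at h2
  rw [h2]
  exact key _ _ (inv_mul_cancel _)

/-- The velocity of a curve, translated to the identity. -/
def velocity (γ : ℝ → G) (t : ℝ) : E :=
  maurerCartan E (γ t) (mfderiv 𝓘(ℝ, ℝ) 𝓘(ℝ, E) γ t (1 : ℝ))

theorem continuous_velocity {γ : ℝ → G} (hγ : ContMDiff 𝓘(ℝ, ℝ) 𝓘(ℝ, E) 1 γ) :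
    Continuous (velocity γ : ℝ → E) := by
  have : IsManifold 𝓘(ℝ, E) 1 G := isManifold_one
  have h1 : Continuous fun t : ℝ => tangentMap 𝓘(ℝ, ℝ) 𝓘(ℝ, E) γ ⟨t, (1 : ℝ)⟩ :=
    (hγ.continuous_tangentMap le_rfl).comp
      ((tangentBundleModelSpaceHomeomorph 𝓘(ℝ, ℝ)).symm.continuous.comp
        (continuous_id.prodMk continuous_const))
  exact continuous_maurerCartan.comp h1

theorem mem_unitBall_iff {x : G} : x ∈ unitBall E G ↔ ∃ γ : ℝ → G, γ 0 = 1 ∧ γ 1 = x ∧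
    ContMDiff 𝓘(ℝ, ℝ) 𝓘(ℝ, E) 1 γ ∧
    ∫⁻ t in Set.Icc (0 : ℝ) 1, ‖(velocity γ t : E)‖ₑ < 1 := Iff.rfl

/-- For small `a` the curve `t ↦ Ψ (t a)` has speed less than `1 / 2` on `[0, 1]`, by compactness of
the interval, and its endpoints `Ψ a` fill a neighbourhood of `1`. -/
theorem unitBall_mem_nhds : unitBall E G ∈ 𝓝 (1 : G) := by
  have : IsManifold 𝓘(ℝ, E) 1 G := isManifold_one
  set Ψ : E → G := expProd G (List.finRange (Module.finrank ℝ E)) with hΨ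
  have hΨc : ContMDiff 𝓘(ℝ, E) 𝓘(ℝ, E) 1 Ψ := contMDiff_expProd _
  let W : ℝ × E → E := fun z => maurerCartan E (Ψ (z.1 • z.2))
    (mfderiv 𝓘(ℝ, E) 𝓘(ℝ, E) Ψ (z.1 • z.2) (z.2 : E))
  have hW : Continuous W := by
    have h1 : Continuous fun z : ℝ × E => tangentMap 𝓘(ℝ, E) 𝓘(ℝ, E) Ψ ⟨z.1 • z.2, (z.2 : E)⟩ :=
      (hΨc.continuous_tangentMap le_rfl).comp
        ((tangentBundleModelSpaceHomeomorph 𝓘(ℝ, E)).symm.continuous.comp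
          ((continuous_fst.smul continuous_snd).prodMk continuous_snd))
    exact continuous_maurerCartan.comp h1
  have hW0 : ∀ t, W (t, 0) = 0 := fun t => by
    have h1 : (mfderiv 𝓘(ℝ, E) 𝓘(ℝ, E) Ψ (t • (0 : E)) : E →L[ℝ] E) 0 = 0 := map_zero _
    exact (congrArg (maurerCartan E (Ψ (t • (0 : E)))) h1).trans (map_zero _)
  have hsmall : ∀ᶠ a in 𝓝 (0 : E), ∀ t ∈ Set.Icc (0 : ℝ) 1, ‖W (t, a)‖ < 1 / 2 := by
    refine isCompact_Icc.eventually_forall_of_forall_eventually fun t _ => ?_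
    have h1 : Tendsto (fun z : E × ℝ => ‖W (z.2, z.1)‖) (𝓝 (0, t)) (𝓝 0) := by
      have := (hW.comp (continuous_snd.prodMk continuous_fst)).norm.tendsto ((0 : E), t)
      simpa [hW0] using this
    exact h1.eventually (gt_mem_nhds (by norm_num))
  rw [← map_expProd_nhds (E := E), mem_map]
  filter_upwards [hsmall] with a ha
  refine mem_unitBall_iff.2 ⟨fun t => Ψ (t • a), ?_, ?_, ?_, ?_⟩
  · show Ψ ((0 : ℝ) • a) = 1
    rw [zero_smul]
    exact expProd_zero _
  · show Ψ ((1 : ℝ) • a) = Ψ a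
    rw [one_smul]
  · exact hΨc.comp (contDiff_id.smul contDiff_const).contMDiff
  · have hv : ∀ t, (velocity (fun t : ℝ => Ψ (t • a)) t : E) = W (t, a) := fun t => by
      have h1 : HasMFDerivAt 𝓘(ℝ, ℝ) 𝓘(ℝ, E) (fun s : ℝ => s • a) t
          ((1 : ℝ →L[ℝ] ℝ).smulRight a : ℝ →L[ℝ] E) :=
        ((hasFDerivAt_id (𝕜 := ℝ) t).smul_const a).hasMFDerivAt
      have h2 := ((hΨc.mdifferentiable one_ne_zero (t • a)).hasMFDerivAt.comp t h1).mfderiv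
      have h3 : (mfderiv 𝓘(ℝ, ℝ) 𝓘(ℝ, E) (fun t : ℝ => Ψ (t • a)) t : ℝ →L[ℝ] E) 1 =
          (mfderiv 𝓘(ℝ, E) 𝓘(ℝ, E) Ψ (t • a) : E →L[ℝ] E) a := by
        refine (congrArg (fun L : ℝ →L[ℝ] E => L 1) h2).trans ?_
        exact congrArg (mfderiv 𝓘(ℝ, E) 𝓘(ℝ, E) Ψ (t • a) : E →L[ℝ] E) (one_smul ℝ a)
      exact congrArg (maurerCartan E (Ψ (t • a))) h3
    calc ∫⁻ t in Set.Icc (0 : ℝ) 1, ‖(velocity (fun t : ℝ => Ψ (t • a)) t : E)‖ₑ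
        ≤ ∫⁻ t in Set.Icc (0 : ℝ) 1, ENNReal.ofReal (1 / 2) := by
          refine setLIntegral_mono measurable_const fun t ht => ?_
          rw [hv, ← ofReal_norm]
          exact ENNReal.ofReal_le_ofReal (ha t ht).le
      _ < 1 := by
          rw [setLIntegral_const, Real.volume_Icc]
          simp only [sub_zero, ENNReal.ofReal_one, mul_one]
          exact ENNReal.ofReal_lt_one.2 (by norm_num)

theorem hasDerivAt_testFunction_curve (f : TestFunction E G) {γ : ℝ → G}
    (hγ : ContMDiff 𝓘(ℝ, ℝ) 𝓘(ℝ, E) 1 γ) (g : G) (s : ℝ) :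
    HasDerivAt (fun s => f.1 (g * γ s))
      ((derivAlong (velocity γ s : E) f).1 (g * γ s)) s := by
  have d (h : G) : MDifferentiable 𝓘(ℝ, E) 𝓘(ℝ, E) (fun x : G => h * x) :=
    (contMDiff_mul_left (I := 𝓘(ℝ, E)) (n := ∞)).mdifferentiable (by simp)
  have h1 := (hγ.mdifferentiable one_ne_zero s).hasMFDerivAt
  have h2 := (mdifferentiable_testFunction f (g * γ s)).hasMFDerivAt.comp s
    ((d g (γ s)).hasMFDerivAt.comp s h1)
  rw [hasMFDerivAt_iff_hasFDerivAt] at h2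
  have h3 : HasDerivAt (fun s => f.1 (g * γ s)) _ s := HasFDerivAt.hasDerivAt h2
  refine h3.congr_deriv ?_
  have e : (fun x : G => g * x) = (fun x : G => (g * γ s) * x) ∘ fun x : G => (γ s)⁻¹ * x := by
    funext x
    simp [mul_assoc]
  have h4 : (mfderiv 𝓘(ℝ, E) 𝓘(ℝ, E) (fun x : G => g * x) (γ s) : E →L[ℝ] E) =
      (mfderiv 𝓘(ℝ, E) 𝓘(ℝ, E) (fun x : G => (g * γ s) * x) ((γ s)⁻¹ * γ s) : E →L[ℝ] E) ∘L
        maurerCartan E (γ s) := by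
    rw [e]
    exact mfderiv_comp (γ s) (d _ _) (d _ _)
  have h5 : ∀ h : G, h = 1 → (mfderiv 𝓘(ℝ, E) 𝓘(ℝ, E) (fun x : G => (g * γ s) * x) h : E →L[ℝ] E) =
      (mfderiv 𝓘(ℝ, E) 𝓘(ℝ, E) (fun x : G => (g * γ s) * x) 1 : E →L[ℝ] E) := by rintro _ rfl; rfl
  rw [h5 _ (inv_mul_cancel _)] at h4
  exact congrArg (fun L : E →L[ℝ] E => (mfderiv 𝓘(ℝ, E) 𝓘(ℝ, ℝ) f.1 (g * γ s) : E →L[ℝ] ℝ)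
    (L ((mfderiv 𝓘(ℝ, ℝ) 𝓘(ℝ, E) γ s : ℝ →L[ℝ] E) 1))) h4

/-- The derivative is linear in `w`, so bounds on a basis suffice. This makes a test function
Lipschitz for the left-invariant length. -/
theorem exists_derivAlong_bound (f : TestFunction E G) :
    ∃ M : ℝ, 0 < M ∧ ∀ (w : E) (x : G), |(derivAlong (w : GroupLieAlgebra 𝓘(ℝ, E) G) f).1 x| ≤ M * ‖w‖ := by
  let b := Module.finBasis ℝ E
  have hb (i) : ∃ C : ℝ, ∀ x, ‖(derivAlong (basisVec G i) f).1 x‖ ≤ C :=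
    (derivAlong (basisVec G i) f).2.2.exists_bound_of_continuous (continuous_testFunction _)
  choose C hC using hb
  let N : Fin (Module.finrank ℝ E) → ℝ := fun i => ‖(b.coord i).toContinuousLinearMap‖
  have hlin (w : E) (x : G) : (derivAlong (w : GroupLieAlgebra 𝓘(ℝ, E) G) f).1 x =
      ∑ i, b.coord i w * (derivAlong (basisVec G i) f).1 x := by
    let L : E →ₗ[ℝ] ℝ :=
      { toFun := fun w => (derivAlong (w : GroupLieAlgebra 𝓘(ℝ, E) G) f).1 x
        map_add' := fun v w => congrArg (fun ψ : TestFunction E G => ψ.1 x) (derivAlong_add_left v w f)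
        map_smul' := fun c v => congrArg (fun ψ : TestFunction E G => ψ.1 x) (derivAlong_smul_left c v f) }
    calc L w = L (∑ i, b.repr w i • b i) := by rw [b.sum_repr]
      _ = _ := by simp only [map_sum, map_smul, smul_eq_mul, Module.Basis.coord_apply]; rfl
  have hC0 (i) : 0 ≤ C i := (norm_nonneg _).trans (hC i 1)
  refine ⟨∑ i, N i * C i + 1, add_pos_of_nonneg_of_pos
    (Finset.sum_nonneg fun i _ => mul_nonneg (norm_nonneg _) (hC0 i)) one_pos, fun w x => ?_⟩
  rw [hlin]
  refine (Finset.abs_sum_le_sum_abs _ _).trans ?_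
  rw [add_mul, Finset.sum_mul]
  refine le_add_of_le_of_nonneg (Finset.sum_le_sum fun i _ => ?_) (by positivity)
  rw [abs_mul]
  calc |b.coord i w| * |(derivAlong (basisVec G i) f).1 x| ≤ (N i * ‖w‖) * C i := by
        gcongr
        · exact (b.coord i).toContinuousLinearMap.le_opNorm w
        · exact hC i x
    _ = N i * C i * ‖w‖ := by ring

/-- Take a bump function equal to `1` at `1`, with compact support `S` and Lipschitz constant `M`.
Along a curve of length less than `1 / M`, its left translate to the starting point cannot drop to
zero, so the endpoint stays in the start times `S`. Induction on `n`, cutting off a last piece of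
length less than `1 / M`, confines curves of length less than `n / M` to a compact set. -/
theorem exists_isCompact_unitBall_subset :
    ∃ K : Set G, IsCompact K ∧ MeasurableSet[borel G] K ∧ unitBall E G ⊆ K := by
  have : IsManifold 𝓘(ℝ, E) ∞ G := inferInstance
  obtain ⟨β⟩ : Nonempty (SmoothBumpFunction 𝓘(ℝ, E) (1 : G)) := inferInstance
  let f : TestFunction E G := ⟨β, β.contMDiff, β.hasCompactSupport⟩
  have hf1 : f.1 1 = 1 := β.eq_one
  obtain ⟨M, hM, hMb⟩ := exists_derivAlong_bound f
  set S : Set G := tsupport f.1 with hS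
  have hSc : IsCompact S := f.2.2
  have hS1 : (1 : G) ∈ S := subset_tsupport _ (by rw [Function.mem_support, hf1]; exact one_ne_zero)
  have hpow : ∀ n : ℕ, ∃ K : Set G, IsCompact K ∧ ∀ γ : ℝ → G, γ 0 = 1 →
      ContMDiff 𝓘(ℝ, ℝ) 𝓘(ℝ, E) 1 γ → ∀ s, 0 ≤ s →
        ∫ r in (0 : ℝ)..s, ‖(velocity γ r : E)‖ < n / M → γ s ∈ K := by
    intro n
    induction n with
    | zero =>
      refine ⟨∅, isCompact_empty, fun γ _ _ s hs h => ?_⟩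
      have : 0 ≤ ∫ r in (0 : ℝ)..s, ‖(velocity γ r : E)‖ :=
        intervalIntegral.integral_nonneg hs fun r _ => norm_nonneg _
      simp at h
      linarith
    | succ n ih =>
      obtain ⟨K, hK, hKγ⟩ := ih
      refine ⟨S ∪ (fun z : G × G => z.1 * z.2) '' (K ×ˢ S),
        hSc.union ((hK.prod hSc).image continuous_mul), fun γ h0 hγ s hs h => ?_⟩
      have hvc : Continuous fun r => ‖(velocity γ r : E)‖ := (continuous_velocity hγ).norm
      have hii : ∀ a b, IntervalIntegrable (fun r => ‖(velocity γ r : E)‖) volume a b :=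
        fun a b => hvc.intervalIntegrable a b
      have step : ∀ a, a ≤ s → ∫ r in a..s, ‖(velocity γ r : E)‖ < 1 / M → (γ a)⁻¹ * γ s ∈ S := by
        intro a has hlt
        have hder := fun r => hasDerivAt_testFunction_curve f hγ (γ a)⁻¹ r
        have hdc : Continuous fun r => deriv (fun s => f.1 ((γ a)⁻¹ * γ s)) r := by
          have hcd : ContMDiff 𝓘(ℝ, ℝ) 𝓘(ℝ, ℝ) 1 (fun s => f.1 ((γ a)⁻¹ * γ s)) :=
            ((f.2.1.of_le (by exact_mod_cast le_top) : ContMDiff 𝓘(ℝ, E) 𝓘(ℝ, ℝ) 1 f.1)).comp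
              (((contMDiff_mul_left (I := 𝓘(ℝ, E)) (n := ∞) (a := (γ a)⁻¹)).of_le
                (by exact_mod_cast le_top) : ContMDiff 𝓘(ℝ, E) 𝓘(ℝ, E) 1 _).comp hγ)
          exact hcd.contDiff.continuous_deriv le_rfl
        have e : (fun r => deriv (fun s => f.1 ((γ a)⁻¹ * γ s)) r) = fun r =>
          (derivAlong (velocity γ r : E) f).1 ((γ a)⁻¹ * γ r) := funext fun r => (hder r).deriv
        rw [e] at hdc
        have hint := intervalIntegral.integral_eq_sub_of_hasDerivAt (a := a) (b := s)
          (fun r _ => hder r) (hdc.intervalIntegrable a s)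
        have hb : |f.1 ((γ a)⁻¹ * γ s) - f.1 ((γ a)⁻¹ * γ a)| < 1 := by
          rw [← hint]
          calc |∫ r in a..s, (derivAlong (velocity γ r : E) f).1 ((γ a)⁻¹ * γ r)|
              ≤ ∫ r in a..s, |(derivAlong (velocity γ r : E) f).1 ((γ a)⁻¹ * γ r)| :=
                intervalIntegral.abs_integral_le_integral_abs has
            _ ≤ ∫ r in a..s, M * ‖(velocity γ r : E)‖ := by
                refine intervalIntegral.integral_mono_on has
                  (hdc.abs.intervalIntegrable a s) ((hii a s).const_mul M) fun r _ => ?_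
                exact hMb _ _
            _ = M * ∫ r in a..s, ‖(velocity γ r : E)‖ := intervalIntegral.integral_const_mul _ _
            _ < M * (1 / M) := by gcongr
            _ = 1 := by field_simp
        refine subset_tsupport _ fun h0 => ?_
        rw [h0, inv_mul_cancel, hf1] at hb
        simp at hb
      by_cases hsmall : ∫ r in (0 : ℝ)..s, ‖(velocity γ r : E)‖ < 1 / M
      · left
        have := step 0 hs hsmall
        rwa [h0, inv_one, one_mul] at this
      · right
        push Not at hsmall
        have hcont : Continuous fun a => ∫ r in (0 : ℝ)..a, ‖(velocity γ r : E)‖ :=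
          intervalIntegral.continuous_primitive hii 0
        set T := ∫ r in (0 : ℝ)..s, ‖(velocity γ r : E)‖ with hT
        have hlt : T - 1 / M < n / M := by
          have : ((n + 1 : ℕ) : ℝ) / M = n / M + 1 / M := by push_cast; ring
          linarith
        -- The curve is cut where its length reaches `ℓ`: the first part is shorter than `n / M` and
        -- the rest shorter than `1 / M`. If `ℓ` exceeds the whole length, no cut is needed.
        obtain ⟨ℓ, hℓ1, hℓ2⟩ := exists_between hlt
        have hℓ0 : ℓ ∈ Set.Icc (∫ r in (0 : ℝ)..0, ‖(velocity γ r : E)‖) T ∨ T < ℓ := by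
          rw [intervalIntegral.integral_same]
          rcases lt_or_ge T ℓ with h | h
          · exact Or.inr h
          · exact Or.inl ⟨by linarith, h⟩
        rcases hℓ0 with hℓ0 | hℓ0
        · obtain ⟨a, ha, haℓ⟩ := intermediate_value_Icc hs hcont.continuousOn hℓ0
          simp only at haℓ
          refine ⟨(γ a, (γ a)⁻¹ * γ s), ⟨hKγ γ h0 hγ a ha.1 (by rw [haℓ]; exact hℓ2), ?_⟩, by simp⟩
          refine step a ha.2 ?_
          have := intervalIntegral.integral_add_adjacent_intervals (hii 0 a) (hii a s)
          rw [haℓ] at this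
          linarith
        · refine ⟨(γ s, 1), ⟨hKγ γ h0 hγ s hs (by linarith), hS1⟩, by simp⟩
  obtain ⟨n, hn⟩ := exists_nat_gt M
  obtain ⟨K, hK, hKγ⟩ := hpow n
  refine ⟨K, hK, ?_, ?_⟩
  · borelize G
    exact hK.measurableSet
  · rintro x hx
    obtain ⟨γ, h0, h1, hγ, hlen⟩ := mem_unitBall_iff.1 hx
    rw [← h1]
    refine hKγ γ h0 hγ 1 zero_le_one ?_
    have hvc : Continuous fun r => ‖(velocity γ r : E)‖ := (continuous_velocity hγ).norm
    have h2 : ∫ r in (0 : ℝ)..1, ‖(velocity γ r : E)‖ < 1 := by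
      rw [intervalIntegral.integral_of_le zero_le_one, ← integral_Icc_eq_integral_Ioc]
      have h3 := ofReal_integral_eq_lintegral_ofReal (μ := volume.restrict (Set.Icc (0 : ℝ) 1))
        (hvc.integrableOn_Icc) (Eventually.of_forall fun r => norm_nonneg _)
      simp only [ofReal_norm] at h3
      rw [← h3, ENNReal.ofReal_lt_one] at hlen
      exact hlen
    exact h2.trans ((one_lt_div hM).2 hn)

end UnitBall

/-! ### Oscillation on balls and differences with right translates -/

section Translates

open Measure
open scoped Pointwise

variable {G : Type*} [TopologicalSpace G] [Group G] [IsTopologicalGroup G] [T2Space G]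
  [SecondCountableTopology G] [LocallyCompactSpace G] [MeasurableSpace G] [BorelSpace G]
  {μ : Measure G} [μ.IsHaarMeasure] {p : ℝ≥0∞}

variable (μ p) in
/-- Locally `L^p` functions whose differences with their right translates are in `L^p`, locally
uniformly. -/
structure HasLpTranslates (u : G → ℝ) : Prop where
  memLp : ∀ K, IsCompact K → MemLp u p (μ.restrict K)
  bound : ∀ A : Set G, IsCompact A → ∃ C : ℝ≥0∞, C ≠ ⊤ ∧ ∀ h ∈ A,
    eLpNorm (fun x => u (x * h) - u x) p μ ≤ C

theorem HasLpTranslates.aestronglyMeasurable {u : G → ℝ} (hp1 : 1 ≤ p)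
    (hu : HasLpTranslates μ p u) : AEStronglyMeasurable u μ :=
  (locallyIntegrable_of_memLp_restrict hp1 hu.memLp).aestronglyMeasurable

theorem HasLpTranslates.add (hp1 : 1 ≤ p) {u w : G → ℝ} (hu : HasLpTranslates μ p u)
    (hw : HasLpTranslates μ p w) : HasLpTranslates μ p (u + w) := by
  refine ⟨fun K hK => (hu.memLp K hK).add (hw.memLp K hK), fun A hA => ?_⟩
  obtain ⟨C, hC, hCu⟩ := hu.bound A hA
  obtain ⟨D, hD, hDw⟩ := hw.bound A hA
  refine ⟨C + D, ENNReal.add_ne_top.2 ⟨hC, hD⟩, fun h hh => ?_⟩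
  have hm {f : G → ℝ} (hf : AEStronglyMeasurable f μ) :
      AEStronglyMeasurable (fun x => f (x * h) - f x) μ :=
    (hf.comp_quasiMeasurePreserving (quasiMeasurePreserving_mul_right' μ h)).sub hf
  have e : (fun x => (u + w) (x * h) - (u + w) x) =
      (fun x => u (x * h) - u x) + fun x => w (x * h) - w x := by
    funext x
    simp only [Pi.add_apply]
    ring
  rw [e]
  exact (eLpNorm_add_le (hm (hu.aestronglyMeasurable hp1)) (hm (hw.aestronglyMeasurable hp1))
    hp1).trans (add_le_add (hCu h hh) (hDw h hh))

theorem exists_modularCharacterFun_le {A : Set G} (hA : IsCompact A) :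
    ∃ C : ℝ≥0∞, C ≠ ⊤ ∧ ∀ h ∈ A, (modularCharacterFun h : ℝ≥0∞) ≤ C := by
  obtain ⟨C, hC⟩ := hA.bddAbove_image (continuous_modularCharacterFun (G := G)).continuousOn
  exact ⟨C, ENNReal.coe_ne_top, fun h hh => ENNReal.coe_le_coe.2 (hC ⟨h, hh, rfl⟩)⟩

theorem hasLpTranslates_of_memLp (hp1 : 1 ≤ p) (hp : p ≠ ⊤) {f : G → ℝ} (hf : MemLp f p μ) :
    HasLpTranslates μ p f := by
  refine ⟨fun K _ => hf.restrict K, fun A hA => ?_⟩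
  obtain ⟨C, hC, hCA⟩ := exists_modularCharacterFun_le hA
  refine ⟨C ^ (1 / p).toReal * eLpNorm f p μ + eLpNorm f p μ, ?_, fun h hh => ?_⟩
  · exact ENNReal.add_ne_top.2 ⟨ENNReal.mul_ne_top (ENNReal.rpow_ne_top_of_nonneg (by positivity) hC)
      hf.2.ne, hf.2.ne⟩
  · refine (eLpNorm_sub_le (f := fun x => f (x * h))
      (hf.1.comp_quasiMeasurePreserving (quasiMeasurePreserving_mul_right' μ h)) hf.1 hp1).trans ?_
    rw [eLpNorm_mul_right μ hp]
    gcongr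
    exact hCA h hh

set_option maxHeartbeats 1000000 in
/-- A form of the Poincaré inequality: oscillations on translates of a bounded set are controlled by
differences with right translates. -/
theorem HasLpTranslates.lintegral_iInf_lt_top [Fact (1 ≤ p)] (hp : p ≠ ⊤) {u : G → ℝ}
    (hu : HasLpTranslates μ p u) {K B : Set G} (hK : IsCompact K) (hK0 : μ K ≠ 0) (hB : B ⊆ K) :
    ∫⁻ g, (⨅ c : ℝ, eLpNorm (fun x => u x - c) p
      (μ.restrict ((fun x => g * x) '' B))) ^ p.toReal ∂μ < ⊤ := by
  have hp1 : 1 ≤ p := Fact.out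
  have h0 : p ≠ 0 := (zero_lt_one.trans_le hp1).ne'
  have hq0 := ENNReal.toReal_pos h0 hp
  have hum := hu.aestronglyMeasurable hp1
  set w := hum.mk u with hw
  have hwm : Measurable w := hum.stronglyMeasurable_mk.measurable
  have huw : u =ᵐ[μ] w := hum.ae_eq_mk
  -- `w (g z) - w (g y)` is the difference of `w` with its right translate by `y⁻¹ z`, taken at `g
  -- y`. For `y, z ∈ K` these elements fill a compact set.
  obtain ⟨C, hC, hCb⟩ := hu.bound ((fun z : G × G => z.1⁻¹ * z.2) '' (K ×ˢ K))
    ((hK.prod hK).image (continuous_fst.inv.mul continuous_snd))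
  obtain ⟨D, hD, hDb⟩ := exists_modularCharacterFun_le hK
  have hq : Measurable fun z : (G × G) × G => ‖w (z.2 * z.1.2) - w (z.2 * z.1.1)‖ₑ ^ p.toReal :=
    ((hwm.comp (measurable_snd.mul (measurable_snd.comp measurable_fst))).sub
      (hwm.comp (measurable_snd.mul (measurable_fst.comp measurable_fst)))).enorm.pow_const _
  -- pointwise bound
  have hpt (g : G) : (⨅ c : ℝ, eLpNorm (fun x => u x - c) p
      (μ.restrict ((fun x => g * x) '' B))) ^ p.toReal * μ K ≤
      ∫⁻ y in K, ∫⁻ z in K, ‖w (g * z) - w (g * y)‖ₑ ^ p.toReal ∂μ ∂μ := by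
    -- Every `w (g y)` with `y ∈ K` is a candidate for the constant in the infimum, so the bound can
    -- be integrated over `y`.
    rw [← setLIntegral_const]
    refine setLIntegral_mono' hK.measurableSet fun y _ => ?_
    calc (⨅ c : ℝ, eLpNorm (fun x => u x - c) p (μ.restrict ((fun x => g * x) '' B))) ^ p.toReal
        ≤ (eLpNorm (fun x => w x - w (g * y)) p (μ.restrict ((fun x => g * x) '' K))) ^ p.toReal := by
          gcongr
          refine (iInf_le _ (w (g * y))).trans ?_
          refine (eLpNorm_mono_measure _ (restrict_mono (Set.image_mono hB) le_rfl)).trans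
            (le_of_eq (eLpNorm_congr_ae (ae_restrict_of_ae ?_)))
          filter_upwards [huw] with x hx
          rw [hx]
      _ = ∫⁻ z in K, ‖w (g * z) - w (g * y)‖ₑ ^ p.toReal ∂μ := by
          have hgK : MeasurableSet ((fun x => g * x) '' K) :=
            (hK.image (continuous_const_mul g)).measurableSet
          rw [eLpNorm_rpow_toReal h0 hp, ← lintegral_indicator hgK,
            ← lintegral_indicator hK.measurableSet, ← lintegral_mul_left_eq_self _ g]
          refine lintegral_congr fun z => ?_
          by_cases hz : z ∈ K
          · simp [Set.indicator, hz]
          · simp [Set.indicator, hz]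
  have hgoal : (∫⁻ g, (⨅ c : ℝ, eLpNorm (fun x => u x - c) p
      (μ.restrict ((fun x => g * x) '' B))) ^ p.toReal ∂μ) * μ K < ⊤ := by
    calc (∫⁻ g, (⨅ c : ℝ, eLpNorm (fun x => u x - c) p
          (μ.restrict ((fun x => g * x) '' B))) ^ p.toReal ∂μ) * μ K
        = ∫⁻ g, (⨅ c : ℝ, eLpNorm (fun x => u x - c) p
          (μ.restrict ((fun x => g * x) '' B))) ^ p.toReal * μ K ∂μ :=
          (lintegral_mul_const' _ _ hK.measure_lt_top.ne).symm
      _ ≤ ∫⁻ g, ∫⁻ y in K, ∫⁻ z in K, ‖w (g * z) - w (g * y)‖ₑ ^ p.toReal ∂μ ∂μ ∂μ :=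
          lintegral_mono hpt
      _ = ∫⁻ g, ∫⁻ a, ‖w (g * a.2) - w (g * a.1)‖ₑ ^ p.toReal
            ∂((μ.restrict K).prod (μ.restrict K)) ∂μ := by
          refine lintegral_congr fun g => ?_
          have hg : Measurable fun a : G × G => ‖w (g * a.2) - w (g * a.1)‖ₑ ^ p.toReal :=
            hq.comp (measurable_id.prodMk measurable_const)
          exact (lintegral_prod _ hg.aemeasurable).symm
      _ = ∫⁻ a, ∫⁻ g, ‖w (g * a.2) - w (g * a.1)‖ₑ ^ p.toReal ∂μ
            ∂((μ.restrict K).prod (μ.restrict K)) :=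
          lintegral_lintegral_swap (hq.comp measurable_swap).aemeasurable
      _ ≤ ∫⁻ _, D * C ^ p.toReal ∂((μ.restrict K).prod (μ.restrict K)) := by
          rw [prod_restrict]
          refine setLIntegral_mono' (hK.measurableSet.prod hK.measurableSet) fun a ha => ?_
          have h1 := lintegral_mul_right μ
            (fun x => ‖w (x * (a.1⁻¹ * a.2)) - w x‖ₑ ^ p.toReal) a.1
          simp only [mul_assoc, mul_inv_cancel_left] at h1
          rw [h1]
          gcongr
          · exact hDb a.1 ha.1
          · have h2 : ∫⁻ x, ‖w (x * (a.1⁻¹ * a.2)) - w x‖ₑ ^ p.toReal ∂μ =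
                eLpNorm (fun x => u (x * (a.1⁻¹ * a.2)) - u x) p μ ^ p.toReal := by
              rw [eLpNorm_rpow_toReal h0 hp]
              refine lintegral_congr_ae ?_
              filter_upwards [huw, (quasiMeasurePreserving_mul_right' μ (a.1⁻¹ * a.2)).ae huw]
                with x hx hx'
              rw [hx, hx']
            rw [h2]
            gcongr
            exact hCb _ ⟨a, ha, rfl⟩
      _ < ⊤ := by
          rw [lintegral_const, prod_restrict, restrict_apply_univ, prod_prod]
          exact ENNReal.mul_lt_top (ENNReal.mul_lt_top hD.lt_top
            (ENNReal.rpow_lt_top_of_nonneg hq0.le hC))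
            (ENNReal.mul_lt_top hK.measure_lt_top hK.measure_lt_top)
  by_contra htop
  rw [not_lt_top_iff] at htop
  rw [htop, ENNReal.top_mul hK0] at hgoal
  exact lt_irrefl _ hgoal

/-- Conversely, the oscillation condition controls differences with translates by small elements. -/
theorem exists_nhds_eLpNorm_translate_le [Fact (1 ≤ p)] (hp : p ≠ ⊤) {w : G → ℝ}
    (hw : AEStronglyMeasurable w μ) {B : Set G} (hB : B ∈ 𝓝 (1 : G))
    (hI : ∫⁻ g, (⨅ c : ℝ, eLpNorm (fun x => w x - c) p
      (μ.restrict ((fun x => g * x) '' B))) ^ p.toReal ∂μ < ⊤) :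
    ∃ V ∈ 𝓝 (1 : G), ∃ C : ℝ≥0∞, C ≠ ⊤ ∧ ∀ y ∈ V,
      eLpNorm (fun x => w (x * y) - w x) p μ ≤ C := by
  have hp1 : 1 ≤ p := Fact.out
  have h0 : p ≠ 0 := (zero_lt_one.trans_le hp1).ne'
  have hq0 := ENNReal.toReal_pos h0 hp
  obtain ⟨V, hVo, hV1, hVB⟩ : ∃ V : Set G, IsOpen V ∧ (1 : G) ∈ V ∧
      ∀ x ∈ V, ∀ y ∈ V, x * y ∈ B := by
    obtain ⟨V, hVo, hV1, hVB⟩ := exists_open_nhds_one_mul_subset hB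
    exact ⟨V, hVo, hV1, fun x hx y hy => hVB (Set.mul_mem_mul hx hy)⟩
  let N : Set G := {y | (modularCharacterFun y : ℝ≥0∞) < 2}
  have hN : N ∈ 𝓝 (1 : G) := by
    have h1 : Continuous fun y : G => (modularCharacterFun y : ℝ≥0∞) :=
      ENNReal.continuous_coe.comp continuous_modularCharacterFun
    refine (isOpen_lt h1 continuous_const).mem_nhds ?_
    show (modularCharacterFun (1 : G) : ℝ≥0∞) < 2
    rw [modularCharacterFun_map_one]
    exact_mod_cast one_lt_two
  set I := ∫⁻ g, (⨅ c : ℝ, eLpNorm (fun x => w x - c) p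
      (μ.restrict ((fun x => g * x) '' B))) ^ p.toReal ∂μ with hIdef
  -- Integrating `|k (g v)|^p` over `g ∈ G` and `v ∈ V` gives `W` times the norm of `k` to the power
  -- `p`; since `W` is non-zero, it can be divided out.
  let W : ℝ≥0∞ := ∫⁻ v in V, (modularCharacterFun v : ℝ≥0∞) ∂μ
  have hW0 : W ≠ 0 := by
    have hc : Measurable fun v : G => (modularCharacterFun v : ℝ≥0∞) :=
      (ENNReal.continuous_coe.comp continuous_modularCharacterFun).measurable
    intro hW
    rw [lintegral_eq_zero_iff hc] at hW
    have h1 : ∀ᵐ v ∂μ.restrict V, False := by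
      filter_upwards [hW] with v hv
      exact (modularCharacterFun_pos v).ne' (by simpa using hv)
    rw [eventually_false_iff_eq_bot, ae_eq_bot, restrict_eq_zero] at h1
    exact (hVo.measure_pos μ ⟨1, hV1⟩).ne' h1
  -- In the factor `2 ^ (1 / p) + 1`, the first term bounds the part translated by `y`, as the
  -- modular function is less than `2` on `N`, and the second bounds the untranslated part. Both
  -- parts stay in `g B` because `V V ⊆ B`.
  refine ⟨V ∩ N, inter_mem (hVo.mem_nhds hV1) hN,
    (((2 ^ p.toReal⁻¹ + 1) ^ p.toReal * I) / W) ^ p.toReal⁻¹, ?_, fun y hy => ?_⟩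
  · refine ENNReal.rpow_ne_top_of_nonneg (by positivity) (ENNReal.div_ne_top
      (ENNReal.mul_ne_top (ENNReal.rpow_ne_top_of_nonneg hq0.le ?_) hI.ne) hW0)
    exact ENNReal.add_ne_top.2 ⟨ENNReal.rpow_ne_top_of_nonneg (by positivity) (by simp), by simp⟩
  have hwy : AEStronglyMeasurable (fun x => w (x * y)) μ :=
    hw.comp_quasiMeasurePreserving (quasiMeasurePreserving_mul_right' μ y)
  let k : G → ℝ := fun x => w (x * y) - w x
  have hk : AEStronglyMeasurable k μ := hwy.sub hw
  have hleft {f : G → ℝ} (hf : AEStronglyMeasurable f μ) (g : G) :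
      AEStronglyMeasurable (fun x => f (g * x)) μ :=
    hf.comp_quasiMeasurePreserving (measurePreserving_mul_left μ g).quasiMeasurePreserving
  -- the local estimate
  have hloc (g : G) : eLpNorm (fun v => k (g * v)) p (μ.restrict V) ≤
      (2 ^ p.toReal⁻¹ + 1) * ⨅ c : ℝ, eLpNorm (fun x => w x - c) p
        (μ.restrict ((fun x => g * x) '' B)) := by
    rw [ENNReal.mul_iInf_of_ne (by simp) (ENNReal.add_ne_top.2
      ⟨ENNReal.rpow_ne_top_of_nonneg (by positivity) (by simp), by simp⟩)]
    refine le_iInf fun c => ?_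
    set VV : Set G := {z | g⁻¹ * z ∈ V * V}
    have hVVo : IsOpen VV := (hVo.mul_right (t := V)).preimage (continuous_const_mul g⁻¹)
    have hVVB : VV ⊆ (fun x => g * x) '' B := by
      intro z hz
      obtain ⟨a, ha, b, hb, hab⟩ := hz
      exact ⟨g⁻¹ * z, by rw [← hab]; exact hVB a ha b hb, by simp⟩
    set R := eLpNorm (fun x => w x - c) p (μ.restrict ((fun x => g * x) '' B)) with hR
    have hVVR : ∫⁻ x in VV, ‖w x - c‖ₑ ^ p.toReal ∂μ ≤ R ^ p.toReal := by
      rw [← eLpNorm_rpow_toReal h0 hp]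
      gcongr
      exact eLpNorm_mono_measure _ (restrict_mono hVVB le_rfl)
    have h1 : eLpNorm (fun v => w (g * v) - c) p (μ.restrict V) ≤ R := by
      rw [← ENNReal.rpow_le_rpow_iff hq0, eLpNorm_rpow_toReal h0 hp]
      refine le_trans ?_ hVVR
      rw [← lintegral_indicator hVo.measurableSet, ← lintegral_indicator hVVo.measurableSet,
        ← lintegral_mul_left_eq_self (VV.indicator _) g]
      refine lintegral_mono fun v => ?_
      by_cases hv : v ∈ V
      · have : g * v ∈ VV := by
          show g⁻¹ * (g * v) ∈ V * V
          rw [inv_mul_cancel_left]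
          exact ⟨v, hv, 1, hV1, mul_one v⟩
        simp [hv, this]
      · simp [hv]
    have h2 : eLpNorm (fun v => w (g * v * y) - c) p (μ.restrict V) ≤ 2 ^ p.toReal⁻¹ * R := by
      rw [← ENNReal.rpow_le_rpow_iff hq0, eLpNorm_rpow_toReal h0 hp,
        ENNReal.mul_rpow_of_nonneg _ _ hq0.le, ← ENNReal.rpow_mul, inv_mul_cancel₀ hq0.ne',
        ENNReal.rpow_one]
      calc ∫⁻ v in V, ‖w (g * v * y) - c‖ₑ ^ p.toReal ∂μ
          ≤ ∫⁻ v, VV.indicator (fun x => ‖w x - c‖ₑ ^ p.toReal) (g * (v * y)) ∂μ := by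
            rw [← lintegral_indicator hVo.measurableSet]
            refine lintegral_mono fun v => ?_
            by_cases hv : v ∈ V
            · have : g * (v * y) ∈ VV := by
                show g⁻¹ * (g * (v * y)) ∈ V * V
                rw [inv_mul_cancel_left]
                exact ⟨v, hv, y, hy.1, rfl⟩
              simp [hv, this, mul_assoc]
            · simp [hv]
        _ = modularCharacterFun y * ∫⁻ x in VV, ‖w x - c‖ₑ ^ p.toReal ∂μ := by
            rw [lintegral_mul_right μ (fun v => VV.indicator (fun x => ‖w x - c‖ₑ ^ p.toReal)
              (g * v)), lintegral_mul_left_eq_self, lintegral_indicator hVVo.measurableSet]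
        _ ≤ 2 * R ^ p.toReal := by
            gcongr
            exact hy.2.le
    have e : (fun v => k (g * v)) = (fun v => w (g * v * y) - c) - fun v => w (g * v) - c := by
      funext v
      simp [k]
    rw [e, add_mul, one_mul]
    exact (eLpNorm_sub_le ((hleft hwy g).restrict.sub aestronglyMeasurable_const)
      ((hleft hw g).restrict.sub aestronglyMeasurable_const) hp1).trans (add_le_add h2 h1)
  -- integration of the local estimate
  have hkq : AEMeasurable (fun z : G × G => ‖k (z.2 * z.1)‖ₑ ^ p.toReal) ((μ.restrict V).prod μ) :=
    (aestronglyMeasurable_mul_curve (ν := μ.restrict V) μ continuous_id hk).enorm.pow_const _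
  have hfin : eLpNorm k p μ ^ p.toReal * W ≤ (2 ^ p.toReal⁻¹ + 1) ^ p.toReal * I := by
    calc eLpNorm k p μ ^ p.toReal * W
        = ∫⁻ v in V, ∫⁻ g, ‖k (g * v)‖ₑ ^ p.toReal ∂μ ∂μ := by
          rw [eLpNorm_rpow_toReal h0 hp, mul_comm]
          simp only [lintegral_mul_right μ (fun x => ‖k x‖ₑ ^ p.toReal)]
          rw [lintegral_mul_const]
          exact (ENNReal.continuous_coe.comp continuous_modularCharacterFun).measurable
      _ = ∫⁻ g, ∫⁻ v in V, ‖k (g * v)‖ₑ ^ p.toReal ∂μ ∂μ :=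
          lintegral_lintegral_swap (f := fun v g => ‖k (g * v)‖ₑ ^ p.toReal) hkq
      _ ≤ ∫⁻ g, (2 ^ p.toReal⁻¹ + 1) ^ p.toReal * (⨅ c : ℝ, eLpNorm (fun x => w x - c) p
            (μ.restrict ((fun x => g * x) '' B))) ^ p.toReal ∂μ := by
          refine lintegral_mono fun g => ?_
          rw [← ENNReal.mul_rpow_of_nonneg _ _ hq0.le, ← eLpNorm_rpow_toReal h0 hp]
          exact ENNReal.rpow_le_rpow (hloc g) hq0.le
      _ = _ := lintegral_const_mul' _ _ (ENNReal.rpow_ne_top_of_nonneg hq0.le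
          (ENNReal.add_ne_top.2 ⟨ENNReal.rpow_ne_top_of_nonneg (by positivity) (by simp), by simp⟩))
  have hWtop : W ≠ ⊤ ∨ (2 ^ p.toReal⁻¹ + 1) ^ p.toReal * I ≠ ⊤ := Or.inr
    (ENNReal.mul_ne_top (ENNReal.rpow_ne_top_of_nonneg hq0.le
      (ENNReal.add_ne_top.2 ⟨ENNReal.rpow_ne_top_of_nonneg (by positivity) (by simp), by simp⟩)) hI.ne)
  rw [← ENNReal.rpow_le_rpow_iff hq0, ← ENNReal.rpow_mul, inv_mul_cancel₀ hq0.ne', ENNReal.rpow_one]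
  exact (ENNReal.le_div_iff_mul_le (Or.inl hW0) hWtop).2 hfin

end Translates

/-! ### Functions with `L^p` gradient lie in `d⁻¹dL^p` -/

section DInv

open Measure

variable {E : Type*} [NormedAddCommGroup E] [NormedSpace ℝ E] [FiniteDimensional ℝ E]
  {G : Type*} [TopologicalSpace G] [ChartedSpace E G] [Group G] [LieGroup 𝓘(ℝ, E) ∞ G]
  [T2Space G] [IsTopologicalGroup G] [SecondCountableTopology G] [LocallyCompactSpace G]
  [MeasurableSpace G] [BorelSpace G] {μ : Measure G} [μ.IsHaarMeasure]
  {p : ℝ≥0∞} [Fact (1 ≤ p)]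

theorem HasLpTranslates.mem_dInvDLp (hp : p ≠ ⊤) {u : G → ℝ} (hu : HasLpTranslates μ p u) :
    u ∈ dInvDLp E μ p := by
  obtain ⟨K, hK, -, hBK⟩ := exists_isCompact_unitBall_subset (E := E) (G := G)
  refine ⟨hu.memLp, hu.lintegral_iInf_lt_top hp hK ?_ hBK⟩
  exact (measure_pos_of_mem_nhds μ (mem_of_superset (unitBall_mem_nhds (E := E)) hBK)).ne'

/-- The differences with right translates are the values of the cocycle of `α`, which is continuous
and so bounded on compact sets. -/
theorem HasWeakDifferential.hasLpTranslates [ConnectedSpace G] (hp : p ≠ ⊤)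
    (hμ : μ Set.univ = ⊤) {u : G → ℝ} {α : Lp (E →L[ℝ] ℝ) p μ} (hu : HasWeakDifferential μ u α) :
    HasLpTranslates μ p u := by
  obtain ⟨F, hF⟩ := exists_isCocycle (E := E) hp hμ
    (show α ∈ closedForms (G := G) E μ p from isClosed_of_hasWeakDifferential μ hu)
  obtain ⟨h1, h2⟩ := hu.of_isCocycle hp hF
  refine ⟨h1, fun A hA => ?_⟩
  obtain ⟨C, hC⟩ := hA.exists_bound_of_continuousOn (hF.continuous hp).continuousOn
  refine ⟨ENNReal.ofReal C, ENNReal.ofReal_ne_top, fun h hh => ?_⟩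
  rw [eLpNorm_congr_ae (h2 h), ← Lp.enorm_def, ← ofReal_norm]
  exact ENNReal.ofReal_le_ofReal (hC h hh)

end DInv

/-! ### Smoothing by convolution, and realization of invariant functions -/

section Convolution

open Measure

variable {E : Type*} [NormedAddCommGroup E] [NormedSpace ℝ E] [FiniteDimensional ℝ E]
  {G : Type*} [TopologicalSpace G] [ChartedSpace E G] [Group G] [LieGroup 𝓘(ℝ, E) ∞ G]
  [T2Space G] [IsTopologicalGroup G] [SecondCountableTopology G] [LocallyCompactSpace G]
  [MeasurableSpace G] [BorelSpace G] (μ : Measure G) [μ.IsHaarMeasure]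

/-- The left translate `x ↦ φ (g x)` of a test function. -/
def leftTranslate (g : G) (φ : TestFunction E G) : TestFunction E G :=
  ⟨fun x => φ.1 (g * x), φ.2.1.comp contMDiff_mul_left,
    φ.2.2.comp_homeomorph (Homeomorph.mulLeft g)⟩

theorem derivAlong_leftTranslate (φ : TestFunction E G) (v : GroupLieAlgebra 𝓘(ℝ, E) G) (g : G) :
    derivAlong v (leftTranslate g φ) = leftTranslate g (derivAlong v φ) := by
  refine Subtype.ext (funext fun x => derivAlong_eq ?_)
  have h := hasDerivAt_mul_expCurve φ v (g * x) 0
  simpa [leftTranslate, mul_assoc, expCurve_zero] using h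

theorem derivAlong_eq_zero_of_notMem_tsupport {φ : TestFunction E G}
    (v : GroupLieAlgebra 𝓘(ℝ, E) G) {x : G} (hx : x ∉ tsupport φ.1) : (derivAlong v φ).1 x = 0 := by
  have h0 : φ.1 =ᶠ[𝓝 x] fun _ => (0 : ℝ) := notMem_tsupport_iff_eventuallyEq.mp hx
  show mfderiv 𝓘(ℝ, E) 𝓘(ℝ, ℝ) φ.1 x (mulInvariantVectorField v x) = (0 : ℝ)
  rw [h0.mfderiv_eq, mfderiv_const]
  rfl

/-- The convolution of a locally integrable function with a test function. -/
def conv (w : G → ℝ) (f : TestFunction E G) (x : G) : ℝ := ∫ z, w z * f.1 (z⁻¹ * x) ∂μ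

variable {μ} {w : G → ℝ}

theorem integrable_conv (hw : LocallyIntegrable w μ) (f : TestFunction E G) (x : G) :
    Integrable (fun z => w z * f.1 (z⁻¹ * x)) μ := by
  have h1 : Continuous fun z : G => f.1 (z⁻¹ * x) :=
    (continuous_testFunction f).comp (continuous_inv.mul continuous_const)
  have h2 : HasCompactSupport fun z : G => f.1 (z⁻¹ * x) :=
    f.2.2.comp_homeomorph ((Homeomorph.inv G).trans (Homeomorph.mulRight x))
  have h3 := hw.integrable_smul_right_of_hasCompactSupport h1 h2
  simpa [mul_comm] using h3

theorem conv_eq (w : G → ℝ) (f : TestFunction E G) (x : G) :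
    conv μ w f x = ∫ y, w (x * y) * f.1 y⁻¹ ∂μ := by
  rw [conv, ← integral_mul_left_eq_self _ x]
  simp [mul_assoc]

theorem integrable_conv' (hw : LocallyIntegrable w μ) (f : TestFunction E G) (x : G) :
    Integrable (fun y => w (x * y) * f.1 y⁻¹) μ := by
  have h := (integrable_conv hw f x).comp_mul_left x
  simpa [mul_assoc] using h

theorem conv_const (c : ℝ) (f : TestFunction E G) (x : G) :
    conv μ (fun _ => c) f x = c * ∫ y, f.1 y⁻¹ ∂μ := by
  rw [conv_eq, integral_const_mul]

theorem conv_add (hw : LocallyIntegrable w μ) (f g : TestFunction E G) (x : G) :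
    conv μ w (f + g) x = conv μ w f x + conv μ w g x := by
  rw [conv, conv, conv, ← integral_add (integrable_conv hw f x) (integrable_conv hw g x)]
  refine integral_congr_ae (Eventually.of_forall fun z => ?_)
  exact mul_add _ _ _

theorem conv_smul (c : ℝ) (f : TestFunction E G) (x : G) :
    conv μ w (c • f) x = c * conv μ w f x := by
  rw [conv, conv, ← integral_const_mul]
  refine integral_congr_ae (Eventually.of_forall fun z => ?_)
  exact mul_left_comm _ _ _

theorem integral_conv_mul (hw : LocallyIntegrable w μ) (f ψ : TestFunction E G) :
    ∫ x, conv μ w f x * ψ.1 x ∂μ =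
      ∫ z, w z * ∫ x, (leftTranslate z⁻¹ f).1 x * ψ.1 x ∂μ ∂μ := by
  set K := tsupport ψ.1 with hK
  have hKc : IsCompact K := ψ.2.2
  let S : Set G := (fun q : G × G => q.1 * q.2⁻¹) '' (K ×ˢ tsupport f.1)
  have hS : IsCompact S := (hKc.prod f.2.2).image (continuous_fst.mul continuous_snd.inv)
  have hfc : Continuous fun q : G × G => f.1 (q.2⁻¹ * q.1) * ψ.1 q.1 :=
    ((continuous_testFunction f).comp (continuous_snd.inv.mul continuous_fst)).mul
      ((continuous_testFunction ψ).comp continuous_fst)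
  obtain ⟨M, hM⟩ : ∃ M, ∀ x, ‖f.1 x‖ ≤ M :=
    (continuous_testFunction f).bounded_above_of_compact_support f.2.2
  obtain ⟨N, hN⟩ : ∃ N, ∀ x, ‖ψ.1 x‖ ≤ N :=
    (continuous_testFunction ψ).bounded_above_of_compact_support ψ.2.2
  have hint : Integrable (fun q : G × G => w q.2 * f.1 (q.2⁻¹ * q.1) * ψ.1 q.1) (μ.prod μ) := by
    have h1 : Integrable (K.indicator fun _ => (1 : ℝ)) μ :=
      (integrable_indicator_iff hKc.measurableSet).2 (integrableOn_const hKc.measure_lt_top.ne)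
    have h2 : Integrable (S.indicator w) μ :=
      (integrable_indicator_iff hS.measurableSet).2 (hw.integrableOn_isCompact hS)
    have h3 := (h1.mul_prod h2).mul_bdd (c := M * N) hfc.aestronglyMeasurable
      (Eventually.of_forall fun q => by
        rw [norm_mul]
        exact mul_le_mul (hM _) (hN _) (norm_nonneg _) ((norm_nonneg _).trans (hM 1)))
    refine h3.congr (Eventually.of_forall fun q => ?_)
    by_cases hq1 : q.1 ∈ K
    · by_cases hq2 : q.2 ∈ S
      · simp [hq1, hq2, mul_assoc]
      · have : f.1 (q.2⁻¹ * q.1) = 0 := by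
          by_contra hne
          exact hq2 ⟨(q.1, q.2⁻¹ * q.1), ⟨hq1, subset_tsupport _ hne⟩, by simp⟩
        simp [this]
    · have : ψ.1 q.1 = 0 := image_eq_zero_of_notMem_tsupport hq1
      simp [this]
  calc ∫ x, conv μ w f x * ψ.1 x ∂μ
      = ∫ x, ∫ z, w z * f.1 (z⁻¹ * x) * ψ.1 x ∂μ ∂μ := by
        refine integral_congr_ae (Eventually.of_forall fun x => ?_)
        exact (integral_mul_const _ _).symm
    _ = ∫ z, ∫ x, w z * f.1 (z⁻¹ * x) * ψ.1 x ∂μ ∂μ := integral_integral_swap hint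
    _ = _ := by
        refine integral_congr_ae (Eventually.of_forall fun z => ?_)
        simp only [mul_assoc]
        exact integral_const_mul _ _

/-- The convolution superposes left translates of `f`, and these commute with left-invariant fields,
so the derivative falls on `f`. -/
theorem integral_conv_mul_adjDeriv (hw : LocallyIntegrable w μ) (f φ : TestFunction E G)
    (v : GroupLieAlgebra 𝓘(ℝ, E) G) :
    -∫ x, conv μ w f x * (adjDeriv μ v φ).1 x ∂μ = ∫ x, conv μ w (derivAlong v f) x * φ.1 x ∂μ := by
  rw [integral_conv_mul hw, integral_conv_mul hw, ← integral_neg]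
  refine integral_congr_ae (Eventually.of_forall fun z => ?_)
  simp only
  rw [← derivAlong_leftTranslate, ← mul_neg]
  congr 1
  have h := integral_mul_derivAlong μ φ (leftTranslate z⁻¹ f) v
  simp only [mul_comm] at h ⊢
  exact h.symm

/-- Convolving the constant `1` with `f` gives a constant, whose differential is zero. This
cancellation puts the gradient of a convolution in `L^p`. -/
theorem integral_derivAlong_inv (f : TestFunction E G) (v : GroupLieAlgebra 𝓘(ℝ, E) G) :
    ∫ y, (derivAlong v f).1 y⁻¹ ∂μ = 0 := by
  obtain ⟨φ, hφ⟩ := exists_testFunction_integral_ne_zero (E := E) μ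
  have h := integral_conv_mul_adjDeriv (μ := μ) (locallyIntegrable_const (1 : ℝ)) f φ v
  have h0 := congrFun (congrFun (distD_const (E := E) (G := G) μ (∫ y, f.1 y⁻¹ ∂μ)) v) φ
  simp only [conv_const, one_mul] at h
  have h1 : (∫ y, (derivAlong v f).1 y⁻¹ ∂μ) * ∫ x, φ.1 x ∂μ = 0 := by
    rw [← integral_const_mul]
    exact h.symm.trans h0
  exact (mul_eq_zero.1 h1).resolve_right hφ

variable {p : ℝ≥0∞}

/-- The function is the integral of `w (x y) - w x` against `f y⁻¹`, so the uniform bound on `V`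
passes to it by Jensen. It is used with mean one, to compare `w` with its smoothing, and with mean
zero, to bound the gradient. -/
theorem memLp_conv_sub (hp1 : 1 ≤ p) (hp : p ≠ ⊤) (hw : LocallyIntegrable w μ) {V : Set G}
    (hVo : IsOpen V) (hV1 : (1 : G) ∈ V) (hVfin : μ V ≠ ⊤) {C : ℝ≥0∞} (hC : C ≠ ⊤)
    (hb : ∀ y ∈ V, eLpNorm (fun x => w (x * y) - w x) p μ ≤ C) (f : TestFunction E G)
    (hf : ∀ y, f.1 y⁻¹ ≠ 0 → y ∈ V) :
    MemLp (fun x => conv μ w f x - (∫ y, f.1 y⁻¹ ∂μ) * w x) p μ := by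
  have h0 : p ≠ 0 := (zero_lt_one.trans_le hp1).ne'
  have hq0 := ENNReal.toReal_pos h0 hp
  have hq : 1 ≤ p.toReal := by simpa using ENNReal.toReal_mono hp hp1
  have hwm := hw.aestronglyMeasurable
  have hfc : Continuous fun y : G => f.1 y⁻¹ := (continuous_testFunction f).comp continuous_inv
  have hfs : HasCompactSupport fun y : G => f.1 y⁻¹ := f.2.2.comp_homeomorph (Homeomorph.inv G)
  obtain ⟨M, hM⟩ : ∃ M, ∀ x, ‖f.1 x‖ ≤ M :=
    (continuous_testFunction f).bounded_above_of_compact_support f.2.2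
  have hV0 : μ V ≠ 0 := (hVo.measure_pos μ ⟨1, hV1⟩).ne'
  have e (x : G) : conv μ w f x - (∫ y, f.1 y⁻¹ ∂μ) * w x =
      ∫ y, (w (x * y) - w x) * f.1 y⁻¹ ∂μ := by
    rw [conv_eq, ← integral_mul_const,
      ← integral_sub (integrable_conv' hw f x)
        ((hfc.integrable_of_hasCompactSupport hfs).mul_const _)]
    refine integral_congr_ae (Eventually.of_forall fun y => ?_)
    simp only
    ring
  simp only [e]
  have hm (ν : Measure G) [SFinite ν] :
      AEStronglyMeasurable (fun z : G × G => w (z.2 * z.1) - w z.2) (ν.prod μ) :=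
    (aestronglyMeasurable_mul_curve (ν := ν) μ continuous_id hwm).sub hwm.comp_snd
  refine ⟨?_, ?_⟩
  · exact (((hm μ).mul (hfc.comp continuous_fst).aestronglyMeasurable).prod_swap).integral_prod_right'
  let ν : Measure G := (μ V)⁻¹ • μ.restrict V
  have hν : IsProbabilityMeasure ν :=
    ⟨by simp [ν, ENNReal.inv_mul_cancel hV0 hVfin]⟩
  have hle (x : G) : ‖∫ y, (w (x * y) - w x) * f.1 y⁻¹ ∂μ‖ₑ ≤
      ENNReal.ofReal M * μ V * ∫⁻ y, ‖w (x * y) - w x‖ₑ ∂ν := by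
    calc ‖∫ y, (w (x * y) - w x) * f.1 y⁻¹ ∂μ‖ₑ
        ≤ ∫⁻ y, ‖(w (x * y) - w x) * f.1 y⁻¹‖ₑ ∂μ := enorm_integral_le_lintegral_enorm _
      _ ≤ ∫⁻ y in V, ENNReal.ofReal M * ‖w (x * y) - w x‖ₑ ∂μ := by
          rw [← lintegral_indicator hVo.measurableSet]
          refine lintegral_mono fun y => ?_
          by_cases hy : y ∈ V
          · rw [Set.indicator_of_mem hy, enorm_mul, mul_comm]
            gcongr
            rw [← ofReal_norm]
            exact ENNReal.ofReal_le_ofReal (hM _)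
          · have : f.1 y⁻¹ = 0 := by
              by_contra hne
              exact hy (hf y hne)
            simp [this]
      _ = ENNReal.ofReal M * μ V * ∫⁻ y, ‖w (x * y) - w x‖ₑ ∂ν := by
          rw [lintegral_const_mul' _ _ ENNReal.ofReal_ne_top, lintegral_smul_measure, smul_eq_mul,
            mul_assoc, ← mul_assoc (μ V), ENNReal.mul_inv_cancel hV0 hVfin, one_mul]
  rw [← ENNReal.rpow_lt_top_iff_of_pos hq0, eLpNorm_rpow_toReal h0 hp]
  calc ∫⁻ x, ‖∫ y, (w (x * y) - w x) * f.1 y⁻¹ ∂μ‖ₑ ^ p.toReal ∂μ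
      ≤ ∫⁻ x, (ENNReal.ofReal M * μ V) ^ p.toReal *
          (∫⁻ y, ‖w (x * y) - w x‖ₑ ∂ν) ^ p.toReal ∂μ := by
        refine lintegral_mono fun x => ?_
        rw [← ENNReal.mul_rpow_of_nonneg _ _ hq0.le]
        exact ENNReal.rpow_le_rpow (hle x) hq0.le
    _ = (ENNReal.ofReal M * μ V) ^ p.toReal *
          ∫⁻ x, (∫⁻ y, ‖w (x * y) - w x‖ₑ ∂ν) ^ p.toReal ∂μ :=
        lintegral_const_mul' _ _ (ENNReal.rpow_ne_top_of_nonneg hq0.le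
          (ENNReal.mul_ne_top ENNReal.ofReal_ne_top hVfin))
    _ ≤ (ENNReal.ofReal M * μ V) ^ p.toReal *
          ∫⁻ y, ∫⁻ x, ‖w (x * y) - w x‖ₑ ^ p.toReal ∂μ ∂ν := by
        refine mul_le_mul' le_rfl ?_
        exact lintegral_rpow_lintegral_le (f := fun z : G × G => ‖w (z.2 * z.1) - w z.2‖ₑ)
          (hm ν).enorm hq
    _ ≤ (ENNReal.ofReal M * μ V) ^ p.toReal * ∫⁻ _, C ^ p.toReal ∂ν := by
        gcongr 1
        rw [lintegral_smul_measure, lintegral_smul_measure]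
        gcongr 1
        refine setLIntegral_mono' hVo.measurableSet fun y hy => ?_
        rw [← eLpNorm_rpow_toReal h0 hp]
        exact ENNReal.rpow_le_rpow (hb y hy) hq0.le
    _ < ⊤ := by
        rw [lintegral_const, measure_univ, mul_one]
        exact ENNReal.mul_lt_top (ENNReal.rpow_lt_top_of_nonneg hq0.le
          (ENNReal.mul_ne_top ENNReal.ofReal_ne_top hVfin))
          (ENNReal.rpow_lt_top_of_nonneg hq0.le hC)

variable (μ) in
theorem exists_testFunction_tsupport_subset {U : Set G} (hU : U ∈ 𝓝 (1 : G)) :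
    ∃ χ : TestFunction E G, tsupport χ.1 ⊆ U ∧ ∫ y, χ.1 y⁻¹ ∂μ = 1 := by
  have : IsManifold 𝓘(ℝ, E) ∞ G := inferInstance
  obtain ⟨f, -, hf⟩ := (SmoothBumpFunction.nhds_basis_tsupport (I := 𝓘(ℝ, E)) (1 : G)).mem_iff.1 hU
  let b : TestFunction E G := ⟨f, f.contMDiff, f.hasCompactSupport⟩
  have hbc : Continuous fun y : G => b.1 y⁻¹ := (continuous_testFunction b).comp continuous_inv
  have hbs : HasCompactSupport fun y : G => b.1 y⁻¹ := b.2.2.comp_homeomorph (Homeomorph.inv G)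
  have hpos : 0 < ∫ y, b.1 y⁻¹ ∂μ := by
    refine hbc.integral_pos_of_hasCompactSupport_nonneg_nonzero hbs (fun y => f.nonneg) (x := 1) ?_
    show f 1⁻¹ ≠ 0
    rw [inv_one, f.eq_one]
    exact one_ne_zero
  refine ⟨(∫ y, b.1 y⁻¹ ∂μ)⁻¹ • b, ?_, ?_⟩
  · exact (closure_mono (Function.support_const_smul_subset _ _)).trans hf
  · show ∫ y, (∫ y, b.1 y⁻¹ ∂μ)⁻¹ * b.1 y⁻¹ ∂μ = 1
    rw [integral_const_mul, inv_mul_cancel₀ hpos.ne']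

/-- The differential of the convolution of `w` with `f`. -/
def convForm (hw : LocallyIntegrable w μ) (f : TestFunction E G) (x : G) : E →L[ℝ] ℝ :=
  LinearMap.toContinuousLinearMap
    { toFun := fun v : E => conv μ w (derivAlong (v : GroupLieAlgebra 𝓘(ℝ, E) G) f) x
      map_add' := fun v v' => by
        rw [← conv_add hw]
        exact congrArg (fun g => conv μ w g x) (derivAlong_add_left (G := G) v v' f)
      map_smul' := fun c v => by
        simp only [RingHom.id_apply, smul_eq_mul]
        rw [← conv_smul]
        exact congrArg (fun g => conv μ w g x) (derivAlong_smul_left (G := G) c v f) }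

theorem memLp_of_forall_apply {X : Type*} [MeasurableSpace X] {ν : Measure X}
    {α : X → (E →L[ℝ] ℝ)} (h : ∀ v : E, MemLp (fun x => α x v) p ν) : MemLp α p ν := by
  let b := Module.finBasis ℝ E
  let T : (Fin (Module.finrank ℝ E) → ℝ) →L[ℝ] (E →L[ℝ] ℝ) := LinearMap.toContinuousLinearMap
    ((LinearMap.toContinuousLinearMap (𝕜 := ℝ) (E := E) (F' := ℝ)).toLinearMap ∘ₗ
      (b.constr ℝ).toLinearMap)
  have e (x : X) : T (fun i => α x (b i)) = α x := by
    refine ContinuousLinearMap.coe_injective (b.ext fun i => ?_)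
    exact b.constr_basis ℝ _ i
  have h1 : MemLp (fun x i => α x (b i)) p ν := memLp_pi_iff.2 fun i => h (b i)
  have h2 := T.comp_memLp' h1
  exact (memLp_congr_ae (Eventually.of_forall e)).1 h2

/-- Take for `u` the convolution of `w` with a bump `χ` such that `χ y⁻¹` has mean one and is
supported where translation differences are bounded. The derivatives of `χ` have mean zero after
inversion, so both `u - w` and `du` are in `L^p`. -/
theorem exists_hasWeakDifferential_of_mem_dInvDLp [Fact (1 ≤ p)] (hp : p ≠ ⊤)
    (hw : w ∈ dInvDLp E μ p) : ∃ (u : G → ℝ) (α : Lp (E →L[ℝ] ℝ) p μ),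
      HasWeakDifferential μ u α ∧ MemLp (fun x => u x - w x) p μ := by
  have hp1 : 1 ≤ p := Fact.out
  have hwl : LocallyIntegrable w μ := locallyIntegrable_of_memLp_restrict hp1 hw.1
  obtain ⟨V₀, hV₀, C, hC, hb⟩ := exists_nhds_eLpNorm_translate_le hp hwl.aestronglyMeasurable
    (unitBall_mem_nhds (E := E) (G := G)) hw.2
  obtain ⟨K, hK, hK1⟩ := exists_compact_mem_nhds (1 : G)
  obtain ⟨V, hVs, hVo, hV1⟩ := mem_nhds_iff.1 (inter_mem hV₀ hK1)
  have hVfin : μ V ≠ ⊤ :=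
    ((measure_mono (hVs.trans Set.inter_subset_right)).trans_lt hK.measure_lt_top).ne
  have hU : (fun y : G => y⁻¹) ⁻¹' V ∈ 𝓝 (1 : G) :=
    (hVo.preimage continuous_inv).mem_nhds (by simpa using hV1)
  obtain ⟨χ, hχs, hχ⟩ := exists_testFunction_tsupport_subset (E := E) μ hU
  have hsub (f : TestFunction E G) (hf : ∀ x, x ∉ tsupport χ.1 → f.1 x = 0) :
      MemLp (fun x => conv μ w f x - (∫ y, f.1 y⁻¹ ∂μ) * w x) p μ := by
    refine memLp_conv_sub hp1 hp hwl hVo hV1 hVfin hC (fun y hy => hb y (hVs hy).1) f fun y hy => ?_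
    have h1 : y⁻¹ ∈ tsupport χ.1 := by
      by_contra hn
      exact hy (hf _ hn)
    simpa using hχs h1
  have h1 : MemLp (fun x => conv μ w χ x - w x) p μ := by
    simpa [hχ] using hsub χ fun x hx => image_eq_zero_of_notMem_tsupport hx
  have h2 : MemLp (convForm hwl χ) p μ := by
    have key (v : GroupLieAlgebra 𝓘(ℝ, E) G) : MemLp (conv μ w (derivAlong v χ)) p μ := by
      have h := hsub (derivAlong v χ) fun x hx => derivAlong_eq_zero_of_notMem_tsupport v hx
      rw [integral_derivAlong_inv] at h
      simpa using h
    exact memLp_of_forall_apply fun v => key v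
  refine ⟨conv μ w χ, h2.toLp _, ⟨?_, ?_⟩, h1⟩
  · have h := (h1.locallyIntegrable hp1).add hwl
    have e : (fun x => conv μ w χ x - w x) + w = conv μ w χ := by
      funext x
      simp
    rwa [e] at h
  · rw [formDist_congr μ h2.coeFn_toLp]
    funext v φ
    exact integral_conv_mul_adjDeriv hwl χ φ v

/-- By invariance of `w`, `u (x exp (t ξ)) - w x` is the right translate of `u - w`, an `L^p`
function that the flow contracts to zero. -/
theorem exists_isBoundaryValue_of_mem_invariantSpace [Fact (1 ≤ p)] (hp : p ≠ ⊤)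
    {ξ : GroupLieAlgebra 𝓘(ℝ, E) G} (hξ : 0 < divergence μ ξ) (hw : w ∈ invariantSpace μ p ξ) :
    ∃ (u : G → ℝ) (α : Lp (E →L[ℝ] ℝ) p μ),
      HasWeakDifferential μ u α ∧ IsBoundaryValue μ p ξ u w := by
  obtain ⟨u, α, hu, hd⟩ := exists_hasWeakDifferential_of_mem_dInvDLp hp hw.1
  refine ⟨u, α, hu,
    (locallyIntegrable_of_memLp_restrict Fact.out hw.1.1).aestronglyMeasurable, ?_⟩
  refine (tendsto_eLpNorm_mul_right hp hξ hd).congr fun t => eLpNorm_congr_ae ?_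
  filter_upwards [hw.2 t] with x hx
  rw [hx]

end Convolution

/-! ### The boundary map on cohomology and its image -/

section BoundaryMap

variable {E : Type*} [NormedAddCommGroup E] [NormedSpace ℝ E] [FiniteDimensional ℝ E]
  {G : Type*} [TopologicalSpace G] [ChartedSpace E G] [Group G] [LieGroup 𝓘(ℝ, E) ∞ G]
  [T2Space G] [IsTopologicalGroup G] [SecondCountableTopology G] [LocallyCompactSpace G]
  [MeasurableSpace G] [BorelSpace G] {μ : Measure G} [μ.IsHaarMeasure]
  {ξ : GroupLieAlgebra 𝓘(ℝ, E) G} {p : ℝ≥0∞} [Fact (1 ≤ p)] {u u' v v' : G → ℝ}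

theorem IsBoundaryValue.add (hu : AEStronglyMeasurable u μ) (hu' : AEStronglyMeasurable u' μ)
    (h : IsBoundaryValue μ p ξ u v) (h' : IsBoundaryValue μ p ξ u' v') :
    IsBoundaryValue μ p ξ (u + u') (v + v') := by
  refine ⟨h.1.add h'.1, ?_⟩
  have hm {u : G → ℝ} (hu : AEStronglyMeasurable u μ) (t : ℝ) :
      AEStronglyMeasurable (fun x => u (x * expCurve ξ t)) μ :=
    hu.comp_quasiMeasurePreserving (quasiMeasurePreserving_mul_right' μ _)
  have hl := h.2.add h'.2
  rw [add_zero] at hl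
  refine tendsto_of_tendsto_of_tendsto_of_le_of_le tendsto_const_nhds hl (fun _ => bot_le)
    fun t => ?_
  have e : (fun x => (u + u') (x * expCurve ξ t) - (v + v') x) =
      (fun x => u (x * expCurve ξ t) - v x) + fun x => u' (x * expCurve ξ t) - v' x := by
    funext x
    simp only [Pi.add_apply]
    ring
  simp only [e]
  exact eLpNorm_add_le ((hm hu t).sub h.1) ((hm hu' t).sub h'.1) Fact.out

theorem IsBoundaryValue.smul (c : ℝ) (h : IsBoundaryValue μ p ξ u v) :
    IsBoundaryValue μ p ξ (c • u) (c • v) := by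
  refine ⟨h.1.const_smul c, ?_⟩
  have hl := ENNReal.Tendsto.const_mul (a := ‖c‖ₑ) h.2 (Or.inr enorm_ne_top)
  rw [mul_zero] at hl
  refine hl.congr fun t => ?_
  rw [← eLpNorm_const_smul]
  congr 1
  funext x
  simp [mul_sub]

theorem isBoundaryValue_const (c : ℝ) :
    IsBoundaryValue μ p ξ (fun _ => c) fun _ => c :=
  ⟨aestronglyMeasurable_const, by simp⟩

theorem IsBoundaryValue.congr_left (h : IsBoundaryValue μ p ξ u v) (hu : u =ᵐ[μ] u') :
    IsBoundaryValue μ p ξ u' v := by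
  refine ⟨h.1, h.2.congr fun t => eLpNorm_congr_ae ?_⟩
  filter_upwards [(quasiMeasurePreserving_mul_right' μ (expCurve ξ t)).ae hu] with x hx
  rw [hx]

theorem isBoundaryValue_zero_of_memLp (hp : p ≠ ⊤) (hξ : 0 < divergence μ ξ) (hu : MemLp u p μ) :
    IsBoundaryValue μ p ξ u 0 := by
  refine ⟨aestronglyMeasurable_zero, ?_⟩
  simpa using tendsto_eLpNorm_mul_right hp hξ hu

theorem locallyIntegrable_of_mem_invariantSpace {w : G → ℝ} (hw : w ∈ invariantSpace μ p ξ) :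
    LocallyIntegrable w μ :=
  locallyIntegrable_of_memLp_restrict Fact.out hw.1.1

variable [ConnectedSpace G]

theorem exists_hasWeakDifferential (hp : p ≠ ⊤) (hξ : 0 < divergence μ ξ)
    {α : Lp (E →L[ℝ] ℝ) p μ} (hα : α ∈ closedForms (G := G) E μ p) :
    ∃ u : G → ℝ, HasWeakDifferential μ u α := by
  obtain ⟨F, hF⟩ := exists_isCocycle (E := E) hp (measure_univ_eq_top μ ξ hξ.ne') hα
  obtain ⟨u, -, hu, -⟩ := hF.exists_primitive hp
  exact ⟨u, hu⟩

/-- It is the sum of a function with `L^p` gradient and an `L^p` function; both have differences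
with translates in `L^p`, locally uniformly. -/
theorem boundaryValue_mem_invariantSpace (hp : p ≠ ⊤) (hξ : 0 < divergence μ ξ)
    {α : Lp (E →L[ℝ] ℝ) p μ} (hu : HasWeakDifferential μ u α) :
    boundaryValue ξ u α ∈ invariantSpace μ p ξ := by
  have hp1 : 1 ≤ p := Fact.out
  have hH := memLp_tailIntegral hp hξ (memLp_form_apply μ (Lp.memLp α) (ξ : E))
  exact ⟨((hu.hasLpTranslates hp (measure_univ_eq_top μ ξ hξ.ne')).add hp1
    (hasLpTranslates_of_memLp hp1 hp hH)).mem_dInvDLp hp, boundaryValue_invariant hp hξ hu⟩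

theorem IsBoundaryValue.locallyIntegrable (hp : p ≠ ⊤) (hξ : 0 < divergence μ ξ)
    {α : Lp (E →L[ℝ] ℝ) p μ} (hu : HasWeakDifferential μ u α) (h : IsBoundaryValue μ p ξ u v) :
    LocallyIntegrable v μ :=
  (locallyIntegrable_of_mem_invariantSpace (boundaryValue_mem_invariantSpace hp hξ hu)).congr
    (h.ae_eq hu.1.aestronglyMeasurable (isBoundaryValue_boundaryValue hp hξ hu))

theorem HasWeakDifferential.ae_eq_add_const {α : Lp (E →L[ℝ] ℝ) p μ}
    (hu : HasWeakDifferential μ u α) (hu' : HasWeakDifferential μ u' α) :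
    ∃ c : ℝ, u' =ᵐ[μ] u + fun _ => c := by
  obtain ⟨c, hc⟩ := ae_const_of_distD_eq_zero (E := E) μ (hu'.1.sub hu.1) (by
    rw [distD_sub μ hu'.1 hu.1, hu.2, hu'.2, sub_self])
  refine ⟨c, ?_⟩
  filter_upwards [hc] with x hx
  rw [Pi.add_apply, ← hx, Pi.sub_apply, add_sub_cancel]

theorem IsBoundaryValue.ae_eq_add_const {α : Lp (E →L[ℝ] ℝ) p μ}
    (hu : HasWeakDifferential μ u α) (hu' : HasWeakDifferential μ u' α)
    (h : IsBoundaryValue μ p ξ u v) (h' : IsBoundaryValue μ p ξ u' v') :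
    ∃ c : ℝ, v' =ᵐ[μ] v + fun _ => c := by
  obtain ⟨c, hc⟩ := hu.ae_eq_add_const hu'
  exact ⟨c, ((h.add hu.1.aestronglyMeasurable aestronglyMeasurable_const
    (isBoundaryValue_const c)).congr_left hc.symm).ae_eq hu'.1.aestronglyMeasurable h'⟩

theorem HasWeakDifferential.add {α β : Lp (E →L[ℝ] ℝ) p μ} (hu : HasWeakDifferential μ u α)
    (hu' : HasWeakDifferential μ u' β) :
    HasWeakDifferential μ (u + u') (α + β : Lp (E →L[ℝ] ℝ) p μ) :=
  ⟨hu.1.add hu'.1, by rw [formDist_add, distD_add μ hu.1 hu'.1, hu.2, hu'.2]⟩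

theorem HasWeakDifferential.smul (c : ℝ) {α : Lp (E →L[ℝ] ℝ) p μ}
    (hu : HasWeakDifferential μ u α) :
    HasWeakDifferential μ (c • u) (c • α : Lp (E →L[ℝ] ℝ) p μ) :=
  ⟨hu.1.smul c, by rw [formDist_smul, distD_smul, hu.2]⟩

/-- An `L^p` primitive has boundary value zero. Conversely, if the boundary value is a constant,
then `u` minus it is minus the tail integral, which is in `L^p`. -/
theorem mem_exactForms_iff (hp : p ≠ ⊤) (hξ : 0 < divergence μ ξ) {α : Lp (E →L[ℝ] ℝ) p μ}
    (hu : HasWeakDifferential μ u α) (h : IsBoundaryValue μ p ξ u v) :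
    α ∈ exactForms (G := G) E μ p ↔ v ∈ aeConst μ := by
  constructor
  · rintro ⟨w, hw, hwα⟩
    obtain ⟨c, hc⟩ := IsBoundaryValue.ae_eq_add_const hwα hu
      (isBoundaryValue_zero_of_memLp hp hξ hw) h
    rw [zero_add] at hc
    exact ⟨c, hc⟩
  · rintro ⟨c, hc⟩
    have hH := memLp_tailIntegral hp hξ (memLp_form_apply μ (Lp.memLp α) (ξ : E))
    have h1 := h.ae_eq hu.1.aestronglyMeasurable (isBoundaryValue_boundaryValue hp hξ hu)
    have h2 : u =ᵐ[μ] (fun x => -tailIntegral ξ (fun x => α x (ξ : E)) x) + fun _ => c := by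
      filter_upwards [hc, h1] with x hx hx'
      rw [hx, boundaryValue] at hx'
      rw [Pi.add_apply, ← hx']
      ring
    have hl : LocallyIntegrable (fun x => -tailIntegral ξ (fun x => α x (ξ : E)) x) μ :=
      hH.neg.locallyIntegrable Fact.out
    refine ⟨_, hH.neg, hl, ?_⟩
    rw [← hu.2, distD_congr μ h2]
    exact ((distD_add μ hl (locallyIntegrable_const c)).trans (by rw [distD_const, add_zero]; rfl)).symm

/-- A linear invariant of locally integrable functions modulo constants, evaluated on boundary
values, is an injective linear map on `L^p`-cohomology. -/
theorem exists_linearMap_boundaryValue (hp : p ≠ ⊤) (hξ : 0 < divergence μ ξ) {N : Type*}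
    [AddCommGroup N] [Module ℝ N] (m : (G → ℝ) → N)
    (hadd : ∀ v w, LocallyIntegrable v μ → LocallyIntegrable w μ → m (v + w) = m v + m w)
    (hsmul : ∀ (c : ℝ) v, m (c • v) = c • m v)
    (hm : ∀ v, LocallyIntegrable v μ → (m v = 0 ↔ v ∈ aeConst μ)) :
    ∃ Φ : H1p (G := G) E μ p →ₗ[ℝ] N,
      (∀ (α : closedForms (G := G) E μ p) (u v : G → ℝ),
        HasWeakDifferential μ u (α : Lp (E →L[ℝ] ℝ) p μ) → IsBoundaryValue μ p ξ u v →
        Φ (Submodule.Quotient.mk α) = m v) ∧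
      Function.Injective Φ ∧ Set.range Φ = m '' invariantSpace μ p ξ := by
  choose u hu using fun α : closedForms (G := G) E μ p => exists_hasWeakDifferential hp hξ α.2
  have hv (α : closedForms (G := G) E μ p) := isBoundaryValue_boundaryValue hp hξ (hu α)
  -- Another primitive of the same form changes the boundary value by a constant, which `m` kills.
  -- Both linearity and independence of the choices reduce to this.
  have hcongr {α : Lp (E →L[ℝ] ℝ) p μ} {u u' v v' : G → ℝ} (h1 : HasWeakDifferential μ u α)
      (h2 : HasWeakDifferential μ u' α) (h3 : IsBoundaryValue μ p ξ u v)
      (h4 : IsBoundaryValue μ p ξ u' v') : m v' = m v := by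
    obtain ⟨c, hc⟩ := IsBoundaryValue.ae_eq_add_const h1 h2 h3 h4
    have hl := h3.locallyIntegrable hp hξ h1
    have hl' := h4.locallyIntegrable hp hξ h2
    have h5 : m (v' - v) = 0 := by
      refine (hm _ (hl'.sub hl)).2 ⟨c, ?_⟩
      filter_upwards [hc] with x hx
      rw [Pi.sub_apply, hx, Pi.add_apply, add_sub_cancel_left]
    have h6 := hadd _ _ (hl'.sub hl) hl
    rwa [sub_add_cancel, h5, zero_add] at h6
  let Φ₀ : closedForms (G := G) E μ p →ₗ[ℝ] N :=
    { toFun := fun α => m (boundaryValue ξ (u α) (α : Lp (E →L[ℝ] ℝ) p μ))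
      map_add' := fun α β => by
        rw [← hadd _ _ ((hv α).locallyIntegrable hp hξ (hu α))
          ((hv β).locallyIntegrable hp hξ (hu β))]
        exact hcongr ((hu α).add (hu β)) (hu (α + β)) ((hv α).add (hu α).1.aestronglyMeasurable
          (hu β).1.aestronglyMeasurable (hv β)) (hv (α + β))
      map_smul' := fun c α => by
        rw [RingHom.id_apply, ← hsmul]
        exact hcongr ((hu α).smul c) (hu (c • α)) ((hv α).smul c) (hv (c • α)) }
  have hker : (exactForms (G := G) E μ p).comap (closedForms (G := G) E μ p).subtype =
      LinearMap.ker Φ₀ := by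
    ext α
    exact (mem_exactForms_iff hp hξ (hu α) (hv α)).trans
      (hm _ ((hv α).locallyIntegrable hp hξ (hu α))).symm
  refine ⟨Submodule.liftQ _ Φ₀ hker.le, fun α u' v h1 h2 => ?_, ?_, ?_⟩
  · exact hcongr h1 (hu α) h2 (hv α)
  · rw [← LinearMap.ker_eq_bot]
    exact Submodule.ker_liftQ_eq_bot _ _ _ hker.ge
  · ext n
    constructor
    · rintro ⟨a, rfl⟩
      obtain ⟨α, rfl⟩ := Submodule.Quotient.mk_surjective _ a
      exact ⟨_, boundaryValue_mem_invariantSpace hp hξ (hu α), rfl⟩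
    · rintro ⟨w, hw, rfl⟩
      obtain ⟨u', α, h1, h2⟩ := exists_isBoundaryValue_of_mem_invariantSpace hp hξ hw
      let α' : closedForms (G := G) E μ p := ⟨α, isClosed_of_hasWeakDifferential μ h1⟩
      exact ⟨Submodule.Quotient.mk α', hcongr h1 (hu α') h2 (hv α')⟩

theorem distD_eq_zero_iff (hv : LocallyIntegrable v μ) :
    distD (E := E) μ v = 0 ↔ v ∈ aeConst μ := by
  refine ⟨ae_const_of_distD_eq_zero μ hv, ?_⟩
  rintro ⟨c, hc⟩
  rw [distD_congr μ hc, distD_const]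

/-- If `w` is the boundary value of `u`, then `w = u + H` with `H` in `L^p`, so `dw = α + dH`;
invariance makes the derivative along `ξ` vanish. Conversely, if `β + dγ` is closed then so is `β`,
hence `β = du`, and `w = u + γ` is invariant because its derivative along `ξ` is zero. -/
theorem distD_image_invariantSpace (hp : p ≠ ⊤) (hξ : 0 < divergence μ ξ) :
    distD μ '' invariantSpace μ p ξ =
      {T ∈ LpDLp (G := G) E μ p | GenForm.IsClosed μ T ∧ ∀ φ : TestFunction E G, T ξ φ = 0} := by
  have hp1 : 1 ≤ p := Fact.out
  ext T
  constructor
  · rintro ⟨w, hw, rfl⟩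
    have hwl := locallyIntegrable_of_mem_invariantSpace hw
    refine ⟨?_, isClosed_distD μ hwl, fun φ => ?_⟩
    · obtain ⟨u, α, h1, h2⟩ := exists_isBoundaryValue_of_mem_invariantSpace hp hξ hw
      have hH := memLp_tailIntegral hp hξ (memLp_form_apply μ (Lp.memLp α) (ξ : E))
      refine ⟨α, _, hH, ?_⟩
      rw [← h1.2, ← distD_add μ h1.1 (hH.locallyIntegrable hp1)]
      exact distD_congr μ
        ((isBoundaryValue_boundaryValue hp hξ h1).ae_eq h1.1.aestronglyMeasurable h2)
    · refine (weak_derivative_of_translate_sub μ hwl locallyIntegrable_zero ξ (fun t _ => ?_)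
        φ).trans (by simp)
      filter_upwards [hw.2 t] with x hx
      simp [hx]
  · rintro ⟨⟨β, γ, hγ, rfl⟩, hc, hξ0⟩
    have hγl := hγ.locallyIntegrable hp1
    have hβ : β ∈ closedForms (G := G) E μ p := by
      intro v w φ
      have h1 := hc v w φ
      have h2 := isClosed_distD (E := E) μ hγl v w φ
      simp only [Pi.add_apply] at h1
      linarith
    obtain ⟨u, hu⟩ := exists_hasWeakDifferential hp hξ hβ
    have hd : distD μ (u + γ) = formDist μ β + distD μ γ := by
      rw [distD_add μ hu.1 hγl, hu.2]
    refine ⟨u + γ, ⟨((hu.hasLpTranslates hp (measure_univ_eq_top μ ξ hξ.ne')).add hp1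
      (hasLpTranslates_of_memLp hp1 hp hγ)).mem_dInvDLp hp, ae_invariant_of_nonneg fun t ht => ?_⟩,
      hd⟩
    have h := translate_sub_ae_eq μ (hu.1.add hγl) locallyIntegrable_zero ξ (fun φ => by
      have h1 : distD μ (u + γ) ξ φ = 0 := by rw [hd]; exact hξ0 φ
      refine Eq.trans h1 ?_
      simp) ht
    filter_upwards [h] with x hx
    simpa [sub_eq_zero] using hx

end BoundaryMap

/-! ### Vanishing of the torsion -/

section Torsion

open Measure

variable {E : Type*} [NormedAddCommGroup E] [NormedSpace ℝ E] [FiniteDimensional ℝ E]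
  {G : Type*} [TopologicalSpace G] [ChartedSpace E G] [Group G] [LieGroup 𝓘(ℝ, E) ∞ G]
  [T2Space G] [IsTopologicalGroup G] [SecondCountableTopology G] [LocallyCompactSpace G]
  [MeasurableSpace G] [BorelSpace G] {μ : Measure G} [μ.IsHaarMeasure]
  {ξ : GroupLieAlgebra 𝓘(ℝ, E) G} {p : ℝ≥0∞} [Fact (1 ≤ p)]

/-- Hölder's inequality on the compact support of `φ`. -/
theorem continuous_integral_mul_testFunction (φ : TestFunction E G) :
    Continuous fun f : Lp ℝ p μ => ∫ x, f x * φ.1 x ∂μ := by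
  have hp1 : 1 ≤ p := Fact.out
  obtain ⟨M, hM⟩ : ∃ M, ∀ x, ‖φ.1 x‖ ≤ M :=
    (continuous_testFunction φ).bounded_above_of_compact_support φ.2.2
  set K := tsupport φ.1
  have hK : IsCompact K := φ.2.2
  have : IsFiniteMeasure (μ.restrict K) := ⟨by simpa using hK.measure_lt_top⟩
  let D : ℝ≥0∞ := ENNReal.ofReal M * (μ.restrict K) Set.univ ^ (1 / (1 : ℝ≥0∞).toReal - 1 / p.toReal)
  have hr : 0 ≤ 1 / (1 : ℝ≥0∞).toReal - 1 / p.toReal := by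
    rcases eq_or_ne p ⊤ with rfl | hp
    · simp
    · have : 1 ≤ p.toReal := by simpa using ENNReal.toReal_mono hp hp1
      simpa using inv_le_one_of_one_le₀ this
  have hD : D ≠ ⊤ := ENNReal.mul_ne_top ENNReal.ofReal_ne_top
    (ENNReal.rpow_ne_top_of_nonneg hr (measure_ne_top _ _))
  have hi (f : Lp ℝ p μ) : Integrable (fun x => f x * φ.1 x) μ :=
    integrable_mul_testFunction μ ((Lp.memLp f).locallyIntegrable hp1) φ
  refine LipschitzWith.continuous (K := D.toNNReal) fun f g => ?_
  rw [ENNReal.coe_toNNReal hD, Lp.edist_def, edist_eq_enorm_sub, ← integral_sub (hi f) (hi g)]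
  have hfg := ((Lp.memLp f).sub (Lp.memLp g)).1
  calc ‖∫ x, f x * φ.1 x - g x * φ.1 x ∂μ‖ₑ
      ≤ ∫⁻ x, ‖f x * φ.1 x - g x * φ.1 x‖ₑ ∂μ := enorm_integral_le_lintegral_enorm _
    _ ≤ ∫⁻ x in K, ENNReal.ofReal M * ‖(⇑f - ⇑g) x‖ₑ ∂μ := by
        rw [← lintegral_indicator hK.measurableSet]
        refine lintegral_mono fun x => ?_
        by_cases hx : x ∈ K
        · rw [Set.indicator_of_mem hx, ← sub_mul, enorm_mul, mul_comm, Pi.sub_apply]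
          gcongr
          rw [← ofReal_norm]
          exact ENNReal.ofReal_le_ofReal (hM x)
        · have : φ.1 x = 0 := image_eq_zero_of_notMem_tsupport hx
          simp [this]
    _ = ENNReal.ofReal M * eLpNorm (⇑f - ⇑g) 1 (μ.restrict K) := by
        rw [lintegral_const_mul' _ _ ENNReal.ofReal_ne_top, eLpNorm_one_eq_lintegral_enorm]
    _ ≤ ENNReal.ofReal M * (eLpNorm (⇑f - ⇑g) p (μ.restrict K) *
          (μ.restrict K) Set.univ ^ (1 / (1 : ℝ≥0∞).toReal - 1 / p.toReal)) := by
        gcongr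
        exact eLpNorm_le_eLpNorm_mul_rpow_measure_univ hp1 hfg.restrict
    _ ≤ D * eLpNorm (⇑f - ⇑g) p μ := by
        rw [mul_comm (eLpNorm (⇑f - ⇑g) p (μ.restrict K)), ← mul_assoc]
        exact mul_le_mul' le_rfl (eLpNorm_mono_measure _ Measure.restrict_le_self)

theorem continuous_toLp_tailIntegral (hp : p ≠ ⊤) (hξ : 0 < divergence μ ξ) :
    Continuous fun α : Lp (E →L[ℝ] ℝ) p μ =>
      (memLp_tailIntegral hp hξ (memLp_form_apply μ (Lp.memLp α) (ξ : E))).toLp _ := by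
  obtain ⟨C, hC, hCb⟩ := exists_eLpNorm_tailIntegral_le (μ := μ) hp hξ
  have hD : C * enorm (E := E) ξ ≠ ⊤ := ENNReal.mul_ne_top hC enorm_ne_top
  refine LipschitzWith.continuous (K := (C * enorm (E := E) ξ).toNNReal) fun α β => ?_
  rw [ENNReal.coe_toNNReal hD, Lp.edist_toLp_toLp, Lp.edist_def]
  have h (α : Lp (E →L[ℝ] ℝ) p μ) := memLp_form_apply μ (Lp.memLp α) (ξ : E)
  have e : tailIntegral ξ (fun x => α x (ξ : E)) - tailIntegral ξ (fun x => β x (ξ : E)) =ᵐ[μ]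
      tailIntegral ξ (fun x => (⇑α - ⇑β) x (ξ : E)) := by
    filter_upwards [(hCb _ (h α)).1, (hCb _ (h β)).1] with x hx hx'
    exact (integral_sub hx hx').symm
  rw [eLpNorm_congr_ae e, mul_assoc]
  refine (hCb _ (memLp_form_apply μ ((Lp.memLp α).sub (Lp.memLp β)) (ξ : E))).2.2.trans ?_
  gcongr
  exact eLpNorm_form_apply_le μ _ _

/-- A form is exact if and only if minus the tail integral of `α(ξ)` is a primitive of it. Tested
against all `v` and `φ`, this is a family of equations between continuous functions of `α`. -/
theorem isClosed_exactForms [ConnectedSpace G] (hp : p ≠ ⊤) (hξ : 0 < divergence μ ξ) :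
    IsClosed (exactForms (G := G) E μ p : Set (Lp (E →L[ℝ] ℝ) p μ)) := by
  have hp1 : 1 ≤ p := Fact.out
  have hH (α : Lp (E →L[ℝ] ℝ) p μ) :=
    memLp_tailIntegral hp hξ (memLp_form_apply μ (Lp.memLp α) (ξ : E))
  have hset : (exactForms (G := G) E μ p : Set (Lp (E →L[ℝ] ℝ) p μ)) =
      ⋂ (v : GroupLieAlgebra 𝓘(ℝ, E) G) (φ : TestFunction E G),
        {α | ∫ x, (hH α).toLp _ x * (adjDeriv μ v φ).1 x ∂μ =
          ∫ x, (ContinuousLinearMap.apply (E := E) ℝ ℝ v).compLp α x * φ.1 x ∂μ} := by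
    have key (α : Lp (E →L[ℝ] ℝ) p μ) :
        (∀ (v : GroupLieAlgebra 𝓘(ℝ, E) G) (φ : TestFunction E G),
          ∫ x, (hH α).toLp _ x * (adjDeriv μ v φ).1 x ∂μ =
          ∫ x, (ContinuousLinearMap.apply (E := E) ℝ ℝ v).compLp α x * φ.1 x ∂μ) ↔
        distD μ (fun x => -tailIntegral ξ (fun x => α x (ξ : E)) x) = formDist μ α := by
      rw [funext_iff]
      refine forall_congr' fun v => ?_
      rw [funext_iff]
      refine forall_congr' fun φ => ?_
      have e1 : ∫ x, (hH α).toLp _ x * (adjDeriv μ v φ).1 x ∂μ =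
          distD μ (fun x => -tailIntegral ξ (fun x => α x (ξ : E)) x) v φ := by
        rw [distD, ← integral_neg]
        refine integral_congr_ae ?_
        filter_upwards [(hH α).coeFn_toLp] with x hx
        rw [hx]
        ring
      have e2 : ∫ x, (ContinuousLinearMap.apply (E := E) ℝ ℝ v).compLp α x * φ.1 x ∂μ =
          formDist μ α v φ := by
        refine integral_congr_ae ?_
        filter_upwards [ContinuousLinearMap.coeFn_compLp
          (ContinuousLinearMap.apply (E := E) ℝ ℝ v) α] with x hx
        rw [hx]
        rfl
      rw [e1, e2]
    ext α
    simp only [Set.mem_iInter, Set.mem_ofPred_eq]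
    rw [key]
    constructor
    · rintro ⟨u, hu, huα⟩
      have h1 := (isBoundaryValue_zero_of_memLp hp hξ hu).ae_eq hu.1
        (isBoundaryValue_boundaryValue hp hξ huα)
      rw [← huα.2]
      refine distD_congr μ ?_
      filter_upwards [h1] with x hx
      rw [boundaryValue, Pi.zero_apply] at hx
      linarith
    · exact fun h => ⟨_, (hH α).neg, (hH α).neg.locallyIntegrable hp1, h⟩
  rw [hset]
  refine isClosed_iInter fun v => isClosed_iInter fun φ => isClosed_eq ?_ ?_
  · exact (continuous_integral_mul_testFunction (adjDeriv μ v φ)).comp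
      (continuous_toLp_tailIntegral hp hξ)
  · exact (continuous_integral_mul_testFunction φ).comp
      ((ContinuousLinearMap.apply (E := E) ℝ ℝ v).compLpL p μ).continuous

theorem torsion_eq_bot [ConnectedSpace G] (hp : p ≠ ⊤) (hξ : 0 < divergence μ ξ) :
    torsion (G := G) E μ p = ⊥ := by
  rw [torsion, (isClosed_exactForms hp hξ).submodule_topologicalClosure_eq, eq_bot_iff]
  rintro _ ⟨α, hα, rfl⟩
  exact (Submodule.Quotient.mk_eq_zero _).2 hα

end Torsion
end LpCohomology

theorem mainTheorem5
    {E : Type*} [NormedAddCommGroup E] [InnerProductSpace ℝ E] [FiniteDimensional ℝ E]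
    {G : Type*} [TopologicalSpace G] [T2Space G] [SecondCountableTopology G] [ConnectedSpace G]
    [ChartedSpace E G] [Group G] [LieGroup 𝓘(ℝ, E) ∞ G]
    [MeasurableSpace G] [BorelSpace G] (μ : Measure G) [μ.IsHaarMeasure]
    (p : ℝ≥0∞) [Fact (1 ≤ p)] (hp : p ≠ ⊤)
    (ξ₀ : GroupLieAlgebra 𝓘(ℝ, E) G) (hξ₀ : 0 < LpCohomology.divergence μ ξ₀) :
    -- every closed `L^p` form is the differential of a function
    (∀ α ∈ LpCohomology.closedForms (G := G) E μ p,
      ∃ u : G → ℝ, LpCohomology.HasWeakDifferential μ u α) ∧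
    -- every function with `L^p` gradient has a boundary value, which is `ξ₀`-invariant
    (∀ (u : G → ℝ) (α : Lp (E →L[ℝ] ℝ) p μ), LpCohomology.HasWeakDifferential μ u α →
      α ∈ LpCohomology.closedForms (G := G) E μ p ∧
      ∃ v : G → ℝ, LpCohomology.IsBoundaryValue μ p ξ₀ u v ∧
        v ∈ LpCohomology.invariantSpace μ p ξ₀ ∧
        (∀ v' : G → ℝ, LpCohomology.IsBoundaryValue μ p ξ₀ u v' → v' =ᵐ[μ] v) ∧
        ∃ u' : G → ℝ, u' =ᵐ[μ] u ∧
          ∀ᵐ x ∂μ, Tendsto (fun t : ℝ => u' (x * LpCohomology.expCurve ξ₀ t)) atTop (𝓝 (v x))) ∧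
    -- `u ↦ u_∞` induces an injection on cohomology, with image the invariant functions
    (∃ Φ : LpCohomology.H1p (G := G) E μ p →ₗ[ℝ] ((G → ℝ) ⧸ LpCohomology.aeConst μ),
      (∀ (α : LpCohomology.closedForms (G := G) E μ p) (u v : G → ℝ),
        LpCohomology.HasWeakDifferential μ u (α : Lp (E →L[ℝ] ℝ) p μ) →
        LpCohomology.IsBoundaryValue μ p ξ₀ u v →
        Φ (Submodule.Quotient.mk α) = Submodule.Quotient.mk v) ∧
      Function.Injective Φ ∧
      Set.range Φ ⊆ Submodule.Quotient.mk '' LpCohomology.dInvDLp (G := G) E μ p ∧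
      Set.range Φ = Submodule.Quotient.mk '' LpCohomology.invariantSpace μ p ξ₀) ∧
    -- `du ↦ du_∞` induces an injection on cohomology, with image `dB`
    (∃ Ψ : LpCohomology.H1p (G := G) E μ p →ₗ[ℝ] LpCohomology.GenForm E G,
      (∀ (α : LpCohomology.closedForms (G := G) E μ p) (u v : G → ℝ),
        LpCohomology.HasWeakDifferential μ u (α : Lp (E →L[ℝ] ℝ) p μ) →
        LpCohomology.IsBoundaryValue μ p ξ₀ u v →
        Ψ (Submodule.Quotient.mk α) = LpCohomology.distD μ v) ∧
      Function.Injective Ψ ∧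
      Set.range Ψ = LpCohomology.distD μ '' LpCohomology.invariantSpace μ p ξ₀ ∧
      Set.range Ψ = {T ∈ LpCohomology.LpDLp (G := G) E μ p |
        LpCohomology.GenForm.IsClosed μ T ∧ ∀ φ : LpCohomology.TestFunction E G, T ξ₀ φ = 0}) ∧
    -- the torsion vanishes
    LpCohomology.torsion (G := G) E μ p = ⊥ := by
  have := topologicalGroup_of_lieGroup 𝓘(ℝ, E) ∞ (G := G)
  have := ChartedSpace.locallyCompactSpace E G
  refine ⟨fun α hα => LpCohomology.exists_hasWeakDifferential hp hξ₀ hα, fun u α hu => ?_, ?_, ?_,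
    LpCohomology.torsion_eq_bot hp hξ₀⟩
  · have hv := LpCohomology.isBoundaryValue_boundaryValue hp hξ₀ hu
    exact ⟨LpCohomology.isClosed_of_hasWeakDifferential μ hu, _, hv,
      LpCohomology.boundaryValue_mem_invariantSpace hp hξ₀ hu,
      fun v' hv' => hv.ae_eq hu.1.aestronglyMeasurable hv',
      LpCohomology.exists_ae_eq_tendsto hp hξ₀ hu⟩
  -- Both maps are instances of one construction, with `m` the quotient map modulo constants here
  -- and the distributional differential in the next case.
  · obtain ⟨Φ, h1, h2, h3⟩ := LpCohomology.exists_linearMap_boundaryValue (μ := μ) hp hξ₀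
      (LpCohomology.aeConst μ).mkQ (fun v w _ _ => map_add _ v w) (fun c v => map_smul _ c v)
      fun v _ => Submodule.Quotient.mk_eq_zero _
    refine ⟨Φ, h1, h2, ?_, h3⟩
    rw [h3]
    exact Set.image_mono fun w hw => hw.1
  · obtain ⟨Ψ, h1, h2, h3⟩ := LpCohomology.exists_linearMap_boundaryValue (μ := μ) hp hξ₀
      (LpCohomology.distD (E := E) μ) (fun v w hv hw => LpCohomology.distD_add μ hv hw)
      (fun c v => LpCohomology.distD_smul μ c v) fun v hv => LpCohomology.distD_eq_zero_iff hv
    exact ⟨Ψ, h1, h2, h3, h3.trans (LpCohomology.distD_image_invariantSpace hp hξ₀)⟩
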